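/- **Setting.** Let $\Lambda$ be a square domain of side $L>1$: either the $L\times L$ grid graph on $\{0,\dots,L-1\}^2$ (free boundary conditions) or, for even $L$, the $L\times L$ discrete torus (periodic boundary conditions). Let $\mathrm{dist}$ be the graph distance, with $\mathrm{dist}(A,B)=\min_{i\in A,j\in B}\mathrm{dist}(i,j)$ for sets of vertices, $(\Delta_\Lambda f)(j)=\sum_{\ell\sim j}(f_\ell-f_j)$, and $\langle f,g\rangle=\sum_{j}f_jg_j$. For $\beta>0$ and $v\in\Lambda$ let $\mu_{\beta,\Lambda,v}$ be the probability measure on $\mathbb{R}^\Lambda$ with density proportional to $\exp[-\frac{\beta}{2}\sum_{j\sim\ell}(\phi_j-\phi_\ell)^2]\,\mathbf 1_{[-\pi,\pi)}(\phi_v)$, where each edge is counted once. Fix $3/2<\alpha<2$ and $M=2^{16}$; constants called absolute below may depend on $\alpha$. A *density* is a function $\varrho:\Lambda\to\mathbb{Z}$ that is not identically zero; $Q(\varrho)=\sum_j\varrho(j)$ is its charge ($\varrho$ is neutral if $Q(\varrho)=0$), $d(\varrho)$ is the diameter of its support, $\|\varrho\|_2^2=\sum_j\varrho(j)^2$, and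 $\mathrm{dist}(\varrho_1,\varrho_2)$ is the distance of the supports. An *ensemble* is a finite collection of densities with mutually disjoint supports. A $2^k\times2^k$ *square* is a set $\{(c,d)\in\Lambda: c-a,\,d-b\in\{0,\dots,2^k-1\}\}$ with $(a,b)\in\Lambda$ (differences modulo $L$ in the periodic case) that has $2^{2k}$ points; if $2^k>L$, the only square is $\Lambda$. For each density $\varrho$ and $k\ge0$ let $\mathscr S_k(\varrho)$ be a collection of $2^k\times2^k$ squares of minimal cardinality covering the support of $\varrho$ (any choice). For $k\ge1$ put $\mathscr S_k^{\rm sep}(\varrho)=\emptyset$ if $|\mathscr S_k(\varrho)|=1$, and otherwise $\mathscr S_k^{\rm sep}(\varrho)=\{s\in\mathscr S_k(\varrho):\mathrm{dist}(s',s)\ge2M2^{\alpha(k+1)}\ \forall s'\in\mathscr S_k(\varrho)\setminus\{s\}\}$. Put $A(\varrho)=\sum_{k=0}^{n(\varrho)}|\mathscr S_k(\varrho)|$ with $n(\varrho)=\lceil\log_2(M\,d(\varrho)^\alpha)\rceil$ if $d(\varrho)\ge1$, and $A(\varrho)=0$ if $d(\varrho)=0$. For an ensemble $\mathscr N$ and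 real coefficients $(K(\varrho))_{\varrho\in\mathscr N}$ consider the following properties. (a) At most one density in $\mathscr N$ is non-neutral. (b) Distinct $\varrho_1,\varrho_2\in\mathscr N$ satisfy $\mathrm{dist}(\varrho_1,\varrho_2)\ge M[\min(d(\varrho_1),d(\varrho_2))]^\alpha$; and if $\varrho_c\in\mathscr N$ is non-neutral, then $\mathrm{dist}(\varrho,\varrho_c)\ge M\,d(\varrho)^\alpha$ for every $\varrho\in\mathscr N$, $\varrho\ne\varrho_c$. (c) If a neutral $\varrho\in\mathscr N$ is a sum $\varrho_1+\varrho_2$ of densities with disjoint supports and $\mathrm{dist}(\varrho_1,\varrho_2)\ge2M[\min(d(\varrho_1),d(\varrho_2))]^\alpha$, then $\varrho_1,\varrho_2$ are non-neutral. (d) (for a constant $D_2>0$ and trigonometric polynomials $\lambda_j(t)=1+2\sum_{q=1}^{N_j}\hat\lambda_j(q)\cos(qt)$, $j\in\Lambda$, with $N_j\ge 1$, real $\hat\lambda_j(q)$, and $\hat\lambda_j(q)=0$ for $q>N_j$) For every neutral $\varrho\in\mathscr N$, $|K(\varrho)|\le e^{D_2A(\varrho)}\prod_{j\in\mathrm{supp}\,\varrho}e^{\varrho(j)^2}|\hat\lambda_j(|\varrho(j)|)|$.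 The $\lambda_j$ are $(\Gamma,\eta,\theta)$-*sub-Gaussian* if $|\hat\lambda_j(q)|\le\Gamma\exp[(\eta+\theta/\beta)q^2]$ for all $q\ge1$. **Theorem.** There is an absolute constant $D_3>0$ such that the following holds for every square domain $\Lambda$ with free or periodic boundary conditions, every choice of the minimal covers $\mathscr S_k$, every $v\in\Lambda$ and $\beta>0$. Let $\mathscr N$ be an ensemble with properties (a)–(c) and let $K(\varrho)\in\mathbb{R}$ for $\varrho\in\mathscr N$. Then there are functions $a_{\varrho,\mathscr N}:\Lambda\to\mathbb{R}$, not depending on $K$, and real numbers $z(\beta,\varrho,\mathscr N)$, for neutral $\varrho\in\mathscr N$, such that for every $\sigma:\Lambda\to\mathbb{R}$ $$\int\prod_{\varrho\in\mathscr N}\bigl[1+K(\varrho)\cos(\langle\phi,\varrho\rangle+\langle\sigma,\varrho\rangle)\bigr]d\mu_{\beta,\Lambda,v}(\phi)=\int\prod_{\varrho\in\mathscr N,\,Q(\varrho)=0}\bigl[1+z(\beta,\varrho,\mathscr N)\cos(\langle\phi,\varrho+\beta\Delta_\Lambda a_{\varrho,\mathscr N}\rangle+\langle\sigma,\varrho\rangle)\bigr]d\mu_{\beta,\Lambda,v}(\phi),$$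 where $a$ and $z$ do not depend on $\sigma$, and for every neutral $\varrho\in\mathscr N$ $$|z(\beta,\varrho,\mathscr N)|\le|K(\varrho)|\exp\Bigl[-\frac1\beta\Bigl(\frac1{16}\|\varrho\|_2^2+D_3\sum_{k=1}^\infty|\mathscr S_k^{\rm sep}(\varrho)|\Bigr)\Bigr].$$ Moreover, for all $\Gamma>0$, $\eta\in\mathbb{R}$, $0\le\theta<1/16$ and $D_2>0$ there are $\beta_0,c_1>0$, depending only on $\Gamma,\eta,\theta,D_2$ (and $\alpha$), such that the same $z$ satisfy, whenever $0<\beta<\beta_0$, the $\lambda_j$ are $(\Gamma,\eta,\theta)$-sub-Gaussian and (d) holds, $$|z(\beta,\varrho,\mathscr N)|\le\exp\Bigl[-\frac{c_1}\beta\bigl(\|\varrho\|_2^2+\log_2(d(\varrho)+1)\bigr)\Bigr]\qquad\text{for every neutral }\varrho\in\mathscr N.$$ -/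

import Mathlib

open MeasureTheory
open scoped BigOperators

noncomputable section

namespace RenormStep

/-! ### Finite graphs: Laplacian, Dirichlet energy, Gaussian free field -/

section Graph

variable {V : Type} [Fintype V]

/-- The pairing `⟨f, g⟩ = ∑ j, f j * g j`. -/
def pairing (f g : V → ℝ) : ℝ := ∑ j, f j * g j

open Classical in
/-- The finite difference Laplacian `(Δ f)(j) = ∑_{l ∼ j} (f l - f j)`. -/
def laplacian (G : SimpleGraph V) (f : V → ℝ) (j : V) : ℝ :=
  ∑ l, if G.Adj j l then f l - f j else 0

open Classical in
/-- `∑_{j ∼ l} (φ j - φ l)²`, every edge being counted exactly once (the double sum over ordered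
pairs counts it twice, whence the factor `1/2`). -/
def dirichletEnergy (G : SimpleGraph V) (φ : V → ℝ) : ℝ :=
  (1 / 2) * ∑ j, ∑ l, if G.Adj j l then (φ j - φ l) ^ 2 else 0

/-- The unnormalized law of the Gaussian free field: the density
`exp(-(β/2) ∑_{j ∼ l} (φ j - φ l)²) 1_{[-π, π)}(φ v)` against Lebesgue measure on `V → ℝ`. -/
def gffUnnormalized (G : SimpleGraph V) (β : ℝ) (v : V) : Measure (V → ℝ) :=
  (volume.restrict {φ : V → ℝ | φ v ∈ Set.Ico (-Real.pi) Real.pi}).withDensity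
    fun φ => ENNReal.ofReal (Real.exp (-(β / 2) * dirichletEnergy G φ))

/-- The Gaussian free field at inverse temperature `β`, normalized to take values in `[-π, π)`
at `v`: the measure above divided by its total mass. -/
def gff (G : SimpleGraph V) (β : ℝ) (v : V) : Measure (V → ℝ) :=
  (gffUnnormalized G β v Set.univ)⁻¹ • gffUnnormalized G β v

/-! ### Charge densities -/

/-- The support of `ρ`. -/
def supp (ρ : V → ℤ) : Finset V := Finset.univ.filter fun j => ρ j ≠ 0

/-- The real-valued function underlying an integer-valued one. -/
def toReal (ρ : V → ℤ) : V → ℝ := fun j => (ρ j : ℝ)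

/-- The charge `Q(ρ)`. -/
def charge (ρ : V → ℤ) : ℤ := ∑ j, ρ j

/-- The squared Euclidean norm `‖ρ‖₂²`. -/
def normSq (ρ : V → ℤ) : ℝ := ∑ j, (ρ j : ℝ) ^ 2

/-- The graph distance between two (nonempty) sets of vertices: the least distance between
their points. -/
def setDist (G : SimpleGraph V) (A B : Finset V) : ℕ :=
  sInf {n | ∃ i ∈ A, ∃ j ∈ B, G.dist i j = n}

/-- The diameter `d(ρ)` of the support of `ρ`. -/
def diam (G : SimpleGraph V) (ρ : V → ℤ) : ℕ :=
  (supp ρ ×ˢ supp ρ).sup fun p => G.dist p.1 p.2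

/-- The distance between the supports of two densities. -/
def densDist (G : SimpleGraph V) (ρ₁ ρ₂ : V → ℤ) : ℕ := setDist G (supp ρ₁) (supp ρ₂)

/-- A finite collection of charge densities (functions that are not identically zero) with
mutually disjoint supports. -/
def IsEnsemble (N : Finset (V → ℤ)) : Prop :=
  (∀ ρ ∈ N, ρ ≠ 0) ∧ ∀ ρ₁ ∈ N, ∀ ρ₂ ∈ N, ρ₁ ≠ ρ₂ → Disjoint (supp ρ₁) (supp ρ₂)

/-- The constant `M = 2^16`. -/
def M : ℝ := 2 ^ 16

/-- Property (a): there is at most one non-neutral density. -/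
def PropA (N : Finset (V → ℤ)) : Prop :=
  ∀ ρ₁ ∈ N, ∀ ρ₂ ∈ N, charge ρ₁ ≠ 0 → charge ρ₂ ≠ 0 → ρ₁ = ρ₂

/-- Property (b): distinct densities are far from each other on the scale of the smaller of their
diameters, and from the non-neutral density on the scale of their own diameter. -/
def PropB (G : SimpleGraph V) (α : ℝ) (N : Finset (V → ℤ)) : Prop :=
  (∀ ρ₁ ∈ N, ∀ ρ₂ ∈ N, ρ₁ ≠ ρ₂ →
    M * (min (diam G ρ₁ : ℝ) (diam G ρ₂ : ℝ)) ^ α ≤ (densDist G ρ₁ ρ₂ : ℝ)) ∧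
  ∀ ρc ∈ N, charge ρc ≠ 0 → ∀ ρ ∈ N, ρ ≠ ρc →
    M * (diam G ρ : ℝ) ^ α ≤ (densDist G ρ ρc : ℝ)

/-- Property (c): a neutral density does not split into two well separated neutral densities. -/
def PropC (G : SimpleGraph V) (α : ℝ) (N : Finset (V → ℤ)) : Prop :=
  ∀ ρ ∈ N, charge ρ = 0 → ∀ ρ₁ ρ₂ : V → ℤ, ρ₁ ≠ 0 → ρ₂ ≠ 0 →
    Disjoint (supp ρ₁) (supp ρ₂) → ρ = ρ₁ + ρ₂ →
    2 * M * (min (diam G ρ₁ : ℝ) (diam G ρ₂ : ℝ)) ^ α ≤ (densDist G ρ₁ ρ₂ : ℝ) →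
    charge ρ₁ ≠ 0 ∧ charge ρ₂ ≠ 0

end Graph

/-! ### Square domains and square covers -/

/-- Free or periodic boundary conditions. -/
inductive BC
  | free
  | periodic

/-- The vertex set `{0, …, L-1}²`. -/
abbrev Site (L : ℕ) : Type := Fin L × Fin L

open scoped SimpleGraph in
/-- The square domain of side `L`: the `L × L` grid for free boundary conditions, the `L × L`
discrete torus for periodic ones. -/
def domain (bc : BC) (L : ℕ) : SimpleGraph (Site L) :=
  match bc with
  | BC.free => SimpleGraph.pathGraph L □ SimpleGraph.pathGraph L
  | BC.periodic => SimpleGraph.cycleGraph L □ SimpleGraph.cycleGraph L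

/-- The admissible side lengths: `L > 1`, and `L` even for periodic boundary conditions. -/
def Admissible (bc : BC) (L : ℕ) : Prop :=
  match bc with
  | BC.free => 1 < L
  | BC.periodic => 1 < L ∧ Even L

/-- `c - a ∈ {0, …, m-1}`; for periodic boundary conditions, `(c - a) mod L ∈ {0, …, m-1}`. -/
def InWindow (bc : BC) {L : ℕ} (m : ℕ) (a c : Fin L) : Prop :=
  match bc with
  | BC.free => (a : ℕ) ≤ c ∧ (c : ℕ) < a + m
  | BC.periodic => ((c : ℤ) - (a : ℤ)) % (L : ℤ) < (m : ℤ)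

/-- `s` is a `2^k × 2^k` square: it has `2^k · 2^k` points, unless `2^k > L`, when it is the whole
domain. -/
def IsSquareOf (bc : BC) {L : ℕ} (k : ℕ) (s : Finset (Site L)) : Prop :=
  (∃ a b : Fin L, ∀ p : Site L,
    p ∈ s ↔ InWindow bc (2 ^ k) a p.1 ∧ InWindow bc (2 ^ k) b p.2) ∧
  (2 ^ k ≤ L → s.card = 2 ^ k * 2 ^ k) ∧ (L < 2 ^ k → s = Finset.univ)

/-- `C` is a collection of `2^k × 2^k` squares that covers the support of `ρ`. -/
def IsCover (bc : BC) {L : ℕ} (k : ℕ) (ρ : Site L → ℤ) (C : Finset (Finset (Site L))) : Prop :=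
  (∀ s ∈ C, IsSquareOf bc k s) ∧ ∀ j ∈ supp ρ, ∃ s ∈ C, j ∈ s

/-- `S` chooses, for every density `ρ` and every scale `k`, a cover `S k ρ` of `ρ` by
`2^k × 2^k` squares, of minimal cardinality. -/
def IsCoverChoice (bc : BC) {L : ℕ} (S : ℕ → (Site L → ℤ) → Finset (Finset (Site L))) : Prop :=
  ∀ ρ : Site L → ℤ, ρ ≠ 0 → ∀ k : ℕ, IsCover bc k ρ (S k ρ) ∧
    ∀ C : Finset (Finset (Site L)), IsCover bc k ρ C → (S k ρ).card ≤ C.card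

open Classical in
/-- The squares of `S k ρ` that are separated from all the others; none if there is only one
square. -/
def sepSquares (bc : BC) {L : ℕ} (α : ℝ) (S : ℕ → (Site L → ℤ) → Finset (Finset (Site L)))
    (k : ℕ) (ρ : Site L → ℤ) : Finset (Finset (Site L)) :=
  if (S k ρ).card = 1 then ∅
  else (S k ρ).filter fun s => ∀ s' ∈ S k ρ, s' ≠ s →
    2 * M * (2 : ℝ) ^ (α * ((k : ℝ) + 1)) ≤ (setDist (domain bc L) s' s : ℝ)

/-- `∑_{k ≥ 1} |S_k^sep(ρ)|`; all terms with `2^k > L` vanish. -/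
def sepTotal (bc : BC) {L : ℕ} (α : ℝ) (S : ℕ → (Site L → ℤ) → Finset (Finset (Site L)))
    (ρ : Site L → ℤ) : ℝ :=
  ∑' k : ℕ, ((sepSquares bc α S (k + 1) ρ).card : ℝ)

/-- `A(ρ) = ∑_{k = 0}^{n(ρ)} |S_k(ρ)|` with `n(ρ) = ⌈log₂ (M d(ρ)^α)⌉`, and `A(ρ) = 0` when
`d(ρ) = 0`. -/
def coverSum (bc : BC) {L : ℕ} (α : ℝ) (S : ℕ → (Site L → ℤ) → Finset (Finset (Site L)))
    (ρ : Site L → ℤ) : ℝ :=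
  if diam (domain bc L) ρ = 0 then 0
  else ∑ k ∈ Finset.range (⌈Real.logb 2 (M * (diam (domain bc L) ρ : ℝ) ^ α)⌉₊ + 1),
    ((S k ρ).card : ℝ)

/-! ### Single-site weights -/

/-- `f` is the real, even, normalized trigonometric polynomial
`1 + 2 ∑_{q = 1}^n c q cos (q t)` for some `n > 0`, with `c q = 0` for `q > n`. -/
def IsEvenTrigPoly (f : ℝ → ℝ) (c : ℕ → ℝ) : Prop :=
  ∃ n : ℕ, 0 < n ∧ (∀ q, n < q → c q = 0) ∧
    ∀ t : ℝ, f t = 1 + 2 * ∑ q ∈ Finset.Icc 1 n, c q * Real.cos ((q : ℝ) * t)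

/-- `f` is `(Γ, η, θ)`-sub-Gaussian at inverse temperature `β`, with coefficients `c`. -/
def IsSubGaussian (β Γ η θ : ℝ) (f : ℝ → ℝ) (c : ℕ → ℝ) : Prop :=
  IsEvenTrigPoly f c ∧
    ∀ q : ℕ, 1 ≤ q → |c q| ≤ Γ * Real.exp ((η + θ / β) * (q : ℝ) ^ 2)

/-- Property (d) with constant `D₂`: for neutral `ρ` in `N`, the coefficient `K ρ` is bounded by
`exp (D₂ A(ρ)) ∏_{j ∈ supp ρ} exp (ρ(j)²) |c_j(|ρ(j)|)|`. -/
def PropD (bc : BC) {L : ℕ} (α D₂ : ℝ) (S : ℕ → (Site L → ℤ) → Finset (Finset (Site L)))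
    (c : Site L → ℕ → ℝ) (N : Finset (Site L → ℤ)) (K : (Site L → ℤ) → ℝ) : Prop :=
  ∀ ρ ∈ N, charge ρ = 0 →
    |K ρ| ≤ Real.exp (D₂ * coverSum bc α S ρ) *
      ∏ j ∈ supp ρ, Real.exp ((ρ j : ℝ) ^ 2) * |c j (ρ j).natAbs|

end RenormStep

end

open RenormStep

/-!
Both sides are expectations of trigonometric polynomials under a Gaussian field. Translating the
field by `i β a ρ` multiplies the activity of a neutral density `ρ` by
`exp (-⟨a ρ, ρ⟩ + β / 2 * E(a ρ))`, where `E` is the Dirichlet energy, and replaces `ρ` by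
`ρ + β Δ (a ρ)`. All these translations can be made at once if the spin waves `a ρ` of different
densities are orthogonal for `E` and do not see the other densities. The one charged density
averages out, because the field is invariant under constant shifts up to the choice of the pinning
window.

The spin wave of `ρ` is built from `ρ` itself, which gains `‖ρ‖² / 16`, and from one cutoff of
bounded energy around each separated square. By property (c) a separated square carries non-zero
charge, so its cutoff gains a constant. The cutoff is a function of a distance in which the discs
around smaller densities are crossed for free; hence it is constant on those discs, and since
`α ≥ 3/2` makes the discs sparse, its Dirichlet energy is still bounded. Finally the entropy `A(ρ)`
is bounded by `‖ρ‖² + ∑ₖ |S_k^sep(ρ)|`, because squares that are not separated are merged in pairs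
at the next scales, and a rate of growth `α < 2` of the scales makes the resulting series converge.
-/

namespace RenormStep

/-! ### Complex translations of the free field -/

section DirichletForm

variable {V : Type} [Fintype V] (G : SimpleGraph V)

lemma pairing_eq_dotProduct (f g : V → ℝ) : pairing f g = f ⬝ᵥ g := rfl

lemma pairing_const_toReal (c : ℝ) (ρ : V → ℤ) :
    pairing (fun _ => c) (toReal ρ) = c * charge ρ := by
  simp [pairing, toReal, charge, Finset.mul_sum]

open Classical in
/-- The bilinear form `⟨f, -Δ g⟩`, whose diagonal is the Dirichlet energy. -/
noncomputable def dirichletForm : LinearMap.BilinForm ℝ (V → ℝ) :=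
  Matrix.toLinearMap₂' ℝ (G.lapMatrix ℝ)

open Classical in
lemma laplacian_eq_neg_lapMatrix_mulVec (f : V → ℝ) :
    laplacian G f = -(G.lapMatrix ℝ).mulVec f := by
  ext j
  rw [laplacian, ← Finset.sum_filter, Finset.sum_sub_distrib, Finset.sum_const, nsmul_eq_mul,
    ← SimpleGraph.neighborFinset_eq_filter, SimpleGraph.card_neighborFinset_eq_degree,
    Pi.neg_apply, SimpleGraph.lapMatrix_mulVec_apply, neg_sub]

lemma laplacian_sum_smul {ι : Type*} (s : Finset ι) (c : ι → ℝ) (f : ι → V → ℝ) :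
    laplacian G (∑ i ∈ s, c i • f i) = ∑ i ∈ s, c i • laplacian G (f i) := by
  classical
  simp only [laplacian_eq_neg_lapMatrix_mulVec, Matrix.mulVec_sum, Matrix.mulVec_smul, smul_neg,
    Finset.sum_neg_distrib]

lemma laplacian_smul (c : ℝ) (f : V → ℝ) : laplacian G (c • f) = c • laplacian G f := by
  simpa using laplacian_sum_smul G Finset.univ (fun _ : Unit => c) (fun _ => f)

lemma laplacian_add_const (f : V → ℝ) (c : ℝ) :
    laplacian G (f + fun _ => c) = laplacian G f := by
  ext j
  simp [laplacian]

lemma pairing_laplacian (φ f : V → ℝ) : pairing φ (laplacian G f) = -dirichletForm G φ f := by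
  classical
  rw [dirichletForm, Matrix.toLinearMap₂'_apply', laplacian_eq_neg_lapMatrix_mulVec,
    pairing_eq_dotProduct, dotProduct_neg]

lemma dirichletForm_self (f : V → ℝ) : dirichletForm G f f = dirichletEnergy G f := by
  classical
  rw [dirichletForm, SimpleGraph.lapMatrix_toLinearMap₂', dirichletEnergy, div_eq_inv_mul,
    one_div]

lemma dirichletForm_comm (f g : V → ℝ) : dirichletForm G f g = dirichletForm G g f := by
  classical
  rw [dirichletForm, Matrix.toLinearMap₂'_apply', Matrix.toLinearMap₂'_apply',
    ← Matrix.vecMul_transpose, (G.isSymm_lapMatrix (R := ℝ)).eq, dotProduct_comm,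
    Matrix.dotProduct_mulVec]

lemma dirichletEnergy_nonneg (f : V → ℝ) : 0 ≤ dirichletEnergy G f := by
  unfold dirichletEnergy
  positivity

lemma dirichletEnergy_smul (c : ℝ) (f : V → ℝ) :
    dirichletEnergy G (c • f) = c ^ 2 * dirichletEnergy G f := by
  simp only [← dirichletForm_self, map_smul, LinearMap.smul_apply, smul_eq_mul]
  ring

lemma dirichletEnergy_add (f g : V → ℝ) :
    dirichletEnergy G (f + g)
      = dirichletEnergy G f + 2 * dirichletForm G f g + dirichletEnergy G g := by
  simp only [← dirichletForm_self, map_add, LinearMap.add_apply, dirichletForm_comm G g f]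
  ring

lemma dirichletEnergy_add_const (f : V → ℝ) (c : ℝ) :
    dirichletEnergy G (f + fun _ => c) = dirichletEnergy G f := by
  simp [dirichletEnergy]

lemma dirichletForm_eq_zero {f g : V → ℝ}
    (h : ∀ j l, G.Adj j l → (f j - f l) * (g j - g l) = 0) : dirichletForm G f g = 0 := by
  have hadd : dirichletEnergy G (f + g) = dirichletEnergy G f + dirichletEnergy G g := by
    simp only [dirichletEnergy, ← mul_add, ← Finset.sum_add_distrib, Pi.add_apply]
    refine congrArg _ (Finset.sum_congr rfl fun j _ => Finset.sum_congr rfl fun l _ => ?_)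
    split_ifs with hjl
    · linear_combination 2 * h j l hjl
    · simp
  linarith [dirichletEnergy_add G f g]

lemma dirichletEnergy_sum_smul {ι : Type*} (s : Finset ι) (c : ι → ℝ) (f : ι → V → ℝ)
    (h : (s : Set ι).Pairwise fun i i' => dirichletForm G (f i) (f i') = 0) :
    dirichletEnergy G (∑ i ∈ s, c i • f i) = ∑ i ∈ s, c i ^ 2 * dirichletEnergy G (f i) := by
  rw [← dirichletForm_self, map_sum]
  refine Finset.sum_congr rfl fun i hi => ?_
  rw [map_sum, LinearMap.sum_apply, Finset.sum_eq_single_of_mem i hi, dirichletForm_self,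
    dirichletEnergy_smul]
  intro i' hi' hne
  simp [h hi' hi hne]

lemma sq_sub_le_dirichletEnergy (f : V → ℝ) {j l : V} (h : G.Adj j l) :
    (f j - f l) ^ 2 ≤ dirichletEnergy G f := by
  classical
  have hrow : ∀ x y, G.Adj x y →
      (f x - f y) ^ 2 ≤ ∑ y, if G.Adj x y then (f x - f y) ^ 2 else 0 := by
    intro x y hxy
    refine (if_pos hxy).ge.trans
      (Finset.single_le_sum (f := fun y => if G.Adj x y then (f x - f y) ^ 2 else 0)
        (fun y _ => ?_) (Finset.mem_univ y))
    positivity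
  have hrows := Finset.add_le_sum
    (f := fun x => ∑ y, if G.Adj x y then (f x - f y) ^ 2 else 0)
    (fun x _ => by positivity) (Finset.mem_univ j) (Finset.mem_univ l) h.ne
  simp only [dirichletEnergy]
  convert_to _ ≤ 1 / 2 * ∑ x, ∑ y, if G.Adj x y then (f x - f y) ^ 2 else 0
  linarith [hrow j l h, hrow l j h.symm, sub_sq_comm (f j) (f l)]

lemma abs_sub_le_dist_mul_sqrt_dirichletEnergy {G : SimpleGraph V} (hG : G.Connected) (f : V → ℝ)
    (j l : V) : |f j - f l| ≤ G.dist j l * √(dirichletEnergy G f) := by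
  have hwalk : ∀ {j l : V} (p : G.Walk j l), |f j - f l| ≤ p.length * √(dirichletEnergy G f) := by
    intro j l p
    induction p with
    | nil => simp
    | @cons j m l h p ih =>
      have hstep : |f j - f m| ≤ √(dirichletEnergy G f) :=
        Real.abs_le_sqrt (sq_sub_le_dirichletEnergy G f h)
      rw [SimpleGraph.Walk.length_cons]
      push_cast
      linarith [abs_sub_le (f j) (f m) (f l)]
  obtain ⟨p, hp⟩ := hG.exists_walk_length_eq_dist j l
  exact hp ▸ hwalk p

lemma exists_forall_sum_sq_le {G : SimpleGraph V} (hG : G.Connected) (v : V) :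
    ∃ C > 0, ∀ φ : V → ℝ, ∑ j, φ j ^ 2 ≤ C * (φ v ^ 2 + dirichletEnergy G φ) := by
  refine ⟨∑ j, (2 + 2 * (G.dist j v : ℝ) ^ 2),
    Finset.sum_pos (fun j _ => by positivity) ⟨v, Finset.mem_univ v⟩, fun φ => ?_⟩
  rw [Finset.sum_mul]
  refine Finset.sum_le_sum fun j _ => ?_
  have hE := dirichletEnergy_nonneg G φ
  have hdiff : (φ j - φ v) ^ 2 ≤ (G.dist j v : ℝ) ^ 2 * dirichletEnergy G φ := by
    calc (φ j - φ v) ^ 2 = |φ j - φ v| ^ 2 := (sq_abs _).symm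
      _ ≤ (G.dist j v * √(dirichletEnergy G φ)) ^ 2 := by
          gcongr; exact abs_sub_le_dist_mul_sqrt_dirichletEnergy hG φ j v
      _ = _ := by rw [mul_pow, Real.sq_sqrt hE]
  have hd : 0 ≤ (G.dist j v : ℝ) ^ 2 * φ v ^ 2 := by positivity
  nlinarith [sq_nonneg (φ j - 2 * φ v)]

end DirichletForm

section FreeField

variable {V : Type} [Fintype V] (G : SimpleGraph V) (β : ℝ) (v : V)

/-- The configurations with `φ v ∈ [-π, π)`, which carry the free field. -/
def pinned : Set (V → ℝ) := {φ | φ v ∈ Set.Ico (-Real.pi) Real.pi}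

omit [Fintype V] in
lemma measurableSet_pinned : MeasurableSet (pinned v) :=
  measurableSet_Ico.preimage (measurable_pi_apply v)

/-- The Boltzmann weight, i.e. the density of the unnormalized free field. -/
noncomputable def weight (φ : V → ℝ) : ℝ := Real.exp (-(β / 2) * dirichletEnergy G φ)

@[fun_prop]
lemma continuous_dirichletEnergy : Continuous (dirichletEnergy G) := by
  classical
  unfold dirichletEnergy
  refine continuous_const.mul
    (continuous_finsetSum _ fun j _ => continuous_finsetSum _ fun l _ => ?_)
  split_ifs <;> fun_prop

@[fun_prop]
lemma continuous_weight : Continuous (weight G β) := by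
  unfold weight
  fun_prop

@[fun_prop]
lemma continuous_pairing_left (g : V → ℝ) : Continuous fun φ => pairing φ g := by
  unfold pairing
  fun_prop

lemma abs_pairing_le (φ g : V → ℝ) : |pairing φ g| ≤ (∑ j, |g j|) * ∑ j, |φ j| := by
  refine (Finset.abs_sum_le_sum_abs _ _).trans ?_
  rw [Finset.mul_sum]
  refine Finset.sum_le_sum fun j _ => ?_
  rw [abs_mul, mul_comm]
  gcongr
  exact Finset.single_le_sum (f := fun j => |g j|) (fun _ _ => abs_nonneg _) (Finset.mem_univ j)

lemma weight_add (φ a : V → ℝ) :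
    weight G β (φ + a) = weight G β φ *
      Real.exp (pairing φ (β • laplacian G a) - β / 2 * dirichletEnergy G a) := by
  have hpair : pairing φ (β • laplacian G a) = -(β * dirichletForm G φ a) := by
    rw [pairing_eq_dotProduct, dotProduct_smul, ← pairing_eq_dotProduct, pairing_laplacian,
      smul_eq_mul, mul_neg]
  rw [weight, weight, dirichletEnergy_add, hpair, ← Real.exp_add]
  ring_nf

lemma weight_add_const (φ : V → ℝ) (c : ℝ) : weight G β (φ + fun _ => c) = weight G β φ := by
  rw [weight, weight, dirichletEnergy_add_const]

lemma gffUnnormalized_eq : gffUnnormalized G β v =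
    (volume.restrict (pinned v)).withDensity fun φ => ENNReal.ofReal (weight G β φ) := rfl

lemma integral_gff {E : Type*} [NormedAddCommGroup E] [NormedSpace ℝ E] (F : (V → ℝ) → E) :
    ∫ φ, F φ ∂gff G β v = (gffUnnormalized G β v Set.univ)⁻¹.toReal •
      ∫ φ in pinned v, weight G β φ • F φ := by
  have hmeas : Measurable fun φ => ENNReal.ofReal (weight G β φ) :=
    (continuous_weight G β).measurable.ennreal_ofReal
  rw [gff, integral_smul_measure, gffUnnormalized_eq, integral_withDensity_eq_integral_toReal_smul
    hmeas (.of_forall fun _ => ENNReal.ofReal_lt_top)]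
  simp only [weight, ENNReal.toReal_ofReal (Real.exp_pos _).le]

lemma integrable_gff {E : Type*} [NormedAddCommGroup E] [NormedSpace ℝ E] {F : (V → ℝ) → E}
    (hF : IntegrableOn (fun φ => weight G β φ • F φ) (pinned v)) : Integrable F (gff G β v) := by
  rcases eq_or_ne (gffUnnormalized G β v Set.univ) 0 with h0 | h0
  · rw [gff, Measure.measure_univ_eq_zero.1 h0, smul_zero]
    exact integrable_zero_measure
  · have hmeas : Measurable fun φ => ENNReal.ofReal (weight G β φ) :=
      (continuous_weight G β).measurable.ennreal_ofReal
    refine Integrable.smul_measure ?_ (ENNReal.inv_ne_top.2 h0)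
    rw [gffUnnormalized_eq, integrable_withDensity_iff_integrable_smul' hmeas
      (.of_forall fun _ => ENNReal.ofReal_lt_top)]
    simp only [weight, ENNReal.toReal_ofReal (Real.exp_pos _).le]
    exact hF

variable {G β} (hG : G.Connected) (hβ : 0 < β)
include hG hβ

lemma exists_weight_le :
    ∃ ε > 0, ∃ C, ∀ φ ∈ pinned v, weight G β φ ≤ Real.exp (C - ε * ∑ j, φ j ^ 2) := by
  obtain ⟨C, hC, hbound⟩ := exists_forall_sum_sq_le hG v
  refine ⟨β / (2 * C), by positivity, β / 2 * Real.pi ^ 2, fun φ hφ => ?_⟩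
  have hv : φ v ^ 2 ≤ Real.pi ^ 2 := sq_le_sq' hφ.1 hφ.2.le
  have hsum : ∑ j, φ j ^ 2 ≤ C * (Real.pi ^ 2 + dirichletEnergy G φ) :=
    (hbound φ).trans (by gcongr)
  have hscaled : β / (2 * C) * ∑ j, φ j ^ 2 ≤ β / 2 * (Real.pi ^ 2 + dirichletEnergy G φ) :=
    (mul_le_mul_of_nonneg_left hsum (by positivity)).trans_eq (by field_simp)
  exact Real.exp_le_exp.2 (by linarith)

lemma integrable_exp_mul_sum_abs_gff (c : ℝ) :
    Integrable (fun φ => Real.exp (c * ∑ j, |φ j|)) (gff G β v) := by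
  obtain ⟨ε, hε, C, hC⟩ := exists_weight_le v hG hβ
  refine integrable_gff G β v ?_
  have hdom : Integrable fun φ : V → ℝ =>
      Real.exp C * ∏ j, (Real.exp (c ^ 2 / (2 * ε)) * Real.exp (-(ε / 2) * φ j ^ 2)) :=
    (Integrable.fintype_prod (f := fun _ x => Real.exp (c ^ 2 / (2 * ε)) *
      Real.exp (-(ε / 2) * x ^ 2)) fun _ =>
        (integrable_exp_neg_mul_sq (half_pos hε)).const_mul _).const_mul _
  refine hdom.integrableOn.mono' (by fun_prop)
    ((ae_restrict_mem (measurableSet_pinned v)).mono fun φ hφ => ?_)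
  have hsq : ∀ x : ℝ, c * |x| - ε * x ^ 2 ≤ c ^ 2 / (2 * ε) + -(ε / 2) * x ^ 2 := by
    intro x
    rw [div_add' _ _ _ (by positivity), le_div_iff₀ (by positivity), ← sq_abs x]
    nlinarith [sq_nonneg (c - ε * |x|)]
  calc ‖weight G β φ • Real.exp (c * ∑ j, |φ j|)‖
      = weight G β φ * Real.exp (c * ∑ j, |φ j|) :=
        Real.norm_of_nonneg (mul_nonneg (Real.exp_pos _).le (Real.exp_pos _).le)
    _ ≤ Real.exp (C - ε * ∑ j, φ j ^ 2) * Real.exp (c * ∑ j, |φ j|) := by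
        gcongr; exact hC φ hφ
    _ = Real.exp (C + ∑ j, (c * |φ j| - ε * φ j ^ 2)) := by
        rw [← Real.exp_add, Finset.sum_sub_distrib, ← Finset.mul_sum, ← Finset.mul_sum]
        ring_nf
    _ ≤ Real.exp (C + ∑ j, (c ^ 2 / (2 * ε) + -(ε / 2) * φ j ^ 2)) := by
        gcongr with j; exact hsq _
    _ = _ := by simp only [Real.exp_add, Real.exp_sum]

lemma isFiniteMeasure_gff : IsFiniteMeasure (gff G β v) := by
  have h := integrable_exp_mul_sum_abs_gff v hG hβ 0
  simp only [zero_mul, Real.exp_zero] at h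
  exact (integrable_const_iff_isFiniteMeasure one_ne_zero).1 h

lemma integrable_gff_of_bounded {E : Type*} [NormedAddCommGroup E]
    [SecondCountableTopologyEither (V → ℝ) E] {F : (V → ℝ) → E} (hF : Continuous F) {B : ℝ}
    (hB : ∀ φ, ‖F φ‖ ≤ B) : Integrable F (gff G β v) :=
  have := isFiniteMeasure_gff v hG hβ
  .of_bound hF.aestronglyMeasurable B (.of_forall hB)

end FreeField

section Translation

variable {V : Type} [Fintype V] (G : SimpleGraph V) (β : ℝ) (v : V)
  {E : Type*} [NormedAddCommGroup E] [NormedSpace ℝ E]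

lemma integral_gff_add {a : V → ℝ} (ha : a v = 0) (F : (V → ℝ) → E) :
    ∫ φ, F φ ∂gff G β v
      = ∫ φ, Real.exp (pairing φ (β • laplacian G a) - β / 2 * dirichletEnergy G a) • F (φ + a)
          ∂gff G β v := by
  have hpre : (fun φ : V → ℝ => φ + a) ⁻¹' pinned v = pinned v := by
    ext φ
    simp [pinned, ha]
  rw [integral_gff, integral_gff]
  simp only [smul_smul, ← weight_add]
  congr 1
  have h := (measurePreserving_add_right (volume : Measure (V → ℝ)) a).setIntegral_preimage_emb
    (measurableEmbedding_addRight a) (fun φ => weight G β φ • F φ) (pinned v)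
  rw [← h, hpre]

lemma isAddFundamentalDomain_preimage_Ico (t : ℝ) :
    IsAddFundamentalDomain (AddSubgroup.zmultiples fun _ : V => 2 * Real.pi)
      {φ : V → ℝ | φ v ∈ Set.Ico t (t + 2 * Real.pi)} volume := by
  have hmeas : MeasurableSet {φ : V → ℝ | φ v ∈ Set.Ico t (t + 2 * Real.pi)} :=
    measurableSet_Ico.preimage (measurable_pi_apply v)
  have hinj : Function.Injective fun n : ℤ => n • fun _ : V => 2 * Real.pi := fun m n h =>
    (zsmul_left_strictMono Real.two_pi_pos).injective (congrFun h v)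
  refine IsAddFundamentalDomain.mk' hmeas.nullMeasurableSet fun φ => ?_
  refine (Equiv.ofInjective _ hinj).bijective.existsUnique_iff.2 ?_
  change ∃! n : ℤ, n • (2 * Real.pi) + φ v ∈ Set.Ico t (t + 2 * Real.pi)
  simpa only [add_comm (φ v)] using existsUnique_add_zsmul_mem_Ico Real.two_pi_pos (φ v) t

lemma integral_gff_add_const {F : (V → ℝ) → E} (hF : ∀ φ, F (φ + fun _ => 2 * Real.pi) = F φ)
    (c : ℝ) : ∫ φ, F (φ + fun _ => c) ∂gff G β v = ∫ φ, F φ ∂gff G β v := by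
  have hmem : (fun φ : V → ℝ => φ + fun _ => c) ⁻¹'
      {φ | φ v ∈ Set.Ico (c - Real.pi) (c - Real.pi + 2 * Real.pi)} = pinned v := by
    ext φ
    simp only [pinned, Set.mem_preimage, Set.mem_ofPred_eq, Set.mem_Ico, Pi.add_apply]
    constructor <;> rintro ⟨h₁, h₂⟩ <;> constructor <;> linarith
  have hpinned : pinned v = {φ | φ v ∈ Set.Ico (-Real.pi) (-Real.pi + 2 * Real.pi)} := by
    ext φ
    simp only [pinned, Set.mem_ofPred_eq]
    ring_nf
  have hper : ∀ (g : AddSubgroup.zmultiples fun _ : V => 2 * Real.pi) (φ : V → ℝ),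
      weight G β (g +ᵥ φ) • F (g +ᵥ φ) = weight G β φ • F φ := by
    have hF' : Function.Periodic (fun φ => weight G β φ • F φ) fun _ : V => 2 * Real.pi :=
      fun φ => by simp only [weight_add_const, hF]
    rintro ⟨_, n, rfl⟩ φ
    change weight G β (n • _ + φ) • F (n • _ + φ) = _
    rw [add_comm]
    exact hF'.zsmul n φ
  have hshift : ∀ φ, weight G β φ • F (φ + fun _ => c)
      = weight G β (φ + fun _ => c) • F (φ + fun _ => c) := fun φ => by rw [weight_add_const]
  rw [integral_gff, integral_gff]
  simp only [hshift]
  have h := (measurePreserving_add_right (volume : Measure (V → ℝ))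
    fun _ => c).setIntegral_preimage_emb (measurableEmbedding_addRight _)
    (fun φ => weight G β φ • F φ) {φ | φ v ∈ Set.Ico (c - Real.pi) (c - Real.pi + 2 * Real.pi)}
  rw [hmem] at h
  rw [h, (isAddFundamentalDomain_preimage_Ico v _).setIntegral_eq
    (isAddFundamentalDomain_preimage_Ico v (-Real.pi)) hper, ← hpinned]

end Translation

section ComplexTranslation

lemma differentiable_integral_mul_cexp {Ω : Type*} [MeasurableSpace Ω] {μ : Measure Ω}
    {X : Ω → ℝ} (hX : AEMeasurable X μ) {F : Ω → ℂ} (hF : AEStronglyMeasurable F μ)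
    (hint : ∀ t : ℝ, Integrable (fun ω => ‖F ω‖ * Real.exp (t * |X ω|)) μ) :
    Differentiable ℂ fun z : ℂ => ∫ ω, F ω * Complex.exp (z * X ω) ∂μ := by
  intro z₀
  have hX' : AEStronglyMeasurable (fun ω => (X ω : ℂ)) μ :=
    (Complex.measurable_ofReal.comp_aemeasurable hX).aestronglyMeasurable
  have hmeas : ∀ z : ℂ, AEStronglyMeasurable (fun ω => F ω * Complex.exp (z * X ω)) μ := fun z =>
    hF.mul (Complex.continuous_exp.comp_aestronglyMeasurable (hX'.const_mul z))
  have hnorm : ∀ (z : ℂ) ω, ‖F ω * Complex.exp (z * X ω)‖ ≤ ‖F ω‖ * Real.exp (‖z‖ * |X ω|) := by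
    intro z ω
    rw [norm_mul, Complex.norm_exp, Complex.re_mul_ofReal]
    have hre : z.re * X ω ≤ ‖z‖ * |X ω| := by
      calc z.re * X ω ≤ |z.re| * |X ω| := (le_abs_self _).trans (abs_mul _ _).le
        _ ≤ ‖z‖ * |X ω| := by gcongr; exact Complex.abs_re_le_norm z
    gcongr
  have hbound : ∀ ω, ∀ z ∈ Metric.ball z₀ 1, ‖F ω * Complex.exp (z * X ω) * X ω‖
      ≤ ‖F ω‖ * Real.exp ((‖z₀‖ + 2) * |X ω|) := by
    intro ω z hz
    have hz' : ‖z‖ ≤ ‖z₀‖ + 1 := by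
      linarith [norm_le_norm_add_norm_sub' z z₀, mem_ball_iff_norm.1 hz]
    have habs : |X ω| ≤ Real.exp |X ω| := by linarith [Real.add_one_le_exp |X ω|]
    calc ‖F ω * Complex.exp (z * X ω) * X ω‖
        ≤ ‖F ω‖ * Real.exp ((‖z₀‖ + 1) * |X ω|) * Real.exp |X ω| := by
          rw [norm_mul, Complex.norm_real, Real.norm_eq_abs]
          gcongr
          exact (hnorm z ω).trans (by gcongr)
      _ = _ := by rw [mul_assoc, ← Real.exp_add]; ring_nf
  have hderiv : ∀ ω, ∀ z ∈ Metric.ball z₀ 1,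
      HasDerivAt (fun z => F ω * Complex.exp (z * X ω)) (F ω * Complex.exp (z * X ω) * X ω) z := by
    intro ω z _
    exact ((hasDerivAt_mul_const (X ω : ℂ)).cexp.const_mul (F ω)).congr_deriv
      (mul_assoc _ _ _).symm
  exact (hasDerivAt_integral_of_dominated_loc_of_deriv_le (Metric.ball_mem_nhds z₀ one_pos)
    (.of_forall hmeas) ((hint ‖z₀‖).mono' (hmeas z₀) (.of_forall (hnorm z₀)))
    ((hmeas z₀).mul hX') (.of_forall hbound) (hint _) (.of_forall hderiv)).2.differentiableAt

lemma eq_of_forall_ofReal {f g : ℂ → ℂ} (hf : Differentiable ℂ f) (hg : Differentiable ℂ g)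
    (h : ∀ x : ℝ, f x = g x) : f = g := by
  refine AnalyticOnNhd.eq_of_frequently_eq (z₀ := 0) (fun z _ => hf.analyticAt z)
    (fun z _ => hg.analyticAt z) ?_
  have htend : Filter.Tendsto Complex.ofReal (nhdsWithin 0 {0}ᶜ) (nhdsWithin 0 {0}ᶜ) :=
    Complex.continuous_ofReal.continuousWithinAt.tendsto_nhdsWithin fun x hx => by simpa using hx
  exact htend.frequently (Filter.Frequently.of_forall h)

variable {V : Type} [Fintype V] {G : SimpleGraph V} {β : ℝ}

lemma differentiable_integral_gff_cexp (hG : G.Connected) (hβ : 0 < β) (v : V) (f g : V → ℝ) :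
    Differentiable ℂ fun z : ℂ => ∫ φ, Complex.exp (Complex.I * pairing φ f) *
      Complex.exp (z * pairing φ g) ∂gff G β v := by
  have hnorm : ∀ φ, ‖Complex.exp (Complex.I * pairing φ f)‖ = 1 := fun φ => by
    rw [mul_comm, Complex.norm_exp_ofReal_mul_I]
  refine differentiable_integral_mul_cexp (continuous_pairing_left g).aemeasurable
    (by fun_prop) fun t => ?_
  refine (integrable_exp_mul_sum_abs_gff v hG hβ (|t| * ∑ j, |g j|)).mono' (by fun_prop)
    (.of_forall fun φ => ?_)
  rw [hnorm, one_mul, Real.norm_of_nonneg (Real.exp_pos _).le, mul_assoc]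
  gcongr
  · exact le_abs_self t
  · exact abs_pairing_le φ g

/-- The right-hand side below is the value at `z = i` of an entire function of the size `z` of the
translation, which by the real translation formula is constant for real `z`. -/
lemma integral_gff_cexp_of_apply_eq_zero (hG : G.Connected) (hβ : 0 < β) {v : V} (f : V → ℝ)
    {a : V → ℝ} (ha : a v = 0) :
    ∫ φ, Complex.exp (Complex.I * pairing φ f) ∂gff G β v
      = Complex.exp (-pairing a f + β / 2 * dirichletEnergy G a) *
        ∫ φ, Complex.exp (Complex.I * pairing φ (f + β • laplacian G a)) ∂gff G β v := by
  set g : V → ℝ := β • laplacian G a with hg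
  let Ψ : ℂ → ℂ := fun z =>
    Complex.exp (Complex.I * z * pairing a f - β / 2 * z ^ 2 * dirichletEnergy G a) *
      ∫ φ, Complex.exp (Complex.I * pairing φ f) * Complex.exp (z * pairing φ g) ∂gff G β v
  have hΨ : Differentiable ℂ Ψ :=
    Differentiable.mul (by fun_prop) (differentiable_integral_gff_cexp hG hβ v f g)
  have hreal : ∀ s : ℝ, Ψ s = ∫ φ, Complex.exp (Complex.I * pairing φ f) ∂gff G β v := by
    intro s
    rw [integral_gff_add G β v (a := s • a) (by simp [ha])]
    refine (integral_const_mul _ _).symm.trans ?_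
    refine integral_congr_ae (.of_forall fun φ => ?_)
    have hpair : pairing φ (β • laplacian G (s • a)) = s * pairing φ g := by
      simp [laplacian_smul, pairing_eq_dotProduct, hg, mul_left_comm]
    have hpair' : pairing (φ + s • a) f = pairing φ f + s * pairing a f := by
      simp [pairing_eq_dotProduct, add_dotProduct]
    simp only [hpair, hpair', dirichletEnergy_smul, Complex.real_smul, Complex.ofReal_exp,
      ← Complex.exp_add]
    push_cast
    ring_nf
  have hI : Ψ Complex.I = _ := congrFun
    (eq_of_forall_ofReal hΨ (differentiable_const _) hreal) Complex.I
  rw [← hI]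
  simp only [Ψ, ← Complex.exp_add, pairing_eq_dotProduct, dotProduct_add, Complex.I_mul_I,
    Complex.I_sq, Complex.ofReal_add]
  ring_nf

lemma integral_gff_cexp (hG : G.Connected) (hβ : 0 < β) (v : V) {f : V → ℝ}
    (hf : ∑ j, f j = 0) (a : V → ℝ) :
    ∫ φ, Complex.exp (Complex.I * pairing φ f) ∂gff G β v
      = Complex.exp (-pairing a f + β / 2 * dirichletEnergy G a) *
        ∫ φ, Complex.exp (Complex.I * pairing φ (f + β • laplacian G a)) ∂gff G β v := by
  have hconst : pairing (a + fun _ => -a v) f = pairing a f := by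
    simp only [pairing, Pi.add_apply, add_mul, Finset.sum_add_distrib, ← Finset.mul_sum, hf,
      mul_zero, add_zero]
  have h := integral_gff_cexp_of_apply_eq_zero hG hβ f (a := a + fun _ => -a v) (v := v) (by simp)
  rwa [laplacian_add_const, dirichletEnergy_add_const, hconst] at h

end ComplexTranslation

section Renormalization

/-- The Fourier coefficients of `x ↦ 1 + K cos x`, indexed by the frequencies `-1, 0, 1`. -/
noncomputable def fourierCoeff (K : ℝ) (ε : SignType) : ℝ := if ε = 0 then 1 else K / 2

lemma fourierCoeff_mul (K c : ℝ) (ε : SignType) :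
    fourierCoeff (K * Real.exp c) ε = fourierCoeff K ε * Real.exp ((ε : ℝ) ^ 2 * c) := by
  cases ε <;> simp [fourierCoeff] <;> ring

lemma one_add_mul_cos_eq_sum (K x s : ℝ) :
    ((1 + K * Real.cos (x + s) : ℝ) : ℂ) = ∑ ε : SignType,
      fourierCoeff K ε * Complex.exp (Complex.I * (ε * s : ℝ)) *
        Complex.exp (Complex.I * (ε * x : ℝ)) := by
  simp only [mul_assoc, ← Complex.exp_add, SignType.univ_eq]
  rw [Finset.sum_insert (by decide), Finset.sum_insert (by decide), Finset.sum_singleton]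
  simp only [fourierCoeff, Complex.ofReal_add, Complex.ofReal_mul, Complex.ofReal_cos, Complex.cos]
  norm_num
  ring_nf

variable {V : Type} [Fintype V] {G : SimpleGraph V} {β : ℝ} (hG : G.Connected) (hβ : 0 < β)
  (v : V)

section Finite

variable {ι : Type} [Fintype ι]

include hG hβ in
lemma integral_gff_prod_one_add_cos [DecidableEq ι] (g : ι → V → ℝ) (K s : ι → ℝ) :
    ((∫ φ, ∏ i, (1 + K i * Real.cos (pairing φ (g i) + s i)) ∂gff G β v : ℝ) : ℂ)
      = ∑ ε : ι → SignType,
        (∏ i, fourierCoeff (K i) (ε i) * Complex.exp (Complex.I * (ε i * s i : ℝ))) *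
          ∫ φ, Complex.exp (Complex.I * pairing φ (∑ i, (ε i : ℝ) • g i)) ∂gff G β v := by
  have hexpand : ∀ φ : V → ℝ, ((∏ i, (1 + K i * Real.cos (pairing φ (g i) + s i)) : ℝ) : ℂ)
      = ∑ ε : ι → SignType,
        (∏ i, fourierCoeff (K i) (ε i) * Complex.exp (Complex.I * (ε i * s i : ℝ))) *
          Complex.exp (Complex.I * pairing φ (∑ i, (ε i : ℝ) • g i)) := by
    intro φ
    simp only [Complex.ofReal_prod, one_add_mul_cos_eq_sum, Finset.prod_univ_sum,
      Fintype.piFinset_univ, Finset.prod_mul_distrib, ← Complex.exp_sum, ← Finset.mul_sum,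
      ← Complex.ofReal_sum, pairing_eq_dotProduct, dotProduct_sum, dotProduct_smul, smul_eq_mul]
  have hint : ∀ f : V → ℝ, Integrable (fun φ => Complex.exp (Complex.I * pairing φ f))
      (gff G β v) := fun f =>
    integrable_gff_of_bounded v hG hβ (by fun_prop) (B := 1) fun φ => by
      rw [mul_comm, Complex.norm_exp_ofReal_mul_I]
  rw [← integral_complex_ofReal]
  simp only [hexpand]
  rw [integral_finsetSum _ fun ε _ => (hint _).const_mul _]
  simp only [integral_const_mul]

lemma pairing_sum_smul_sum_smul {a g : ι → V → ℝ}
    (hag : Pairwise fun i i' => pairing (a i) (g i') = 0) (c : ι → ℝ) :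
    pairing (∑ i, c i • a i) (∑ i, c i • g i) = ∑ i, c i ^ 2 * pairing (a i) (g i) := by
  rw [pairing_eq_dotProduct, sum_dotProduct]
  refine Finset.sum_congr rfl fun i _ => ?_
  rw [dotProduct_sum, Finset.sum_eq_single_of_mem i (Finset.mem_univ i)]
  · simp [pairing_eq_dotProduct, sq, mul_assoc]
  · intro i' _ hne
    simp [← pairing_eq_dotProduct, hag hne.symm]

include hG hβ in
lemma integral_gff_prod_renormalize {g a : ι → V → ℝ} (hg : ∀ i, ∑ j, g i j = 0)
    (hag : Pairwise fun i i' => pairing (a i) (g i') = 0)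
    (haa : Pairwise fun i i' => dirichletForm G (a i) (a i') = 0) (K s : ι → ℝ) :
    ∫ φ, ∏ i, (1 + K i * Real.cos (pairing φ (g i) + s i)) ∂gff G β v
      = ∫ φ, ∏ i, (1 +
          K i * Real.exp (-pairing (a i) (g i) + β / 2 * dirichletEnergy G (a i)) *
            Real.cos (pairing φ (g i + β • laplacian G (a i)) + s i)) ∂gff G β v := by
  classical
  rw [← Complex.ofReal_inj, integral_gff_prod_one_add_cos hG hβ,
    integral_gff_prod_one_add_cos hG hβ]
  refine Finset.sum_congr rfl fun ε _ => ?_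
  have hneutral : ∑ j, (∑ i, (ε i : ℝ) • g i) j = 0 := by
    simp only [Finset.sum_apply, Pi.smul_apply, smul_eq_mul]
    rw [Finset.sum_comm]
    simp only [← Finset.mul_sum, hg, mul_zero, Finset.sum_const_zero]
  have hlap : ∑ i, (ε i : ℝ) • g i + β • laplacian G (∑ i, (ε i : ℝ) • a i)
      = ∑ i, (ε i : ℝ) • (g i + β • laplacian G (a i)) := by
    simp only [laplacian_sum_smul, Finset.smul_sum, smul_add, Finset.sum_add_distrib,
      smul_comm β]
  have hexp : -pairing (∑ i, (ε i : ℝ) • a i) (∑ i, (ε i : ℝ) • g i)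
      + β / 2 * dirichletEnergy G (∑ i, (ε i : ℝ) • a i)
      = ∑ i, (ε i : ℝ) ^ 2 * (-pairing (a i) (g i) + β / 2 * dirichletEnergy G (a i)) := by
    rw [pairing_sum_smul_sum_smul hag, dirichletEnergy_sum_smul G _ _ _ fun i _ i' _ h => haa h,
      Finset.mul_sum, ← Finset.sum_neg_distrib, ← Finset.sum_add_distrib]
    exact Finset.sum_congr rfl fun i _ => by ring
  rw [integral_gff_cexp hG hβ v hneutral (∑ i, (ε i : ℝ) • a i), hlap, ← mul_assoc]
  congr 1
  norm_cast
  rw [hexp]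
  simp only [fourierCoeff_mul]
  push_cast
  rw [Complex.exp_sum, ← Finset.prod_mul_distrib]
  exact Finset.prod_congr rfl fun i _ => by ring

end Finite

lemma pairing_add_const_toReal (φ : V → ℝ) (c : ℝ) (ρ : V → ℤ) :
    pairing (φ + fun _ => c) (toReal ρ) = pairing φ (toReal ρ) + c * charge ρ := by
  rw [← pairing_const_toReal]
  simp only [pairing_eq_dotProduct, add_dotProduct]

include hG hβ in
lemma integrable_prod_one_add_cos_gff {ι : Type*} (N : Finset ι) (g : ι → V → ℝ) (K s : ι → ℝ) :
    Integrable (fun φ => ∏ i ∈ N, (1 + K i * Real.cos (pairing φ (g i) + s i))) (gff G β v) := by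
  refine integrable_gff_of_bounded v hG hβ (by fun_prop) (B := ∏ i ∈ N, (1 + |K i|)) fun φ => ?_
  rw [norm_prod]
  refine Finset.prod_le_prod (fun _ _ => norm_nonneg _) fun i _ => ?_
  calc ‖1 + K i * Real.cos (pairing φ (g i) + s i)‖
      ≤ ‖(1 : ℝ)‖ + ‖K i‖ * ‖Real.cos (pairing φ (g i) + s i)‖ :=
        (norm_add_le _ _).trans_eq (by rw [norm_mul])
    _ ≤ 1 + |K i| * 1 := by
        rw [norm_one, Real.norm_eq_abs, Real.norm_eq_abs]
        gcongr
        exact Real.abs_cos_le_one _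
    _ = 1 + |K i| := by rw [mul_one]

lemma prod_one_add_cos_add_const {N : Finset (V → ℤ)} (hN : ∀ ρ ∈ N, charge ρ = 0)
    (K s : (V → ℤ) → ℝ) (φ : V → ℝ) (c : ℝ) :
    ∏ ρ ∈ N, (1 + K ρ * Real.cos (pairing (φ + fun _ => c) (toReal ρ) + s ρ))
      = ∏ ρ ∈ N, (1 + K ρ * Real.cos (pairing φ (toReal ρ) + s ρ)) :=
  Finset.prod_congr rfl fun ρ hρ => by simp [pairing_add_const_toReal, hN ρ hρ]

/-- The constant shift by `π / Q(ρc)` turns the cosine of `ρc` into its negative and leaves the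
neutral factors unchanged. -/
lemma integral_gff_prod_mul_cos_eq_zero {N : Finset (V → ℤ)} (hN : ∀ ρ ∈ N, charge ρ = 0)
    {ρc : V → ℤ} (hρc : charge ρc ≠ 0) (K s : (V → ℤ) → ℝ) (t : ℝ) :
    ∫ φ, (∏ ρ ∈ N, (1 + K ρ * Real.cos (pairing φ (toReal ρ) + s ρ))) *
      Real.cos (pairing φ (toReal ρc) + t) ∂gff G β v = 0 := by
  have hQ : (charge ρc : ℝ) ≠ 0 := Int.cast_ne_zero.2 hρc
  have hneg := integral_gff_add_const G β v (F := fun φ : V → ℝ =>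
    (∏ ρ ∈ N, (1 + K ρ * Real.cos (pairing φ (toReal ρ) + s ρ))) *
      Real.cos (pairing φ (toReal ρc) + t)) ?_ (Real.pi / charge ρc)
  · simp only [prod_one_add_cos_add_const hN] at hneg
    simp only [pairing_add_const_toReal, div_mul_cancel₀ _ hQ,
      add_right_comm _ Real.pi, Real.cos_add_pi, mul_neg, integral_neg] at hneg
    linarith
  · intro φ
    rw [prod_one_add_cos_add_const hN, pairing_add_const_toReal, add_right_comm,
      mul_comm (2 * Real.pi), Real.cos_add_int_mul_two_pi]

include hG hβ in
lemma integral_gff_prod_eq_neutral {N : Finset (V → ℤ)} (hN : PropA N) (K s : (V → ℤ) → ℝ) :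
    ∫ φ, ∏ ρ ∈ N, (1 + K ρ * Real.cos (pairing φ (toReal ρ) + s ρ)) ∂gff G β v
      = ∫ φ, ∏ ρ ∈ N with charge ρ = 0,
          (1 + K ρ * Real.cos (pairing φ (toReal ρ) + s ρ)) ∂gff G β v := by
  classical
  by_cases hneutral : ∀ ρ ∈ N, charge ρ = 0
  · rw [Finset.filter_true_of_mem hneutral]
  push Not at hneutral
  obtain ⟨ρc, hρc, hQ⟩ := hneutral
  have hN₀ : ∀ ρ ∈ N.filter (charge · = 0), charge ρ = 0 := fun ρ hρ => (Finset.mem_filter.1 hρ).2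
  have hcharged : N.filter (charge · ≠ 0) = {ρc} := by
    ext ρ
    rw [Finset.mem_filter, Finset.mem_singleton]
    exact ⟨fun h => hN ρ h.1 ρc hρc h.2 hQ, fun h => h ▸ ⟨hρc, hQ⟩⟩
  have hint := integrable_prod_one_add_cos_gff hG hβ v (N.filter (charge · = 0)) toReal K s
  have hint' : Integrable (fun φ =>
      (∏ ρ ∈ N with charge ρ = 0, (1 + K ρ * Real.cos (pairing φ (toReal ρ) + s ρ))) *
        Real.cos (pairing φ (toReal ρc) + s ρc)) (gff G β v) :=
    hint.mul_bdd (c := 1) (by fun_prop) (.of_forall fun φ => Real.abs_cos_le_one _)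
  simp only [← Finset.prod_filter_mul_prod_filter_not N (charge · = 0), hcharged,
    Finset.prod_singleton, mul_add, mul_one, mul_left_comm _ (K ρc)]
  rw [integral_add hint (hint'.const_mul _), integral_const_mul,
    integral_gff_prod_mul_cos_eq_zero v hN₀ hQ, mul_zero, add_zero]

/-- The neutral densities of an ensemble. -/
def neutral (N : Finset (V → ℤ)) : Set (V → ℤ) := {ρ | ρ ∈ N ∧ charge ρ = 0}

include hG hβ in
lemma integral_gff_renormalize {N : Finset (V → ℤ)} (hN : PropA N) {a : (V → ℤ) → V → ℝ}
    (hag : (neutral N).Pairwise fun ρ ρ' => pairing (a ρ) (toReal ρ') = 0)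
    (haa : (neutral N).Pairwise fun ρ ρ' => dirichletForm G (a ρ) (a ρ') = 0)
    (K s : (V → ℤ) → ℝ) :
    ∫ φ, ∏ ρ ∈ N, (1 + K ρ * Real.cos (pairing φ (toReal ρ) + s ρ)) ∂gff G β v
      = ∫ φ, ∏ ρ ∈ N with charge ρ = 0, (1 +
          K ρ * Real.exp (-pairing (a ρ) (toReal ρ) + β / 2 * dirichletEnergy G (a ρ)) *
            Real.cos (pairing φ (toReal ρ + β • laplacian G (a ρ)) + s ρ)) ∂gff G β v := by
  classical
  have hmem (i : N.filter (charge · = 0)) : (i : V → ℤ) ∈ neutral N :=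
    Finset.mem_filter.1 i.2
  have hsum (i : N.filter (charge · = 0)) : ∑ j, toReal (i : V → ℤ) j = 0 := by
    have hcharge := (hmem i).2
    simp only [toReal, ← Int.cast_sum]
    exact_mod_cast hcharge
  rw [integral_gff_prod_eq_neutral hG hβ v hN]
  simp only [← Finset.prod_coe_sort (N.filter (charge · = 0))]
  exact integral_gff_prod_renormalize hG hβ v hsum
    (fun i i' h => hag (hmem i) (hmem i') (Subtype.coe_injective.ne h))
    (fun i i' h => haa (hmem i) (hmem i') (Subtype.coe_injective.ne h)) _ _

end Renormalization

/-! ### Walks with free jumps inside sparse sets -/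

section Reach

variable {V ι : Type*} {G : SimpleGraph V} {B : ι → Set V} {F : Set ι} {size : ι → ℕ}
  {x y z : V} {n c : ℕ}

/-- `Reach G B F x n y`: one can go from `x` to `y` along `n` edges of `G` together with any
number of free jumps inside the sets `B i`, `i ∈ F`. -/
inductive Reach (G : SimpleGraph V) (B : ι → Set V) (F : Set ι) (x : V) : ℕ → V → Prop
  | refl : Reach G B F x 0 x
  | step {n : ℕ} {y z : V} : Reach G B F x n y → G.Adj y z → Reach G B F x (n + 1) z
  | jump {n : ℕ} {y z : V} (i : ι) : i ∈ F → Reach G B F x n y → y ∈ B i → z ∈ B i →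
      Reach G B F x n z

lemma Reach.of_walk (h : Reach G B F x n y) (p : G.Walk y z) : Reach G B F x (n + p.length) z := by
  induction p generalizing n with
  | nil => simpa using h
  | cons hadj p ih =>
    have := ih (h.step hadj)
    rwa [SimpleGraph.Walk.length_cons, add_comm p.length 1, ← add_assoc]

lemma Reach.dist_le_of_forall_notMem (hG : G.Connected) (hF : ∀ i, i ∉ F)
    (h : Reach G B F x n y) : G.dist x y ≤ n := by
  induction h with
  | refl => simp
  | @step n y z _ hadj ih =>
    have htri := hG.dist_triangle (u := x) (v := y) (w := z)
    rw [SimpleGraph.dist_eq_one_iff_adj.2 hadj] at htri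
    exact htri.trans (Nat.add_le_add_right ih 1)
  | jump i hi => exact absurd hi (hF i)

/-- The sets `B i`, `i ∈ F`, have diameter at most `3 size i`, and two of them whose sizes lie in
the same interval `[4 ^ m, 4 ^ (m + 1))` are at distance at least `2 ^ 15 * 8 ^ m`, which is of
higher order than their sizes. -/
structure IsSparse (G : SimpleGraph V) (B : ι → Set V) (F : Set ι) (size : ι → ℕ) : Prop where
  one_le_size : ∀ i ∈ F, 1 ≤ size i
  dist_le : ∀ i ∈ F, ∀ x ∈ B i, ∀ y ∈ B i, G.dist x y ≤ 3 * size i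
  le_dist : ∀ i ∈ F, ∀ j ∈ F, i ≠ j → ∀ m : ℕ, size i ∈ Set.Ico (4 ^ m) (4 ^ (m + 1)) →
    size j ∈ Set.Ico (4 ^ m) (4 ^ (m + 1)) → ∀ x ∈ B i, ∀ y ∈ B j, 2 ^ 15 * 8 ^ m ≤ G.dist x y

/-- The factor by which free jumps within sets of size less than `4 ^ n` shorten distances at
most. -/
noncomputable def jumpFactor (n : ℕ) : ℝ := 9 / 8 - (1 / 2) ^ n / 8

lemma jumpFactor_zero : jumpFactor 0 = 1 := by norm_num [jumpFactor]

lemma jumpFactor_succ (n : ℕ) : jumpFactor (n + 1) = jumpFactor n + (1 / 2) ^ n / 16 := by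
  rw [jumpFactor, jumpFactor, pow_succ]; ring

lemma monotone_jumpFactor : Monotone jumpFactor :=
  monotone_nat_of_le_succ fun n => by
    rw [jumpFactor_succ]
    exact le_add_of_nonneg_right (by positivity)

lemma jumpFactor_nonneg (n : ℕ) : 0 ≤ jumpFactor n :=
  zero_le_one.trans (jumpFactor_zero.symm.le.trans (monotone_jumpFactor n.zero_le))

lemma jumpFactor_le_two (n : ℕ) : jumpFactor n ≤ 2 := by
  have : (0 : ℝ) < (1 / 2) ^ n := by positivity
  rw [jumpFactor]; linarith

/-- A walk between two different sets of the same scale is so long that the increase of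
`jumpFactor` pays for a further jump of that scale. -/
lemma IsSparse.dist_add_le (hB : IsSparse G B F size) {i j : ι} (hi : i ∈ F) (hj : j ∈ F)
    (hij : i ≠ j) (hin : size i ∈ Set.Ico (4 ^ n) (4 ^ (n + 1)))
    (hjn : size j ∈ Set.Ico (4 ^ n) (4 ^ (n + 1))) (hx : x ∈ B i) (hy : y ∈ B j)
    (hxy : (G.dist x y : ℝ) ≤ jumpFactor n * c + 6 * 4 ^ n) :
    (G.dist x y : ℝ) + 12 * 4 ^ n ≤ jumpFactor (n + 1) * c := by
  have hfar : (2 ^ 15 * 8 ^ n : ℝ) ≤ G.dist x y := by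
    exact_mod_cast hB.le_dist i hi j hj hij n hin hjn x hx y hy
  have h48 : (4 : ℝ) ^ n ≤ 8 ^ n := by gcongr; norm_num
  have hc : (2 ^ 13 * 8 ^ n : ℝ) ≤ c := by
    have := mul_le_mul_of_nonneg_right (jumpFactor_le_two n) (Nat.cast_nonneg (α := ℝ) c)
    linarith
  have hgain : (2 ^ 9 * 4 ^ n : ℝ) ≤ (1 / 2) ^ n / 16 * c :=
    calc (2 ^ 9 * 4 ^ n : ℝ) = (1 / 2) ^ n / 16 * (2 ^ 13 * 8 ^ n) := by
          rw [show (4 : ℝ) = 1 / 2 * 8 by norm_num, mul_pow]; ring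
      _ ≤ (1 / 2) ^ n / 16 * c := by gcongr
  have h4 : (0 : ℝ) < 4 ^ n := by positivity
  rw [jumpFactor_succ]
  linarith

/-- The last set of scale `n` entered by a walk splits it into a part ending in that set and a part
with smaller jumps only. -/
lemma Reach.exists_last_jump (hG : G.Connected) (hB : IsSparse G B F size)
    (hdist : ∀ {x y : V} {c : ℕ}, Reach G B {i ∈ F | size i < 4 ^ n} x c y →
      (G.dist x y : ℝ) ≤ jumpFactor n * c + 6 * 4 ^ n)
    (h : Reach G B {i ∈ F | size i < 4 ^ (n + 1)} x c y) :
    Reach G B {i ∈ F | size i < 4 ^ n} x c y ∨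
      ∃ i ∈ F, size i ∈ Set.Ico (4 ^ n) (4 ^ (n + 1)) ∧ ∃ c₁ c₂ : ℕ, c₁ + c₂ = c ∧
        (∀ q ∈ B i, (G.dist x q : ℝ) ≤ jumpFactor (n + 1) * c₁ + 18 * 4 ^ n) ∧
        ∃ p ∈ B i, Reach G B {i ∈ F | size i < 4 ^ n} p c₂ y := by
  induction h with
  | refl => exact Or.inl Reach.refl
  | step _ hadj ih =>
    obtain h | ⟨i, hi, hin, c₁, c₂, rfl, hq, p, hp, hr⟩ := ih
    · exact Or.inl (h.step hadj)
    · exact Or.inr ⟨i, hi, hin, c₁, c₂ + 1, rfl, hq, p, hp, hr.step hadj⟩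
  | @jump c y z j hj _ hy hz ih =>
    by_cases hjn : size j < 4 ^ n
    · obtain h | ⟨i, hi, hin, c₁, c₂, hc, hq, p, hp, hr⟩ := ih
      · exact Or.inl (h.jump j ⟨hj.1, hjn⟩ hy hz)
      · exact Or.inr ⟨i, hi, hin, c₁, c₂, hc, hq, p, hp, hr.jump j ⟨hj.1, hjn⟩ hy hz⟩
    have hjn' : size j ∈ Set.Ico (4 ^ n) (4 ^ (n + 1)) := ⟨not_lt.1 hjn, hj.2⟩
    refine Or.inr ⟨j, hj.1, hjn', c, 0, rfl, fun q hq => ?_, z, hz, Reach.refl⟩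
    have hjump : (G.dist x q : ℝ) ≤ G.dist x y + 12 * 4 ^ n := by
      have h1 := hG.dist_triangle (u := x) (v := y) (w := q)
      have h2 := hB.dist_le j hj.1 y hy q hq
      have h3 := pow_succ 4 n ▸ hjn'.2
      exact_mod_cast (by omega : G.dist x q ≤ G.dist x y + 12 * 4 ^ n)
    have hstep (c : ℕ) : jumpFactor n * c ≤ jumpFactor (n + 1) * c :=
      mul_le_mul_of_nonneg_right (monotone_jumpFactor n.le_succ) c.cast_nonneg
    obtain h | ⟨i, hi, hin, c₁, c₂, rfl, hq', p, hp, hr⟩ := ih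
    · linarith [hdist h, hstep c]
    have hc₂ : 0 ≤ jumpFactor (n + 1) * c₂ := mul_nonneg (jumpFactor_nonneg _) c₂.cast_nonneg
    push_cast
    obtain rfl | hij := eq_or_ne i j
    · linarith [hq' q hq]
    · have htri : (G.dist x y : ℝ) ≤ G.dist x p + G.dist p y := by
        exact_mod_cast hG.dist_triangle
      linarith [hq' p hp, hB.dist_add_le hi hj.1 hij hin hjn' hp hy (hdist hr)]

lemma Reach.dist_le (hG : G.Connected) (hB : IsSparse G B F size) (n : ℕ)
    (h : Reach G B {i ∈ F | size i < 4 ^ n} x c y) :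
    (G.dist x y : ℝ) ≤ jumpFactor n * c + 6 * 4 ^ n := by
  induction n generalizing x y c with
  | zero =>
    have hdist : (G.dist x y : ℝ) ≤ c := by
      exact_mod_cast h.dist_le_of_forall_notMem hG fun i hi =>
        (hB.one_le_size i hi.1).not_gt (by simpa using hi.2)
    rw [jumpFactor_zero]
    linarith
  | succ n ih =>
    have hstep (c : ℕ) : jumpFactor n * c ≤ jumpFactor (n + 1) * c :=
      mul_le_mul_of_nonneg_right (monotone_jumpFactor n.le_succ) c.cast_nonneg
    have h4 : (0 : ℝ) < 4 ^ n := by positivity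
    rw [pow_succ]
    obtain h | ⟨i, -, -, c₁, c₂, rfl, hq, p, hp, hr⟩ := h.exists_last_jump hG hB ih
    · linarith [ih h, hstep c]
    · have htri : (G.dist x y : ℝ) ≤ G.dist x p + G.dist p y := by
        exact_mod_cast hG.dist_triangle
      push_cast
      linarith [hq p hp, ih hr, hstep c₂]

end Reach

/-! ### Geometry of square domains -/

section Geometry

open scoped SimpleGraph

variable {bc : BC} {L k m : ℕ}

/-- The path or the cycle with `L` vertices. -/
def line (bc : BC) (L : ℕ) : SimpleGraph (Fin L) :=
  match bc with
  | BC.free => SimpleGraph.pathGraph L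
  | BC.periodic => SimpleGraph.cycleGraph L

lemma domain_eq_boxProd (bc : BC) (L : ℕ) : domain bc L = line bc L □ line bc L := by
  cases bc <;> rfl

lemma Admissible.one_lt (h : Admissible bc L) : 1 < L := by
  cases bc
  · exact h
  · exact h.1

lemma line_connected (hL : 0 < L) : (line bc L).Connected := by
  obtain ⟨n, rfl⟩ := Nat.exists_eq_add_one.2 hL
  cases bc
  · exact SimpleGraph.pathGraph_connected n
  · exact SimpleGraph.cycleGraph_connected

lemma domain_connected (hL : 0 < L) : (domain bc L).Connected := by
  rw [domain_eq_boxProd]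
  exact (line_connected hL).boxProd (line_connected hL)

/-- The period of the coordinates; `0` stands for no identification. -/
def period (bc : BC) (L : ℕ) : ℤ :=
  match bc with
  | BC.free => 0
  | BC.periodic => L

/-- `c = p + t`, modulo `L` for periodic boundary conditions. -/
def Displaced (bc : BC) (t : ℤ) (p c : Fin L) : Prop := (p : ℤ) + t ≡ c [ZMOD period bc L]

lemma displaced_zero (bc : BC) (p : Fin L) : Displaced bc 0 p p := by
  rw [Displaced, add_zero]

lemma Displaced.symm {t : ℤ} {p c : Fin L} (h : Displaced bc t p c) : Displaced bc (-t) c p := by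
  simpa only [Displaced, add_neg_cancel_right] using (h.add_right (-t)).symm

lemma Displaced.trans {t u : ℤ} {p c q : Fin L} (h : Displaced bc t p c)
    (h' : Displaced bc u c q) : Displaced bc (t + u) p q := by
  rw [Displaced, ← add_assoc]
  exact (h.add_right u).trans h'

lemma Displaced.eq {t : ℤ} {p c c' : Fin L} (h : Displaced bc t p c)
    (h' : Displaced bc t p c') : c = c' := by
  have hcc : (c : ℤ) ≡ c' [ZMOD period bc L] := Int.ModEq.trans (Int.ModEq.symm h) h'
  cases bc
  · exact Fin.ext (by exact_mod_cast Int.modEq_zero_iff.1 hcc)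
  · exact Fin.ext (Nat.ModEq.eq_of_lt_of_lt (Int.natCast_modEq_iff.1 hcc) c.2 c'.2)

lemma exists_displaced {t : ℤ} {p : Fin L}
    (h : bc = BC.free → (p : ℤ) + t ∈ Set.Ico 0 (L : ℤ)) : ∃ c : Fin L, Displaced bc t p c := by
  have hL : (0 : ℤ) < L := by exact_mod_cast p.pos
  cases bc
  · obtain ⟨h0, hlt⟩ := h rfl
    refine ⟨⟨((p : ℤ) + t).toNat, by omega⟩, ?_⟩
    rw [Displaced, Int.toNat_of_nonneg h0]
  · have h0 := Int.emod_nonneg ((p : ℤ) + t) hL.ne'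
    have hlt := Int.emod_lt_of_pos ((p : ℤ) + t) hL
    refine ⟨⟨(((p : ℤ) + t) % L).toNat, by omega⟩, ?_⟩
    rw [Displaced, Int.toNat_of_nonneg h0]
    exact (Int.mod_modEq _ _).symm

lemma val_sub_eq_one_iff (hL : 1 < L) (p c : Fin L) :
    (c - p).val = 1 ↔ Displaced BC.periodic 1 p c := by
  have hsub : (((c - p).val : ℕ) : ℤ) ≡ c - p [ZMOD L] := by
    rw [Fin.intCast_val_sub_eq_sub_add_ite]
    split_ifs
    · simp
    · exact Int.add_modEq_right
  constructor
  · intro h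
    rw [h] at hsub
    simpa [Displaced, period] using hsub.add_left (p : ℤ)
  · intro h
    have h1 : (c : ℤ) - p ≡ 1 [ZMOD L] := by
      simpa [Displaced, period] using (h.sub_right (p : ℤ)).symm
    exact Nat.ModEq.eq_of_lt_of_lt (Int.natCast_modEq_iff.1 (by exact_mod_cast hsub.trans h1))
      (c - p).2 hL

lemma line_adj_iff (hL : 1 < L) (p c : Fin L) :
    (line bc L).Adj p c ↔ Displaced bc 1 p c ∨ Displaced bc (-1) p c := by
  cases bc
  · simp only [line, Displaced, period, SimpleGraph.pathGraph_adj, Int.modEq_zero_iff]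
    omega
  · rw [line, SimpleGraph.cycleGraph_adj', val_sub_eq_one_iff hL, val_sub_eq_one_iff hL, or_comm]
    exact or_congr_right ⟨fun h => h.symm, fun h => by simpa using h.symm⟩

lemma line_dist_le_of_displaced_natCast (hL : 1 < L) {n : ℕ} {p c : Fin L}
    (h : Displaced bc n p c) : (line bc L).dist p c ≤ n := by
  induction n generalizing c with
  | zero => simp [h.eq (displaced_zero bc p)]
  | succ n ih =>
    obtain ⟨c', hc'⟩ : ∃ c', Displaced bc n p c' := exists_displaced fun hbc => by
      subst hbc
      have := Int.modEq_zero_iff.1 h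
      grind
    have hadj : (line bc L).Adj c' c := (line_adj_iff hL c' c).2
      (Or.inl (by simpa using hc'.symm.trans h))
    have htri := (line_connected (bc := bc) hL.le).dist_triangle (u := p) (v := c') (w := c)
    rw [SimpleGraph.dist_eq_one_iff_adj.2 hadj] at htri
    exact htri.trans (Nat.add_le_add_right (ih hc') 1)

lemma exists_displaced_of_walk (hL : 1 < L) {p c : Fin L} (w : (line bc L).Walk p c) :
    ∃ t : ℤ, t.natAbs ≤ w.length ∧ Displaced bc t p c := by
  induction w with
  | nil => exact ⟨0, le_rfl, displaced_zero bc _⟩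
  | cons hadj w ih =>
    obtain ⟨t, ht, h⟩ := ih
    rw [SimpleGraph.Walk.length_cons]
    obtain h1 | h1 := (line_adj_iff hL _ _).1 hadj
    · exact ⟨1 + t, by omega, h1.trans h⟩
    · exact ⟨-1 + t, by omega, h1.trans h⟩

lemma line_dist_le_iff (hL : 1 < L) {n : ℕ} {p c : Fin L} :
    (line bc L).dist p c ≤ n ↔ ∃ t : ℤ, t.natAbs ≤ n ∧ Displaced bc t p c := by
  constructor
  · intro h
    obtain ⟨w, hw⟩ := (line_connected (bc := bc) hL.le).exists_walk_length_eq_dist p c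
    obtain ⟨t, ht, htpc⟩ := exists_displaced_of_walk hL w
    exact ⟨t, by omega, htpc⟩
  · rintro ⟨t, ht, h⟩
    refine le_trans ?_ ht
    obtain ht' | ht' := Int.natAbs_eq t
    · exact line_dist_le_of_displaced_natCast hL (ht' ▸ h)
    · rw [SimpleGraph.dist_comm]
      exact line_dist_le_of_displaced_natCast hL (by rw [ht'] at h; simpa using h.symm)

lemma domain_dist_eq (hL : 1 < L) (p q : Site L) :
    (domain bc L).dist p q = (line bc L).dist p.1 q.1 + (line bc L).dist p.2 q.2 := by
  have hdom := ((domain_connected (bc := bc) hL.le).preconnected p q).coe_dist_eq_edist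
  have hfst := ((line_connected (bc := bc) hL.le).preconnected p.1 q.1).coe_dist_eq_edist
  have hsnd := ((line_connected (bc := bc) hL.le).preconnected p.2 q.2).coe_dist_eq_edist
  rw [domain_eq_boxProd] at hdom ⊢
  rw [SimpleGraph.edist_boxProd, ← hfst, ← hsnd] at hdom
  exact_mod_cast hdom

lemma card_le_of_forall_displaced (p : Fin L) {T : Finset (Fin L)} {A : Finset ℤ}
    (h : ∀ c ∈ T, ∃ t ∈ A, Displaced bc t p c) : T.card ≤ A.card := by
  choose! f hf hfd using h
  exact Finset.card_le_card_of_injOn f hf fun c hc c' hc' he =>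
    (hfd c hc).eq (he ▸ hfd c' hc')

open Classical in
lemma line_degree_le (hL : 1 < L) (p : Fin L) : (line bc L).degree p ≤ 2 := by
  refine (card_le_of_forall_displaced (bc := bc) (A := {1, -1}) p fun c hc => ?_).trans
    Finset.card_le_two
  simpa using (line_adj_iff hL p c).1 ((SimpleGraph.mem_neighborFinset _ _ _).1 hc)

open Classical in
lemma domain_degree_le (hL : 1 < L) (p : Site L) : (domain bc L).degree p ≤ 4 := by
  have h : (line bc L □ line bc L).degree p ≤ 4 := by
    rw [SimpleGraph.degree_boxProd]
    exact add_le_add (line_degree_le hL p.1) (line_degree_le hL p.2)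
  convert h
  exact domain_eq_boxProd bc L

lemma card_line_ball_le (hL : 1 < L) (p : Fin L) (r : ℕ) :
    {c | (line bc L).dist p c ≤ r}.ncard ≤ 2 * r + 1 := by
  classical
  rw [Set.ncard_eq_toFinset_card']
  refine (card_le_of_forall_displaced (bc := bc) (A := Finset.Icc (-(r : ℤ)) r) p
    fun c hc => ?_).trans (by rw [Int.card_Icc]; omega)
  obtain ⟨t, ht, h⟩ := (line_dist_le_iff hL).1 (by simpa using hc)
  exact ⟨t, Finset.mem_Icc.2 (by omega), h⟩

lemma card_domain_ball_le (hL : 1 < L) (p : Site L) (r : ℕ) :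
    {q | (domain bc L).dist p q ≤ r}.ncard ≤ (2 * r + 1) ^ 2 :=
  calc {q | (domain bc L).dist p q ≤ r}.ncard
      ≤ ({c | (line bc L).dist p.1 c ≤ r} ×ˢ {c | (line bc L).dist p.2 c ≤ r}).ncard := by
        refine Set.ncard_le_ncard (fun q hq => ?_) (Set.toFinite _)
        have hq' : _ ≤ r := hq
        rw [domain_dist_eq hL] at hq'
        exact ⟨(Nat.le_add_right _ _).trans hq', (Nat.le_add_left _ _).trans hq'⟩
    _ ≤ (2 * r + 1) ^ 2 := by
        rw [Set.ncard_prod, sq]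
        exact Nat.mul_le_mul (card_line_ball_le hL p.1 r) (card_line_ball_le hL p.2 r)

lemma inWindow_iff {a c : Fin L} : InWindow bc m a c ↔ ∃ i < m, Displaced bc (i : ℕ) a c := by
  cases bc
  · simp only [InWindow, Displaced, period, Int.modEq_zero_iff]
    exact ⟨fun h => ⟨c - a, by omega, by omega⟩, fun ⟨i, hi, h⟩ => by omega⟩
  · have hL : (0 : ℤ) < L := by exact_mod_cast a.pos
    constructor
    · intro h
      have h0 := Int.emod_nonneg ((c : ℤ) - a) hL.ne'
      refine ⟨(((c : ℤ) - a) % L).toNat, by simp only [InWindow] at h; omega, ?_⟩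
      rw [Int.toNat_of_nonneg h0]
      simpa [Displaced, period] using (Int.mod_modEq ((c : ℤ) - a) L).add_left (a : ℤ)
    · rintro ⟨i, hi, h⟩
      have hsub : (i : ℤ) ≡ c - a [ZMOD L] := by simpa [period] using h.sub_right (a : ℤ)
      calc ((c : ℤ) - a) % L = i % L := hsub.symm
        _ ≤ i := by exact_mod_cast Nat.mod_le i L
        _ < m := by exact_mod_cast hi

lemma IsSquareOf.dist_le (hL : 1 < L) {s : Finset (Site L)} (hs : IsSquareOf bc k s) {x y : Site L}
    (hx : x ∈ s) (hy : y ∈ s) : (domain bc L).dist x y ≤ 2 * 2 ^ k := by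
  have hline {a u w : Fin L} (hu : InWindow bc (2 ^ k) a u) (hw : InWindow bc (2 ^ k) a w) :
      (line bc L).dist u w ≤ 2 ^ k := by
    obtain ⟨i, hi, hiu⟩ := inWindow_iff.1 hu
    obtain ⟨j, hj, hjw⟩ := inWindow_iff.1 hw
    exact (line_dist_le_iff hL).2 ⟨-i + j, by omega, hiu.symm.trans hjw⟩
  obtain ⟨⟨a, b, hmem⟩, -⟩ := hs
  rw [domain_dist_eq hL, two_mul]
  exact add_le_add (hline ((hmem x).1 hx).1 ((hmem y).1 hy).1)
    (hline ((hmem x).1 hx).2 ((hmem y).1 hy).2)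

/-- The window `{a, …, a + m - 1}` has `m` points and does not leave the domain. -/
def FitsWindow (bc : BC) (m : ℕ) (a : Fin L) : Prop := m ≤ L ∧ (bc = BC.free → a + m ≤ L)

open Classical in
lemma FitsWindow.card_eq {a : Fin L} (h : FitsWindow bc m a) :
    (Finset.univ.filter fun c : Fin L => InWindow bc m a c).card = m := by
  have : Nonempty (Fin L) := ⟨a⟩
  have hex : ∀ i < m, ∃ c : Fin L, Displaced bc (i : ℕ) a c := fun i hi =>
    exists_displaced fun hbc => by have := h.2 hbc; simp only [Set.mem_Ico]; omega
  choose! f hf using hex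
  have hinj : Set.InjOn f (Finset.range m) := fun i hi j hj hij => by
    have hi' := Finset.mem_range.1 hi
    have hj' := Finset.mem_range.1 hj
    have hmod : (i : ℤ) ≡ j [ZMOD period bc L] :=
      Int.ModEq.add_left_cancel' (a : ℤ)
        (Int.ModEq.trans (hf i hi') (Int.ModEq.symm (hij ▸ hf j hj')))
    cases bc
    · exact_mod_cast Int.modEq_zero_iff.1 hmod
    · exact Nat.ModEq.eq_of_lt_of_lt (Int.natCast_modEq_iff.1 hmod) (hi'.trans_le h.1)
        (hj'.trans_le h.1)
  have himage : (Finset.univ.filter fun c : Fin L => InWindow bc m a c)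
      = (Finset.range m).image f := by
    ext c
    simp only [Finset.mem_filter_univ, inWindow_iff, Finset.mem_image, Finset.mem_range]
    exact ⟨fun ⟨i, hi, hc⟩ => ⟨i, hi, (hf i hi).eq hc⟩, fun ⟨i, hi, hc⟩ => ⟨i, hi, hc ▸ hf i hi⟩⟩
  rw [himage, Finset.card_image_of_injOn hinj, Finset.card_range]

lemma exists_fitsWindow (a : Fin L) {m' : ℕ} (hm : m ≤ m') (hmL : m' ≤ L) :
    ∃ a' : Fin L, FitsWindow bc m' a' ∧ ∀ c, InWindow bc m a c → InWindow bc m' a' c := by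
  have ha := a.2
  cases bc
  · refine ⟨⟨min a (L - m'), by omega⟩, ⟨hmL, fun _ => ?_⟩, fun c hc => ?_⟩
    · simp only
      omega
    · simp only [InWindow] at hc ⊢
      omega
  · exact ⟨a, ⟨hmL, nofun⟩, fun c hc => hc.trans_le (by exact_mod_cast hm)⟩

lemma exists_inWindow_of_dist_le (hL : 1 < L) (p : Fin L) (r : ℕ) :
    ∃ a : Fin L, ∀ c, (line bc L).dist p c ≤ r → InWindow bc (2 * r + 1) a c := by
  by_cases hp : bc = BC.free ∧ (p : ℕ) < r
  · obtain ⟨rfl, hpr⟩ := hp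
    refine ⟨⟨0, by omega⟩, fun c hc => ?_⟩
    obtain ⟨t, ht, h⟩ := (line_dist_le_iff hL).1 hc
    have := Int.modEq_zero_iff.1 h
    simp only [InWindow]
    omega
  · obtain ⟨a, ha⟩ : ∃ a, Displaced bc (-r) p a := exists_displaced fun hbc => by
      simp only [hbc, true_and, not_lt] at hp
      have := p.2
      simp only [Set.mem_Ico]
      omega
    refine ⟨a, fun c hc => ?_⟩
    obtain ⟨t, ht, h⟩ := (line_dist_le_iff hL).1 hc
    have hac : Displaced bc (r + t) a c := by simpa using ha.symm.trans h
    refine inWindow_iff.2 ⟨(r + t).toNat, by omega, ?_⟩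
    rwa [Int.toNat_of_nonneg (by omega)]

lemma isSquareOf_univ (hL : 0 < L) (hk : L < 2 ^ k) :
    IsSquareOf bc k (Finset.univ : Finset (Site L)) := by
  have hwindow (c : Fin L) : InWindow bc (2 ^ k) ⟨0, hL⟩ c :=
    inWindow_iff.2 ⟨c, c.2.trans hk, by simp [Displaced]⟩
  exact ⟨⟨⟨0, hL⟩, ⟨0, hL⟩, fun p => by simp [hwindow]⟩, fun h => absurd hk h.not_gt, fun _ => rfl⟩

lemma exists_isSquareOf_of_inWindow (hm : m ≤ 2 ^ k) (a b : Fin L) :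
    ∃ s : Finset (Site L), IsSquareOf bc k s ∧
      ∀ q : Site L, InWindow bc m a q.1 → InWindow bc m b q.2 → q ∈ s := by
  classical
  obtain hk | hk := lt_or_ge L (2 ^ k)
  · exact ⟨Finset.univ, isSquareOf_univ a.pos hk, fun q _ _ => Finset.mem_univ q⟩
  obtain ⟨a', ha, haw⟩ := exists_fitsWindow (bc := bc) a hm hk
  obtain ⟨b', hb, hbw⟩ := exists_fitsWindow (bc := bc) b hm hk
  refine ⟨(Finset.univ.filter fun c : Fin L => InWindow bc (2 ^ k) a' c) ×ˢ
    (Finset.univ.filter fun c : Fin L => InWindow bc (2 ^ k) b' c),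
    ⟨⟨a', b', fun p => by simp⟩, fun _ => ?_, fun h => absurd h hk.not_gt⟩, fun q h₁ h₂ => ?_⟩
  · rw [Finset.card_product, ha.card_eq, hb.card_eq]
  · simp [haw q.1 h₁, hbw q.2 h₂]

lemma exists_isSquareOf_ball (hL : 1 < L) (p : Site L) {r : ℕ} (hr : 2 * r + 1 ≤ 2 ^ k) :
    ∃ s : Finset (Site L), IsSquareOf bc k s ∧ ∀ q, (domain bc L).dist p q ≤ r → q ∈ s := by
  obtain ⟨a, ha⟩ := exists_inWindow_of_dist_le (bc := bc) hL p.1 r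
  obtain ⟨b, hb⟩ := exists_inWindow_of_dist_le (bc := bc) hL p.2 r
  obtain ⟨s, hs, hmem⟩ := exists_isSquareOf_of_inWindow hr a b
  refine ⟨s, hs, fun q hq => ?_⟩
  rw [domain_dist_eq hL] at hq
  exact hmem q (ha _ (by omega)) (hb _ (by omega))

lemma IsSquareOf.exists_superset {k' : ℕ} (hk : k ≤ k') {s : Finset (Site L)}
    (hs : IsSquareOf bc k s) : ∃ s' : Finset (Site L), IsSquareOf bc k' s' ∧ s ⊆ s' := by
  obtain ⟨⟨a, b, hmem⟩, -⟩ := hs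
  obtain ⟨s', hs', hsub⟩ :=
    exists_isSquareOf_of_inWindow (bc := bc) (Nat.pow_le_pow_right two_pos hk) a b
  exact ⟨s', hs', fun q hq => hsub q ((hmem q).1 hq).1 ((hmem q).1 hq).2⟩

end Geometry

/-! ### Minimal square covers -/

section Covers

lemma exists_dominating_subset {X : Type*} (T : Finset X) {r : X → X → Prop}
    (hr : ∀ x y, r x y → r y x) (h : ∀ t ∈ T, ∃ t' ∈ T, t' ≠ t ∧ r t t') :
    ∃ D ⊆ T, 2 * D.card ≤ T.card ∧ ∀ t ∈ T, t ∈ D ∨ ∃ d ∈ D, r d t := by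
  classical
  let independent : Finset (Finset X) :=
    {I ∈ T.powerset | (I : Set X).Pairwise fun x y => ¬ r x y}
  obtain ⟨I, hI⟩ := independent.exists_maximal ⟨∅, by simp [independent]⟩
  simp only [independent, Finset.mem_filter, Finset.mem_powerset] at hI
  obtain ⟨hIT, hindep⟩ := hI.prop
  -- A maximal independent set and its complement are both dominating: take the smaller one.
  have hdom : ∀ t ∈ T, t ∈ I ∨ ∃ d ∈ I, r d t := fun t ht => by
    by_contra! hcon
    have hins := hI.le_of_ge ⟨Finset.insert_subset ht hIT, by
      rw [Finset.coe_insert]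
      exact hindep.insert fun i hi _ => ⟨fun hti => hcon.2 i hi (hr _ _ hti), hcon.2 i hi⟩⟩
      (Finset.subset_insert t I)
    exact hcon.1 (hins (Finset.mem_insert_self t I))
  have hdom' : ∀ t ∈ T, t ∈ T \ I ∨ ∃ d ∈ T \ I, r d t := fun t ht => by
    by_cases htI : t ∈ I
    · obtain ⟨t', ht', hne, hrt⟩ := h t ht
      have ht'I : t' ∉ I := fun ht'I => hindep htI ht'I hne.symm hrt
      exact Or.inr ⟨t', Finset.mem_sdiff.2 ⟨ht', ht'I⟩, hr _ _ hrt⟩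
    · exact Or.inl (Finset.mem_sdiff.2 ⟨ht, htI⟩)
  have hcard := Finset.card_sdiff_add_card_eq_card hIT
  rcases le_total I.card (T \ I).card with hle | hle
  · exact ⟨I, hIT, by omega, hdom⟩
  · exact ⟨T \ I, Finset.sdiff_subset, by omega, hdom'⟩

section Density

variable {V : Type} [Fintype V] {ρ : V → ℤ}

lemma mem_supp {j : V} : j ∈ supp ρ ↔ ρ j ≠ 0 := by
  simp [supp]

lemma supp_nonempty (hρ : ρ ≠ 0) : (supp ρ).Nonempty := by
  obtain ⟨j, hj⟩ := Function.ne_iff.1 hρ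
  exact ⟨j, mem_supp.2 hj⟩

lemma card_supp_le_normSq (ρ : V → ℤ) : ((supp ρ).card : ℝ) ≤ normSq ρ := by
  have hsq : ∀ j ∈ supp ρ, (1 : ℝ) ≤ (ρ j : ℝ) ^ 2 := fun j hj => by
    exact_mod_cast Int.one_le_abs (pow_ne_zero 2 (mem_supp.1 hj)) |>.trans_eq (abs_sq _)
  calc ((supp ρ).card : ℝ) ≤ ∑ j ∈ supp ρ, (ρ j : ℝ) ^ 2 := by
        simpa using Finset.card_nsmul_le_sum _ _ 1 hsq
    _ ≤ normSq ρ := Finset.sum_le_univ_sum_of_nonneg fun _ => sq_nonneg _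

end Density

section SetDist

variable {V : Type} {G : SimpleGraph V} {A B : Finset V}

lemma setDist_le {i j : V} (hi : i ∈ A) (hj : j ∈ B) : setDist G A B ≤ G.dist i j :=
  Nat.sInf_le ⟨i, hi, j, hj, rfl⟩

lemma exists_dist_eq_setDist (hA : A.Nonempty) (hB : B.Nonempty) :
    ∃ i ∈ A, ∃ j ∈ B, G.dist i j = setDist G A B := by
  obtain ⟨i, hi⟩ := hA
  obtain ⟨j, hj⟩ := hB
  exact Nat.sInf_mem (s := {n | ∃ i ∈ A, ∃ j ∈ B, G.dist i j = n}) ⟨_, i, hi, j, hj, rfl⟩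

lemma setDist_comm (G : SimpleGraph V) (A B : Finset V) : setDist G A B = setDist G B A := by
  refine congrArg sInf (Set.ext fun n => ?_)
  constructor <;> exact fun ⟨i, hi, j, hj, h⟩ => ⟨j, hj, i, hi, by rw [G.dist_comm, h]⟩

lemma setDist_self (hA : A.Nonempty) : setDist G A A = 0 := by
  obtain ⟨i, hi⟩ := hA
  exact Nat.le_zero.1 ((setDist_le hi hi).trans_eq SimpleGraph.dist_self)

end SetDist

variable {bc : BC} {L : ℕ} {S : ℕ → (Site L → ℤ) → Finset (Finset (Site L))} {ρ : Site L → ℤ}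
  {α : ℝ} {k : ℕ}

lemma IsCoverChoice.card_pos (hS : IsCoverChoice bc S) (hρ : ρ ≠ 0) (k : ℕ) :
    0 < (S k ρ).card := by
  obtain ⟨j, hj⟩ := supp_nonempty hρ
  obtain ⟨s, hs, -⟩ := (hS ρ hρ k).1.2 j hj
  exact Finset.card_pos.2 ⟨s, hs⟩

lemma IsCoverChoice.card_le_of_cover (hS : IsCoverChoice bc S) (hρ : ρ ≠ 0) {ι : Type*}
    {I : Finset ι} {f : ι → Finset (Site L)} (hf : ∀ i ∈ I, IsSquareOf bc k (f i))
    (hcov : ∀ j ∈ supp ρ, ∃ i ∈ I, j ∈ f i) : (S k ρ).card ≤ I.card := by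
  classical
  refine ((hS ρ hρ k).2 (I.image f) ⟨Finset.forall_mem_image.2 hf, fun j hj => ?_⟩).trans
    Finset.card_image_le
  obtain ⟨i, hi, hji⟩ := hcov j hj
  exact ⟨f i, Finset.mem_image_of_mem f hi, hji⟩

lemma IsCoverChoice.exists_mem_supp (hS : IsCoverChoice bc S) (hρ : ρ ≠ 0)
    {s : Finset (Site L)} (hs : s ∈ S k ρ) :
    ∃ j ∈ supp ρ, j ∈ s ∧ ∀ s' ∈ S k ρ, s' ≠ s → j ∉ s' := by
  classical
  by_contra! hcon
  obtain ⟨hsq, hcov⟩ := (hS ρ hρ k).1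
  refine (Finset.card_erase_lt_of_mem hs).not_ge (hS.card_le_of_cover hρ (f := id)
    (fun t ht => hsq t (Finset.mem_of_mem_erase ht)) fun j hj => ?_)
  obtain ⟨t, ht, hjt⟩ := hcov j hj
  rcases eq_or_ne t s with rfl | hts
  · obtain ⟨s', hs', hne, hjs'⟩ := hcon j hj hjt
    exact ⟨s', Finset.mem_erase.2 ⟨hne, hs'⟩, hjs'⟩
  · exact ⟨t, Finset.mem_erase.2 ⟨hts, ht⟩, hjt⟩

lemma IsCoverChoice.nonempty_of_mem (hS : IsCoverChoice bc S) (hρ : ρ ≠ 0)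
    {s : Finset (Site L)} (hs : s ∈ S k ρ) : s.Nonempty := by
  obtain ⟨j, -, hj, -⟩ := hS.exists_mem_supp hρ hs
  exact ⟨j, hj⟩

lemma IsCoverChoice.antitone_card (hS : IsCoverChoice bc S) (hρ : ρ ≠ 0) :
    Antitone fun k => (S k ρ).card := by
  intro k k' hk
  obtain ⟨hsq, hcov⟩ := (hS ρ hρ k).1
  choose! f hf hsub using fun s (hs : s ∈ S k ρ) => (hsq s hs).exists_superset hk
  refine hS.card_le_of_cover hρ hf fun j hj => ?_
  obtain ⟨s, hs, hjs⟩ := hcov j hj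
  exact ⟨s, hs, hsub s hs hjs⟩

lemma IsCoverChoice.card_zero_le_normSq (hL : 1 < L) (hS : IsCoverChoice bc S) (hρ : ρ ≠ 0) :
    ((S 0 ρ).card : ℝ) ≤ normSq ρ := by
  choose f hf hmem using fun j : Site L =>
    exists_isSquareOf_ball (bc := bc) hL j (r := 0) (k := 0) le_rfl
  have hcard : (S 0 ρ).card ≤ (supp ρ).card :=
    hS.card_le_of_cover hρ (fun j _ => hf j) fun j hj => ⟨j, hj, hmem j j (by simp)⟩
  exact (Nat.cast_le.2 hcard).trans (card_supp_le_normSq ρ)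

lemma IsCoverChoice.card_eq_one (hL : 0 < L) (hS : IsCoverChoice bc S) (hρ : ρ ≠ 0)
    (hk : L < 2 ^ k) : (S k ρ).card = 1 :=
  le_antisymm (hS.card_le_of_cover hρ (I := {()}) (f := fun _ => Finset.univ)
    (fun _ _ => isSquareOf_univ hL hk) (by simp)) (hS.card_pos hρ k)

lemma IsCoverChoice.diam_le (hL : 1 < L) (hS : IsCoverChoice bc S) (hρ : ρ ≠ 0)
    (hk : (S k ρ).card = 1) : diam (domain bc L) ρ ≤ 2 * 2 ^ k := by
  obtain ⟨hsq, hcov⟩ := (hS ρ hρ k).1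
  obtain ⟨s, hs⟩ := Finset.card_eq_one.1 hk
  simp only [hs, Finset.mem_singleton, forall_eq, exists_eq_left] at hsq hcov
  exact Finset.sup_le fun p hp => hsq.dist_le hL (hcov _ (Finset.mem_product.1 hp).1)
    (hcov _ (Finset.mem_product.1 hp).2)

/-- The distance `2 M 2^{α(k+1)}` beyond which a square of side `2^k` counts as separated. -/
noncomputable def sepDist (α : ℝ) (k : ℕ) : ℝ := 2 * M * (2 : ℝ) ^ (α * ((k : ℝ) + 1))

lemma mem_sepSquares {s : Finset (Site L)} :
    s ∈ sepSquares bc α S k ρ ↔ (S k ρ).card ≠ 1 ∧ s ∈ S k ρ ∧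
      ∀ s' ∈ S k ρ, s' ≠ s → sepDist α k ≤ (setDist (domain bc L) s' s : ℝ) := by
  unfold sepSquares sepDist
  split_ifs with h <;> simp [h]

lemma sepSquares_subset : sepSquares bc α S k ρ ⊆ S k ρ := fun _ h => (mem_sepSquares.1 h).2.1

lemma sepDist_eq (α : ℝ) (k : ℕ) : sepDist α k = 2 ^ 17 * (2 : ℝ) ^ (α * ((k : ℝ) + 1)) := by
  rw [sepDist, M]
  ring

lemma two_pow_succ_le_rpow (hα : 1 ≤ α) (k : ℕ) :
    (2 : ℝ) ^ (k + 1) ≤ (2 : ℝ) ^ (α * ((k : ℝ) + 1)) := by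
  rw [← Real.rpow_natCast]
  refine Real.rpow_le_rpow_of_exponent_le one_le_two ?_
  push_cast
  exact le_mul_of_one_le_left (by positivity) hα

/-- A scale whose squares contain a square of side `2^k` together with all the squares of that
side at distance less than `sepDist α k`. -/
noncomputable def mergeScale (α : ℝ) (k : ℕ) : ℕ := ⌈α * ((k : ℝ) + 1)⌉₊ + 19

lemma ball_le_two_pow_mergeScale (hα : 1 ≤ α) (k : ℕ) :
    2 * (⌊sepDist α k⌋₊ + 4 * 2 ^ k) + 1 ≤ 2 ^ mergeScale α k := by
  have hk := two_pow_succ_le_rpow hα k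
  have hone : (1 : ℝ) ≤ 2 ^ k := one_le_pow₀ one_le_two
  have hceil : (2 : ℝ) ^ (α * ((k : ℝ) + 1)) ≤ 2 ^ ⌈α * ((k : ℝ) + 1)⌉₊ := by
    rw [← Real.rpow_natCast]
    exact Real.rpow_le_rpow_of_exponent_le one_le_two (Nat.le_ceil _)
  have hfloor : (⌊sepDist α k⌋₊ : ℝ) ≤ sepDist α k :=
    Nat.floor_le (by rw [sepDist_eq]; positivity)
  have hdist := sepDist_eq α k
  rw [pow_succ] at hk
  have hreal : 2 * ((⌊sepDist α k⌋₊ : ℝ) + 4 * 2 ^ k) + 1 ≤ 2 ^ mergeScale α k := by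
    rw [mergeScale, pow_add]
    linarith
  exact_mod_cast hreal

lemma IsSquareOf.exists_mergeScale (hL : 1 < L) (hα : 1 ≤ α) {s : Finset (Site L)}
    (hs : IsSquareOf bc k s) (hne : s.Nonempty) :
    ∃ s', IsSquareOf bc (mergeScale α k) s' ∧ ∀ t, IsSquareOf bc k t → t.Nonempty →
      (setDist (domain bc L) t s : ℝ) < sepDist α k → t ⊆ s' := by
  obtain ⟨p, hp⟩ := hne
  obtain ⟨s', hs', hball⟩ :=
    exists_isSquareOf_ball (bc := bc) hL p (ball_le_two_pow_mergeScale hα k)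
  refine ⟨s', hs', fun t ht hne' hlt q hq => hball q ?_⟩
  obtain ⟨i, hi, j, hj, hij⟩ := exists_dist_eq_setDist (G := domain bc L) hne' ⟨p, hp⟩
  have hG : (domain bc L).Connected := domain_connected (by omega)
  have hji : (domain bc L).dist j i ≤ ⌊sepDist α k⌋₊ := by
    rw [SimpleGraph.dist_comm, hij]
    exact Nat.le_floor hlt.le
  calc (domain bc L).dist p q
      ≤ (domain bc L).dist p j + ((domain bc L).dist j i + (domain bc L).dist i q) :=
        hG.dist_triangle.trans (Nat.add_le_add_left hG.dist_triangle _)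
    _ ≤ 2 * 2 ^ k + (⌊sepDist α k⌋₊ + 2 * 2 ^ k) :=
        add_le_add (hs.dist_le hL hp hj) (add_le_add hji (ht.dist_le hL hi hq))
    _ = ⌊sepDist α k⌋₊ + 4 * 2 ^ k := by ring

lemma exists_setDist_lt_of_notMem_sepSquares (hk : (S k ρ).card ≠ 1) {s : Finset (Site L)}
    (hs : s ∈ S k ρ \ sepSquares bc α S k ρ) :
    ∃ t ∈ S k ρ \ sepSquares bc α S k ρ, t ≠ s ∧
      (setDist (domain bc L) t s : ℝ) < sepDist α k := by
  simp only [Finset.mem_sdiff] at hs ⊢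
  obtain ⟨hsS, hsep⟩ := hs
  rw [mem_sepSquares] at hsep
  push Not at hsep
  obtain ⟨t, ht, hne, hlt⟩ := hsep hk hsS
  refine ⟨t, ⟨ht, fun hsep => ?_⟩, hne, hlt⟩
  have hge := (mem_sepSquares.1 hsep).2.2 s hsS hne.symm
  rw [setDist_comm] at hge
  exact hlt.not_ge hge

lemma IsCoverChoice.two_mul_card_mergeScale_le (hL : 1 < L) (hα : 1 ≤ α)
    (hS : IsCoverChoice bc S) (hρ : ρ ≠ 0) (hk : (S k ρ).card ≠ 1) :
    2 * (S (mergeScale α k) ρ).card ≤ (S k ρ).card + (sepSquares bc α S k ρ).card := by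
  classical
  obtain ⟨hsq, hcov⟩ := (hS ρ hρ k).1
  obtain ⟨D, hD, hDcard, hdom⟩ := exists_dominating_subset _
    (r := fun s t => (setDist (domain bc L) t s : ℝ) < sepDist α k)
    (fun s t h => by rwa [setDist_comm]) fun s hs => exists_setDist_lt_of_notMem_sepSquares hk hs
  choose! f hf hmerge using fun s (hs : s ∈ S k ρ) =>
    (hsq s hs).exists_mergeScale hL hα (hS.nonempty_of_mem hρ hs)
  have hself : ∀ s ∈ S k ρ, s ⊆ f s := fun s hs =>
    hmerge s hs s (hsq s hs) (hS.nonempty_of_mem hρ hs) (by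
      rw [setDist_self (hS.nonempty_of_mem hρ hs), sepDist_eq, Nat.cast_zero]
      positivity)
  have hDS : D ⊆ S k ρ := hD.trans Finset.sdiff_subset
  have hcard : (S (mergeScale α k) ρ).card ≤ (sepSquares bc α S k ρ ∪ D).card := by
    refine hS.card_le_of_cover hρ (f := f)
      (fun s hs => hf s (Finset.union_subset sepSquares_subset hDS hs)) fun j hj => ?_
    obtain ⟨s, hs, hjs⟩ := hcov j hj
    by_cases hsep : s ∈ sepSquares bc α S k ρ
    · exact ⟨s, Finset.mem_union_left _ hsep, hself s hs hjs⟩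
    rcases hdom s (Finset.mem_sdiff.2 ⟨hs, hsep⟩) with hsD | ⟨d, hd, hlt⟩
    · exact ⟨s, Finset.mem_union_right _ hsD, hself s hs hjs⟩
    · exact ⟨d, Finset.mem_union_right _ hd,
        hmerge d (hDS hd) s (hsq s hs) (hS.nonempty_of_mem hρ hs) hlt hjs⟩
  have hunion := Finset.card_union_le (sepSquares bc α S k ρ) D
  have hsdiff := Finset.card_sdiff_add_card_eq_card
    (sepSquares_subset : sepSquares bc α S k ρ ⊆ S k ρ)
  omega

end Covers

/-! ### Entropy of the covers -/

section Entropy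

lemma sum_mul_le_of_antitone {b v : ℕ → ℝ} {B : ℝ} (hb : ∀ n, ∑ i ∈ Finset.range n, b i ≤ B)
    (hv : Antitone v) (hv0 : ∀ n, 0 ≤ v n) (n : ℕ) :
    ∑ i ∈ Finset.range n, b i * v i ≤ B * v 0 := by
  have habel : ∀ n, ∑ i ∈ Finset.range n, b i * v i ≤
      (∑ i ∈ Finset.range n, b i) * v n + B * (v 0 - v n) := by
    intro n
    induction n with
    | zero => simp
    | succ n ih =>
      have hstep := mul_le_mul_of_nonneg_right (hb (n + 1)) (sub_nonneg.2 (hv (Nat.le_succ n)))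
      rw [Finset.sum_range_succ] at hstep ⊢
      rw [Finset.sum_range_succ]
      linarith
  calc ∑ i ∈ Finset.range n, b i * v i
      ≤ (∑ i ∈ Finset.range n, b i) * v n + B * (v 0 - v n) := habel n
    _ ≤ B * v n + B * (v 0 - v n) := by
        gcongr
        exacts [hv0 n, hb n]
    _ = B * v 0 := by ring

/-- If `g` grows at a rate `α < 2`, then a sequence that is halved, up to an error, between `j + 1`
and `g j` is summable up to the sum of the errors. -/
lemma sum_le_of_halving {α : ℝ} (hα : 0 ≤ α) {g : ℕ → ℕ} (hg : Monotone g)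
    (hle : ∀ j, j + 1 ≤ g j) (hstep : ∀ j, g (j + 1) ≤ g j + 2)
    (hgrowth : ∀ n, (g n : ℝ) - g 0 ≤ α * n + 1) {u s : ℕ → ℝ} (hu : Antitone u)
    (hu0 : ∀ k, 0 ≤ u k) (hs : ∀ k, 0 ≤ s k) (h : ∀ j, 2 * u (g j) ≤ u (j + 1) + s (j + 1))
    (n : ℕ) :
    (2 - α) * ∑ k ∈ Finset.range (g n), u k ≤
      (2 * g 0 + 1) * u 0 + 2 * ∑ j ∈ Finset.range n, s (j + 1) := by
  set δ : ℕ → ℝ := fun j => (g (j + 1) : ℝ) - g j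
  have hδ0 : ∀ j, 0 ≤ δ j := fun j => sub_nonneg.2 (Nat.cast_le.2 (hg (Nat.le_succ j)))
  have hδ2 : ∀ j, δ j ≤ 2 := fun j =>
    sub_le_iff_le_add'.2 (by exact_mod_cast hstep j)
  have hblocks : ∑ k ∈ Finset.range (g n), u k ≤
      g 0 * u 0 + ∑ j ∈ Finset.range n, δ j * u (g j) := by
    rw [← Finset.sum_range_add_sum_Ico _ (hg (Nat.zero_le n))]
    refine add_le_add ?_ ?_
    · simpa using Finset.sum_le_card_nsmul (Finset.range (g 0)) u (u 0)
        fun k _ => hu (Nat.zero_le k)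
    · refine (Finset.le_sum_schlomilch' (fun i j _ hij => hu hij)
        (fun j => (Nat.succ_pos j).trans_le (hle j)) hg n).trans_eq
        (Finset.sum_congr rfl fun j _ => ?_)
      rw [nsmul_eq_mul, Nat.cast_sub (hg (Nat.le_succ j))]
  have hhalf : ∀ j, 2 * (δ j * u (g j)) ≤
      α * u (j + 1) + (δ j - α) * u (j + 1) + 2 * s (j + 1) := fun j => by
    have hj := mul_le_mul_of_nonneg_left (h j) (hδ0 j)
    have hsj := mul_le_mul_of_nonneg_right (hδ2 j) (hs (j + 1))
    linarith
  have hexcess : ∑ j ∈ Finset.range n, (δ j - α) * u (j + 1) ≤ 1 * u (0 + 1) := by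
    refine sum_mul_le_of_antitone (v := fun j => u (j + 1)) (fun m => ?_)
      (fun i j hij => hu (by omega)) (fun j => hu0 (j + 1)) n
    rw [Finset.sum_sub_distrib, Finset.sum_range_sub (fun j => (g j : ℝ))]
    simp only [Finset.sum_const, Finset.card_range, nsmul_eq_mul]
    linarith [hgrowth m]
  have hshift : ∑ j ∈ Finset.range n, u (j + 1) ≤ ∑ k ∈ Finset.range (g n), u k := by
    have hsub := Finset.sum_le_sum_of_subset_of_nonneg
      (Finset.range_subset_range.2 (hle n)) fun k _ _ => hu0 k
    rw [Finset.sum_range_succ'] at hsub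
    linarith [hu0 0]
  have hsum := Finset.sum_le_sum fun j (_ : j ∈ Finset.range n) => hhalf j
  rw [Finset.sum_add_distrib, Finset.sum_add_distrib, ← Finset.mul_sum, ← Finset.mul_sum,
    ← Finset.mul_sum] at hsum
  linarith [mul_le_mul_of_nonneg_left hshift hα, hu (Nat.zero_le (0 + 1))]

lemma le_mergeScale {α : ℝ} (hα : 1 ≤ α) (k : ℕ) : k ≤ mergeScale α k := by
  have hreal : (k : ℝ) ≤ α * ((k : ℝ) + 1) := by nlinarith
  exact (Nat.cast_le.1 (hreal.trans (Nat.le_ceil _))).trans (Nat.le_add_right _ _)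

lemma monotone_mergeScale {α : ℝ} (hα : 0 ≤ α) : Monotone (mergeScale α) := fun _ _ _ => by
  unfold mergeScale
  gcongr

lemma mergeScale_succ_le {α : ℝ} (hα : 0 ≤ α) (hα' : α ≤ 2) (k : ℕ) :
    mergeScale α (k + 1) ≤ mergeScale α k + 2 := by
  have hmul : α * (((k + 1 : ℕ) : ℝ) + 1) ≤ α * ((k : ℝ) + 1) + (2 : ℕ) := by
    push_cast
    linarith
  have hceil := (Nat.ceil_mono hmul).trans_eq (Nat.ceil_add_natCast (by positivity) 2)
  unfold mergeScale
  omega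

lemma mergeScale_one_le {α : ℝ} (hα' : α ≤ 2) : mergeScale α 1 ≤ 23 := by
  have hceil : ⌈α * (((1 : ℕ) : ℝ) + 1)⌉₊ ≤ 4 := Nat.ceil_le.2 (by push_cast; linarith)
  unfold mergeScale
  omega

lemma mergeScale_sub_le {α : ℝ} (hα : 0 ≤ α) (n : ℕ) :
    (mergeScale α (n + 1) : ℝ) - mergeScale α 1 ≤ α * n + 1 := by
  have hupper := (Nat.ceil_lt_add_one (show 0 ≤ α * (((n + 1 : ℕ) : ℝ) + 1) by positivity)).le
  have hlower := Nat.le_ceil (α * (((1 : ℕ) : ℝ) + 1))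
  unfold mergeScale
  push_cast at hupper hlower ⊢
  linarith

lemma sum_le_of_mergeScale {α : ℝ} (hα : 1 ≤ α) (hα' : α < 2) {u s : ℕ → ℝ} (hu : Antitone u)
    (hu0 : ∀ k, 0 ≤ u k) (hs : ∀ k, 0 ≤ s k)
    (h : ∀ k, 2 * u (mergeScale α k) ≤ u k + s k) (n : ℕ) :
    ∑ k ∈ Finset.range n, u k ≤ 47 / (2 - α) * (u 0 + ∑ j ∈ Finset.range n, s (j + 1)) := by
  have hα0 : 0 ≤ α := zero_le_one.trans hα
  have hpos : 0 < 2 - α := sub_pos.2 hα'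
  have hhalving := sum_le_of_halving (g := fun j => mergeScale α (j + 1)) hα0
    (fun i j hij => monotone_mergeScale hα0 (Nat.succ_le_succ hij))
    (fun j => le_mergeScale hα (j + 1)) (fun j => mergeScale_succ_le hα0 hα'.le (j + 1))
    (mergeScale_sub_le hα0) hu hu0 hs (fun j => h (j + 1)) n
  have hsub : ∑ k ∈ Finset.range n, u k ≤ ∑ k ∈ Finset.range (mergeScale α (n + 1)), u k :=
    Finset.sum_le_sum_of_subset_of_nonneg
      (Finset.range_subset_range.2 ((Nat.le_succ n).trans (le_mergeScale hα (n + 1))))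
      fun k _ _ => hu0 k
  have hfirst : (mergeScale α 1 : ℝ) * u 0 ≤ 23 * u 0 :=
    mul_le_mul_of_nonneg_right (by exact_mod_cast mergeScale_one_le hα'.le) (hu0 0)
  have herror : 0 ≤ ∑ j ∈ Finset.range n, s (j + 1) := Finset.sum_nonneg fun j _ => hs _
  rw [div_mul_eq_mul_div, le_div_iff₀ hpos]
  linarith [mul_le_mul_of_nonneg_left hsub hpos.le]

variable {bc : BC} {L : ℕ} {S : ℕ → (Site L → ℤ) → Finset (Finset (Site L))} {ρ : Site L → ℤ}
  {α : ℝ}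

lemma IsCoverChoice.card_sepSquares_eq_zero (hL : 0 < L) (hS : IsCoverChoice bc S) (hρ : ρ ≠ 0)
    (α : ℝ) {k : ℕ} (hk : k ∉ Finset.range L) :
    ((sepSquares bc α S (k + 1) ρ).card : ℝ) = 0 := by
  have hcard := hS.card_eq_one (k := k + 1) hL hρ
    (((not_lt.1 (Finset.mem_range.not.1 hk)).trans (Nat.le_succ k)).trans_lt Nat.lt_two_pow_self)
  rw [sepSquares, if_pos hcard, Finset.card_empty, Nat.cast_zero]

lemma IsCoverChoice.sepTotal_eq (hL : 0 < L) (hS : IsCoverChoice bc S) (hρ : ρ ≠ 0) (α : ℝ) :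
    sepTotal bc α S ρ = ∑ k ∈ Finset.range L, ((sepSquares bc α S (k + 1) ρ).card : ℝ) :=
  tsum_eq_sum fun _ hk => hS.card_sepSquares_eq_zero hL hρ α hk

lemma sepTotal_nonneg (α : ℝ) : 0 ≤ sepTotal bc α S ρ := tsum_nonneg fun _ => Nat.cast_nonneg _

lemma IsCoverChoice.sum_sepSquares_le (hL : 0 < L) (hS : IsCoverChoice bc S) (hρ : ρ ≠ 0) (α : ℝ)
    (n : ℕ) : ∑ k ∈ Finset.range n, ((sepSquares bc α S (k + 1) ρ).card : ℝ)
      ≤ sepTotal bc α S ρ :=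
  (summable_of_ne_finset_zero fun _ hk => hS.card_sepSquares_eq_zero hL hρ α hk).sum_le_tsum _
    fun _ _ => Nat.cast_nonneg _

lemma IsCoverChoice.one_le_card (hS : IsCoverChoice bc S) (hρ : ρ ≠ 0) (k : ℕ) :
    (1 : ℝ) ≤ (S k ρ).card :=
  Nat.one_le_cast.2 (hS.card_pos hρ k)

lemma IsCoverChoice.one_le_normSq_add (hL : 1 < L) (hS : IsCoverChoice bc S) (hρ : ρ ≠ 0) (α : ℝ) :
    1 ≤ normSq ρ + sepTotal bc α S ρ :=
  le_add_of_le_of_nonneg ((hS.one_le_card hρ 0).trans (hS.card_zero_le_normSq hL hρ))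
    (sepTotal_nonneg α)

lemma IsCoverChoice.sum_card_sub_one_le (hL : 1 < L) (hα : 1 ≤ α) (hα' : α < 2)
    (hS : IsCoverChoice bc S) (hρ : ρ ≠ 0) (n : ℕ) :
    ∑ k ∈ Finset.range n, ((S k ρ).card - 1 : ℝ) ≤
      47 / (2 - α) * (normSq ρ + sepTotal bc α S ρ) := by
  have : 0 < 2 - α := sub_pos.2 hα'
  have hhalf : ∀ k, 2 * ((S (mergeScale α k) ρ).card - 1 : ℝ) ≤
      ((S k ρ).card - 1 : ℝ) + (sepSquares bc α S k ρ).card := fun k => by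
    by_cases hk : (S k ρ).card = 1
    · have hone := hS.antitone_card hρ (le_mergeScale hα k)
      simp only [hk, ← Nat.cast_le (α := ℝ)] at hone ⊢
      push_cast at hone ⊢
      linarith [Nat.cast_nonneg (α := ℝ) (sepSquares bc α S k ρ).card]
    · have hmerge : (2 * (S (mergeScale α k) ρ).card : ℝ) ≤
          (S k ρ).card + (sepSquares bc α S k ρ).card := by
        exact_mod_cast hS.two_mul_card_mergeScale_le hL hα hρ hk
      linarith
  refine (sum_le_of_mergeScale hα hα' (fun k k' hk => ?_)
    (fun k => sub_nonneg.2 (hS.one_le_card hρ k)) (fun k => Nat.cast_nonneg _) hhalf n).trans ?_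
  · exact sub_le_sub_right (Nat.cast_le.2 (hS.antitone_card hρ hk)) 1
  · gcongr
    · exact (sub_le_self _ zero_le_one).trans (hS.card_zero_le_normSq hL hρ)
    · exact hS.sum_sepSquares_le (by omega) hρ α n

lemma IsCoverChoice.exists_diam_le_two_pow (hL : 1 < L) (hα : 1 ≤ α) (hα' : α < 2)
    (hS : IsCoverChoice bc S) (hρ : ρ ≠ 0) :
    ∃ m : ℕ, (diam (domain bc L) ρ : ℝ) ≤ 2 ^ (m + 1) ∧
      (m : ℝ) ≤ 47 / (2 - α) * (normSq ρ + sepTotal bc α S ρ) := by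
  classical
  have hex : ∃ k, (S k ρ).card = 1 := ⟨L, hS.card_eq_one (by omega) hρ Nat.lt_two_pow_self⟩
  refine ⟨Nat.find hex, ?_, ?_⟩
  · rw [pow_succ']
    exact_mod_cast hS.diam_le hL hρ (Nat.find_spec hex)
  · refine le_trans ?_ (hS.sum_card_sub_one_le hL hα hα' hρ (Nat.find hex))
    have htwo : ∀ k ∈ Finset.range (Nat.find hex), (1 : ℝ) ≤ (S k ρ).card - 1 := fun k hk => by
      have hne := Nat.find_min hex (Finset.mem_range.1 hk)
      have hge : (2 : ℝ) ≤ (S k ρ).card := by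
        have := hS.card_pos hρ k
        exact_mod_cast (by omega : 2 ≤ (S k ρ).card)
      linarith
    simpa using Finset.card_nsmul_le_sum _ _ 1 htwo

/-- The constant in the bound of the entropy `A(ρ)`, and of `log₂ (d(ρ) + 1)`, by
`‖ρ‖₂² + ∑ |S_k^sep(ρ)|`. -/
noncomputable def entropyConst (α : ℝ) : ℝ := 20 + 3 * (47 / (2 - α))

lemma entropyConst_pos (hα' : α < 2) : 0 < entropyConst α := by
  have : 0 < 2 - α := sub_pos.2 hα'
  unfold entropyConst
  positivity

lemma IsCoverChoice.logb_diam_add_one_le (hL : 1 < L) (hα : 1 ≤ α) (hα' : α < 2)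
    (hS : IsCoverChoice bc S) (hρ : ρ ≠ 0) :
    Real.logb 2 ((diam (domain bc L) ρ : ℝ) + 1) ≤
      entropyConst α * (normSq ρ + sepTotal bc α S ρ) := by
  obtain ⟨m, hdiam, hm⟩ := hS.exists_diam_le_two_pow hL hα hα' hρ
  have hX := hS.one_le_normSq_add hL hρ α
  have hlog : Real.logb 2 ((diam (domain bc L) ρ : ℝ) + 1) ≤ (m + 2 : ℕ) := by
    rw [Real.logb_le_iff_le_rpow one_lt_two (by positivity), Real.rpow_natCast]
    have hone : (1 : ℝ) ≤ 2 ^ (m + 1) := one_le_pow₀ one_le_two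
    rw [pow_succ _ (m + 1)]
    linarith
  push_cast at hlog
  rw [entropyConst]
  linarith [m.cast_nonneg (α := ℝ)]

lemma ceil_logb_mul_rpow_le {d : ℝ} {m : ℕ} (hd : 1 ≤ d) (hdm : d ≤ 2 ^ m) (hα' : α ≤ 2) :
    ⌈Real.logb 2 (M * d ^ α)⌉₊ ≤ 16 + 2 * m := by
  have hMpos : 0 < M := by norm_num [M]
  rw [Nat.ceil_le, Real.logb_le_iff_le_rpow one_lt_two (by positivity), Real.rpow_natCast]
  calc M * d ^ α ≤ M * d ^ (2 : ℝ) := by gcongr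
    _ = M * d ^ 2 := by rw [Real.rpow_two]
    _ ≤ M * (2 ^ m) ^ 2 := by gcongr
    _ = 2 ^ (16 + 2 * m) := by rw [M, pow_add, ← pow_mul, mul_comm m 2]

lemma IsCoverChoice.coverSum_le (hL : 1 < L) (hα : 1 ≤ α) (hα' : α < 2)
    (hS : IsCoverChoice bc S) (hρ : ρ ≠ 0) :
    coverSum bc α S ρ ≤ entropyConst α * (normSq ρ + sepTotal bc α S ρ) := by
  have hX := hS.one_le_normSq_add hL hρ α
  unfold coverSum
  split_ifs with hd
  · exact mul_nonneg (entropyConst_pos hα').le (zero_le_one.trans hX)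
  obtain ⟨m, hdiam, hm⟩ := hS.exists_diam_le_two_pow hL hα hα' hρ
  set n := ⌈Real.logb 2 (M * (diam (domain bc L) ρ : ℝ) ^ α)⌉₊
  have hn : n ≤ 16 + 2 * (m + 1) :=
    ceil_logb_mul_rpow_le (Nat.one_le_cast.2 (Nat.pos_of_ne_zero hd)) hdiam hα'.le
  have hn' : (n : ℝ) ≤ 16 + 2 * (m + 1) := by exact_mod_cast hn
  have hsum := hS.sum_card_sub_one_le hL hα hα' hρ (n + 1)
  simp only [Finset.sum_sub_distrib, Finset.sum_const, Finset.card_range, nsmul_eq_mul, mul_one]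
    at hsum
  push_cast at hsum
  rw [entropyConst]
  linarith

end Entropy

/-! ### Spin waves -/

section DegreeBound

variable {V : Type} [Fintype V] {G : SimpleGraph V} {d : ℕ}

open Classical in
lemma dirichletEnergy_le_of_degree_le (hd : ∀ j, G.degree j ≤ d) (f : V → ℝ) :
    dirichletEnergy G f ≤ 2 * d * ∑ j, f j ^ 2 := by
  have hrow (j : V) : ∑ l, (if G.Adj j l then f j ^ 2 else 0) ≤ d * f j ^ 2 := by
    rw [← Finset.sum_filter, Finset.sum_const, nsmul_eq_mul, ← SimpleGraph.neighborFinset_eq_filter]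
    exact mul_le_mul_of_nonneg_right (by exact_mod_cast hd j) (sq_nonneg _)
  have hswap : ∑ j, ∑ l, (if G.Adj j l then f l ^ 2 else 0)
      = ∑ j, ∑ l, if G.Adj j l then f j ^ 2 else 0 := by
    rw [Finset.sum_comm]
    simp only [G.adj_comm]
  calc dirichletEnergy G f
      ≤ 1 / 2 * ∑ j, ∑ l, (2 * (if G.Adj j l then f j ^ 2 else 0)
          + 2 * if G.Adj j l then f l ^ 2 else 0) := by
        unfold dirichletEnergy
        gcongr with j _ l _
        split_ifs
        · linarith [sq_nonneg (f j + f l)]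
        · simp
    _ = 2 * ∑ j, ∑ l, if G.Adj j l then f j ^ 2 else 0 := by
        simp only [Finset.sum_add_distrib, ← Finset.mul_sum, hswap]
        ring
    _ ≤ 2 * ∑ j, d * f j ^ 2 := by gcongr with j; exact hrow j
    _ = 2 * d * ∑ j, f j ^ 2 := by rw [← Finset.mul_sum, mul_assoc]

open Classical in
lemma dirichletEnergy_le_of_local (hd : ∀ j, G.degree j ≤ d) {f : V → ℝ} {T : Set V} {δ : ℝ}
    (hT : ∀ j l, G.Adj j l → f j ≠ f l → j ∈ T) (hδ : ∀ j l, G.Adj j l → |f j - f l| ≤ δ) :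
    dirichletEnergy G f ≤ 1 / 2 * (T.ncard * (d * δ ^ 2)) := by
  have hrow (j : V) : ∑ l, (if G.Adj j l then (f j - f l) ^ 2 else 0)
      ≤ if j ∈ T then d * δ ^ 2 else 0 := by
    rw [← Finset.sum_filter, ← SimpleGraph.neighborFinset_eq_filter]
    split_ifs with hj
    · refine (Finset.sum_le_card_nsmul _ _ (δ ^ 2) fun l hl => ?_).trans ?_
      · exact sq_le_sq.2 ((hδ j l ((G.mem_neighborFinset j l).1 hl)).trans (le_abs_self δ))
      · rw [nsmul_eq_mul]
        exact mul_le_mul_of_nonneg_right (by exact_mod_cast hd j) (sq_nonneg _)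
    · refine (Finset.sum_eq_zero fun l hl => ?_).le
      have hfjl : f j = f l := not_not.1 (mt (hT j l ((G.mem_neighborFinset j l).1 hl)) hj)
      rw [hfjl, sub_self, zero_pow two_ne_zero]
  unfold dirichletEnergy
  gcongr
  calc ∑ j, ∑ l, (if G.Adj j l then (f j - f l) ^ 2 else 0)
      ≤ ∑ j, if j ∈ T then (d * δ ^ 2 : ℝ) else 0 := Finset.sum_le_sum fun j _ => hrow j
    _ = T.ncard * (d * δ ^ 2) := by
      rw [← Finset.sum_filter, Finset.sum_const, nsmul_eq_mul, Set.ncard_eq_toFinset_card',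
        Set.filter_mem_univ_eq_toFinset]

end DegreeBound

section JumpDist

variable {V ι : Type*} {G : SimpleGraph V} {B : ι → Set V} {F : Set ι} {s : Finset V} {x y z : V}

/-- The least number of edges of a walk from `s` to `y` with free jumps in the sets `B i`,
`i ∈ F`. -/
noncomputable def jumpDist (G : SimpleGraph V) (B : ι → Set V) (F : Set ι) (s : Finset V)
    (y : V) : ℕ :=
  sInf {n | ∃ x ∈ s, Reach G B F x n y}

lemma jumpDist_le {n : ℕ} (hx : x ∈ s) (h : Reach G B F x n y) : jumpDist G B F s y ≤ n :=
  Nat.sInf_le ⟨x, hx, h⟩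

lemma jumpDist_le_dist (hG : G.Connected) (hx : x ∈ s) (y : V) :
    jumpDist G B F s y ≤ G.dist x y := by
  obtain ⟨p, hp⟩ := hG.exists_walk_length_eq_dist x y
  have hreach := Reach.of_walk (B := B) (F := F) Reach.refl p
  rw [zero_add, hp] at hreach
  exact jumpDist_le hx hreach

lemma exists_reach_jumpDist (hG : G.Connected) (hs : s.Nonempty) (y : V) :
    ∃ x ∈ s, Reach G B F x (jumpDist G B F s y) y := by
  obtain ⟨x, hx⟩ := hs
  obtain ⟨p⟩ := hG.preconnected x y
  exact Nat.sInf_mem (s := {n | ∃ x ∈ s, Reach G B F x n y}) ⟨_, x, hx, Reach.of_walk Reach.refl p⟩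

lemma jumpDist_le_of_adj (hG : G.Connected) (hs : s.Nonempty) (h : G.Adj y z) :
    jumpDist G B F s z ≤ jumpDist G B F s y + 1 := by
  obtain ⟨x, hx, hr⟩ := exists_reach_jumpDist hG hs y
  exact jumpDist_le hx (hr.step h)

lemma jumpDist_eq_of_mem (hG : G.Connected) (hs : s.Nonempty) {i : ι} (hi : i ∈ F) (hy : y ∈ B i)
    (hz : z ∈ B i) : jumpDist G B F s y = jumpDist G B F s z := by
  obtain ⟨x, hx, hr⟩ := exists_reach_jumpDist hG hs y
  obtain ⟨x', hx', hr'⟩ := exists_reach_jumpDist hG hs z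
  exact le_antisymm (jumpDist_le hx' (hr'.jump i hi hz hy)) (jumpDist_le hx (hr.jump i hi hy hz))

end JumpDist

section Cutoff

variable {r R n m : ℕ}

/-- The cutoff that decreases linearly from `1` at `r` to `0` at `r + R`. -/
noncomputable def cutoff (r R n : ℕ) : ℝ := max 0 (min 1 (((r : ℝ) + R - n) / R))

lemma cutoff_eq_one (hR : 0 < R) (h : n ≤ r) : cutoff r R n = 1 := by
  have hn : (n : ℝ) ≤ r := by exact_mod_cast h
  rw [cutoff, min_eq_left ((one_le_div (by exact_mod_cast hR)).2 (by linarith)),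
    max_eq_right zero_le_one]

lemma cutoff_eq_zero (h : r + R ≤ n) : cutoff r R n = 0 := by
  have hn : (r : ℝ) + R ≤ n := by exact_mod_cast h
  exact max_eq_left ((min_le_right _ _).trans
    (div_nonpos_of_nonpos_of_nonneg (sub_nonpos.2 hn) R.cast_nonneg))

lemma abs_cutoff_sub_le (hnm : n ≤ m + 1) (hmn : m ≤ n + 1) :
    |cutoff r R n - cutoff r R m| ≤ 1 / R := by
  have hlin : |((r : ℝ) + R - n) / R - ((r : ℝ) + R - m) / R| ≤ 1 / R := by
    have hnm' : (n : ℝ) ≤ m + 1 := by exact_mod_cast hnm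
    have hmn' : (m : ℝ) ≤ n + 1 := by exact_mod_cast hmn
    rw [← sub_div, abs_div, Nat.abs_cast]
    gcongr
    rw [abs_le]
    constructor <;> linarith
  simpa [cutoff] using (abs_max_sub_max_le_max 0 _ 0 _).trans
    (max_le (by simp) ((abs_min_sub_min_le_max 1 _ 1 _).trans (max_le (by simp) hlin)))

end Cutoff

section Discs

variable {V : Type} [Fintype V] {G : SimpleGraph V} {N : Finset (V → ℤ)} {ρ ρ' : V → ℤ} {α : ℝ}
  {x y : V}

lemma dist_le_diam (hx : x ∈ supp ρ) (hy : y ∈ supp ρ) : G.dist x y ≤ diam G ρ :=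
  Finset.le_sup (f := fun p : V × V => G.dist p.1 p.2) (Finset.mk_mem_product hx hy)

lemma diam_pos (hG : G.Connected) (hρ : ρ ≠ 0) (hQ : charge ρ = 0) : 0 < diam G ρ := by
  obtain ⟨j, hj⟩ := supp_nonempty hρ
  by_contra! hdiam
  have hsingle (i : V) (hij : i ≠ j) : ρ i = 0 := by
    by_contra hi
    exact (hG.pos_dist_of_ne hij).not_ge ((dist_le_diam (mem_supp.2 hi) hj).trans hdiam)
  exact mem_supp.1 hj ((Fintype.sum_eq_single j hsingle).symm.trans hQ)

/-- The neighbourhood of the support of `ρ` of radius `d(ρ)`. -/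
def disc (G : SimpleGraph V) (ρ : V → ℤ) : Set V :=
  {x | ∃ i ∈ supp ρ, G.dist i x ≤ diam G ρ}

lemma mem_disc_of_mem_supp (hx : x ∈ supp ρ) : x ∈ disc G ρ := ⟨x, hx, by simp⟩

lemma dist_le_of_mem_disc (hG : G.Connected) (hx : x ∈ disc G ρ) (hy : y ∈ disc G ρ) :
    G.dist x y ≤ 3 * diam G ρ := by
  obtain ⟨i, hi, hix⟩ := hx
  obtain ⟨j, hj, hjy⟩ := hy
  have hij := dist_le_diam (G := G) hi hj
  have h₁ := hG.dist_triangle (u := x) (v := i) (w := y)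
  have h₂ := hG.dist_triangle (u := i) (v := j) (w := y)
  rw [SimpleGraph.dist_comm (u := x) (v := i)] at h₁
  omega

lemma PropB.mul_diam_le_dist (hG : G.Connected) (hα : 1 ≤ α) (hB : PropB G α N) (hρ : ρ ∈ N)
    (hρ' : ρ' ∈ N) (hne : ρ ≠ ρ') (hd : diam G ρ ≤ diam G ρ') (hx : x ∈ disc G ρ)
    (hy : y ∈ supp ρ') : (2 ^ 16 - 1) * diam G ρ ≤ G.dist x y := by
  obtain ⟨i, hi, hix⟩ := hx
  have hrpow : (diam G ρ : ℝ) ≤ (diam G ρ : ℝ) ^ α := by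
    rcases (diam G ρ).eq_zero_or_pos with h | h
    · rw [h, Nat.cast_zero]
      exact Real.rpow_nonneg le_rfl α
    · exact Real.self_le_rpow_of_one_le (by exact_mod_cast h) hα
  have hsep : (2 ^ 16 * diam G ρ : ℝ) ≤ densDist G ρ ρ' :=
    calc (2 ^ 16 * diam G ρ : ℝ) ≤ M * (diam G ρ : ℝ) ^ α := by unfold M; gcongr
      _ ≤ densDist G ρ ρ' := by simpa [hd] using hB.1 ρ hρ ρ' hρ' hne
  have hiy : 2 ^ 16 * diam G ρ ≤ G.dist i y :=
    (by exact_mod_cast hsep : _ ≤ densDist G ρ ρ').trans (setDist_le hi hy)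
  have htri := hG.dist_triangle (u := i) (v := x) (w := y)
  omega

lemma PropB.notMem_supp_of_mem_disc (hG : G.Connected) (hα : 1 ≤ α) (hN : IsEnsemble N)
    (hB : PropB G α N) (hρ : ρ ∈ neutral N) (hρ' : ρ' ∈ N) (hne : ρ ≠ ρ')
    (hd : diam G ρ ≤ diam G ρ') (hx : x ∈ disc G ρ) : x ∉ supp ρ' := fun hx' => by
  have hpos := diam_pos hG (hN.1 ρ hρ.1) hρ.2
  have hdist := hB.mul_diam_le_dist hG hα hρ.1 hρ' hne hd hx hx'
  rw [SimpleGraph.dist_self] at hdist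
  omega

lemma eight_pow_le_rpow (hα : 3 / 2 ≤ α) {m : ℕ} {t : ℝ} (ht : 4 ^ m ≤ t) : 8 ^ m ≤ t ^ α := by
  have h4 : (1 : ℝ) ≤ 4 ^ m := one_le_pow₀ (by norm_num)
  calc (8 : ℝ) ^ m = (4 ^ m) ^ (3 / 2 : ℝ) := by
        rw [← Real.rpow_natCast, ← Real.rpow_natCast, show (8 : ℝ) = 2 ^ (3 : ℝ) by norm_num,
          show (4 : ℝ) = 2 ^ (2 : ℝ) by norm_num]
        simp only [← Real.rpow_mul zero_le_two]
        ring_nf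
    _ ≤ (4 ^ m) ^ α := Real.rpow_le_rpow_of_exponent_le h4 hα
    _ ≤ t ^ α := Real.rpow_le_rpow (by positivity) ht (by linarith)

lemma isSparse_disc (hG : G.Connected) (hα : 3 / 2 ≤ α) (hN : IsEnsemble N) (hB : PropB G α N) :
    IsSparse G (disc G) (neutral N) (diam G) where
  one_le_size ρ hρ := diam_pos hG (hN.1 ρ hρ.1) hρ.2
  dist_le _ _ _ hx _ hy := dist_le_of_mem_disc hG hx hy
  le_dist := by
    rintro ρ hρ ρ' hρ' hne m hm hm' x ⟨i, hi, hix⟩ y ⟨j, hj, hjy⟩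
    have hsep : (2 ^ 16 * 8 ^ m : ℝ) ≤ densDist G ρ ρ' := by
      refine le_trans ?_ (hB.1 ρ hρ.1 ρ' hρ'.1 hne)
      unfold M
      gcongr
      exact eight_pow_le_rpow hα (le_min (by exact_mod_cast hm.1) (by exact_mod_cast hm'.1))
    have hij : 2 ^ 16 * 8 ^ m ≤ G.dist i j :=
      (by exact_mod_cast hsep : _ ≤ densDist G ρ ρ').trans (setDist_le hi hj)
    have h₁ := hG.dist_triangle (u := i) (v := x) (w := j)
    have h₂ := hG.dist_triangle (u := x) (v := y) (w := j)
    rw [SimpleGraph.dist_comm (u := y) (v := j)] at h₂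
    have h48 : 4 ^ m ≤ 8 ^ m := Nat.pow_le_pow_left (by norm_num) m
    have := pow_succ 4 m ▸ hm.2
    have := pow_succ 4 m ▸ hm'.2
    omega

end Discs

section SpinWave

variable {V : Type} [Fintype V] {G : SimpleGraph V} {N : Finset (V → ℤ)} {ρ ρ' : V → ℤ} {α : ℝ}
  {k : ℕ} {s : Finset V} {p q j l x y : V}

/-- The neutral densities of `N` of diameter less than `4 ^ ⌈k / 2⌉`, which is `2 ^ k` up to a
factor `2`. -/
def smallNeutral (G : SimpleGraph V) (N : Finset (V → ℤ)) (k : ℕ) : Set (V → ℤ) :=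
  {ρ ∈ neutral N | diam G ρ < 4 ^ ((k + 1) / 2)}

/-- The spin wave of a square `s` of side `2 ^ k`: it equals `1` near `s` and is cut off at
distance `33 * 2 ^ k`. Distances are measured with free jumps in the discs of the small neutral
densities, which makes the wave constant on these discs. -/
noncomputable def spinWave (G : SimpleGraph V) (N : Finset (V → ℤ)) (k : ℕ) (s : Finset V)
    (j : V) : ℝ :=
  cutoff (32 * 2 ^ k) (2 ^ k) (jumpDist G (disc G) (smallNeutral G N k) s j)

lemma spinWave_eq_one (hG : G.Connected) (hj : j ∈ s) : spinWave G N k s j = 1 := by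
  refine cutoff_eq_one (by positivity) ((jumpDist_le_dist hG hj j).trans ?_)
  simp

lemma jumpDist_lt_of_spinWave_ne_zero (h : spinWave G N k s j ≠ 0) :
    jumpDist G (disc G) (smallNeutral G N k) s j < 33 * 2 ^ k := by
  by_contra! hle
  exact h (cutoff_eq_zero (by omega))

lemma abs_spinWave_sub_le (hG : G.Connected) (hs : s.Nonempty) (h : G.Adj j l) :
    |spinWave G N k s j - spinWave G N k s l| ≤ 1 / 2 ^ k := by
  simpa only [spinWave, Nat.cast_pow, Nat.cast_ofNat] using
    abs_cutoff_sub_le (r := 32 * 2 ^ k) (R := 2 ^ k) (jumpDist_le_of_adj hG hs h.symm)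
      (jumpDist_le_of_adj hG hs h)

lemma le_dist_of_spinWave_ne (hG : G.Connected) (h : G.Adj j l)
    (hne : spinWave G N k s j ≠ spinWave G N k s l) (hq : q ∈ s) : 32 * 2 ^ k ≤ G.dist q j := by
  refine le_trans ?_ (jumpDist_le_dist (B := disc G) (F := smallNeutral G N k) hG hq j)
  by_contra! hlt
  have hjl := jumpDist_le_of_adj (B := disc G) (F := smallNeutral G N k) hG ⟨q, hq⟩ h
  refine hne ?_
  rw [spinWave, cutoff_eq_one (by positivity) hlt.le, spinWave,
    cutoff_eq_one (by positivity) (by omega)]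

lemma dist_le_of_jumpDist_le (hG : G.Connected) (hα : 3 / 2 ≤ α) (hN : IsEnsemble N)
    (hB : PropB G α N) (hs : ∀ x ∈ s, ∀ y ∈ s, G.dist x y ≤ 2 * 2 ^ k) (hp : p ∈ s)
    (hj : jumpDist G (disc G) (smallNeutral G N k) s j ≤ 33 * 2 ^ k) :
    G.dist p j ≤ 52 * 2 ^ k := by
  obtain ⟨x, hx, hr⟩ := exists_reach_jumpDist (B := disc G) (F := smallNeutral G N k) hG ⟨p, hp⟩ j
  have hpow : 4 ^ ((k + 1) / 2) ≤ 2 * 2 ^ k := by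
    rw [show 4 = 2 ^ 2 by norm_num, ← pow_mul, ← pow_succ']
    exact Nat.pow_le_pow_right two_pos (by omega)
  have hfac : jumpFactor ((k + 1) / 2) ≤ 9 / 8 := by
    rw [jumpFactor]
    linarith [pow_nonneg (by norm_num : (0 : ℝ) ≤ 1 / 2) ((k + 1) / 2)]
  have hxj : (G.dist x j : ℝ) ≤ (50 * 2 ^ k : ℕ) :=
    calc (G.dist x j : ℝ) ≤ _ := hr.dist_le hG (isSparse_disc hG hα hN hB) _
      _ ≤ 9 / 8 * (33 * 2 ^ k : ℕ) + 6 * (2 * 2 ^ k : ℕ) := by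
        gcongr
        exact_mod_cast hpow
      _ ≤ (50 * 2 ^ k : ℕ) := by
        push_cast
        linarith [pow_nonneg (zero_le_two (α := ℝ)) k]
  have hxj' : G.dist x j ≤ 50 * 2 ^ k := by exact_mod_cast hxj
  have hpx := hs p hp x hx
  have htri := hG.dist_triangle (u := p) (v := x) (w := j)
  omega

lemma dist_le_of_spinWave_ne_zero (hG : G.Connected) (hα : 3 / 2 ≤ α) (hN : IsEnsemble N)
    (hB : PropB G α N) (hs : ∀ x ∈ s, ∀ y ∈ s, G.dist x y ≤ 2 * 2 ^ k) (hp : p ∈ s)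
    (hj : spinWave G N k s j ≠ 0) : G.dist p j ≤ 52 * 2 ^ k :=
  dist_le_of_jumpDist_le hG hα hN hB hs hp (jumpDist_lt_of_spinWave_ne_zero hj).le

lemma dist_le_of_spinWave_ne (hG : G.Connected) (hα : 3 / 2 ≤ α) (hN : IsEnsemble N)
    (hB : PropB G α N) (hs : ∀ x ∈ s, ∀ y ∈ s, G.dist x y ≤ 2 * 2 ^ k) (hp : p ∈ s)
    (h : G.Adj j l) (hne : spinWave G N k s j ≠ spinWave G N k s l) :
    G.dist p j ≤ 52 * 2 ^ k := by
  refine dist_le_of_jumpDist_le hG hα hN hB hs hp ?_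
  by_cases hj : spinWave G N k s j = 0
  · have hl := jumpDist_lt_of_spinWave_ne_zero (hj ▸ hne.symm)
    have hjl := jumpDist_le_of_adj (B := disc G) (F := smallNeutral G N k) hG ⟨p, hp⟩ h.symm
    omega
  · exact (jumpDist_lt_of_spinWave_ne_zero hj).le

lemma spinWave_eq_of_mem_disc (hG : G.Connected) (hα : 3 / 2 ≤ α) (hN : IsEnsemble N)
    (hB : PropB G α N) (hs : ∀ x ∈ s, ∀ y ∈ s, G.dist x y ≤ 2 * 2 ^ k) (hp : p ∈ s)
    (hρ : ρ ∈ neutral N) (hpρ : p ∈ supp ρ) (hρ' : ρ' ∈ neutral N) (hne : ρ' ≠ ρ)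
    (hd : diam G ρ' ≤ diam G ρ) (hx : x ∈ disc G ρ') (hy : y ∈ disc G ρ') :
    spinWave G N k s x = spinWave G N k s y := by
  by_cases hsmall : diam G ρ' < 4 ^ ((k + 1) / 2)
  · exact congrArg (cutoff _ _) (jumpDist_eq_of_mem hG ⟨p, hp⟩ ⟨hρ', hsmall⟩ hx hy)
  · have hpow : 2 ^ k ≤ 4 ^ ((k + 1) / 2) := by
      rw [show 4 = 2 ^ 2 by norm_num, ← pow_mul]
      exact Nat.pow_le_pow_right two_pos (by omega)
    have hzero (z : V) (hz : z ∈ disc G ρ') : spinWave G N k s z = 0 := by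
      by_contra hwz
      have hnear := dist_le_of_spinWave_ne_zero hG hα hN hB hs hp hwz
      have hfar := hB.mul_diam_le_dist hG (by linarith) hρ'.1 hρ.1 hne hd hz hpρ
      rw [SimpleGraph.dist_comm] at hfar
      have := Nat.two_pow_pos k
      omega
    rw [hzero x hx, hzero y hy]

lemma dirichletEnergy_spinWave_le {bc : BC} {L : ℕ} {N : Finset (Site L → ℤ)}
    {s : Finset (Site L)} (hL : 1 < L) (hα : 3 / 2 ≤ α) (hN : IsEnsemble N)
    (hB : PropB (domain bc L) α N) (hs : ∀ x ∈ s, ∀ y ∈ s, (domain bc L).dist x y ≤ 2 * 2 ^ k)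
    (hne : s.Nonempty) :
    dirichletEnergy (domain bc L) (spinWave (domain bc L) N k s) ≤ 2 ^ 16 := by
  have hG := domain_connected (bc := bc) (zero_lt_one.trans hL)
  obtain ⟨p, hp⟩ := hne
  have hcard : ({q | (domain bc L).dist p q ≤ 52 * 2 ^ k}.ncard : ℝ)
      ≤ (2 * (52 * 2 ^ k) + 1) ^ 2 := by
    exact_mod_cast card_domain_ball_le hL p (52 * 2 ^ k)
  have hone : (1 : ℝ) ≤ 2 ^ k := one_le_pow₀ one_le_two
  calc dirichletEnergy (domain bc L) (spinWave (domain bc L) N k s)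
      ≤ 1 / 2 * (_ * ((4 : ℕ) * (1 / 2 ^ k) ^ 2)) :=
        dirichletEnergy_le_of_local (fun j => domain_degree_le hL j)
          (fun j l h hjl => dist_le_of_spinWave_ne hG hα hN hB hs hp h hjl)
          fun j l h => abs_spinWave_sub_le hG ⟨p, hp⟩ h
    _ ≤ 1 / 2 * ((105 * 2 ^ k) ^ 2 * ((4 : ℕ) * (1 / 2 ^ k) ^ 2)) := by
        gcongr
        exact hcard.trans (by gcongr; linarith)
    _ ≤ 2 ^ 16 := by
        push_cast
        field_simp
        norm_num

end SpinWave

/-! ### Decoupling of the spin waves -/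

section Decoupling

variable {V : Type} [Fintype V] {G : SimpleGraph V} {N : Finset (V → ℤ)} {ρ ρ' : V → ℤ} {α : ℝ}
  {b b' : V → ℝ}

/-- The admissible translations of the field along the neutral density `ρ`: the functions that
vanish at distance `d(ρ)` from the support of `ρ` and are constant on the discs of the other neutral
densities of diameter at most `d(ρ)`. -/
def waveSpace (G : SimpleGraph V) (N : Finset (V → ℤ)) (ρ : V → ℤ) : Submodule ℝ (V → ℝ) where
  carrier := {b | (∀ j, b j ≠ 0 → ∃ i ∈ supp ρ, G.dist i j < diam G ρ) ∧
    ∀ ρ' ∈ neutral N, ρ' ≠ ρ → diam G ρ' ≤ diam G ρ →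
      ∀ x ∈ disc G ρ', ∀ y ∈ disc G ρ', b x = b y}
  zero_mem' := ⟨fun _ h => absurd rfl h, fun _ _ _ _ _ _ _ _ => rfl⟩
  add_mem' {b b'} hb hb' :=
    ⟨fun j hj => (Function.support_add b b' hj).elim (hb.1 j) (hb'.1 j),
      fun ρ' hρ' hne hd x hx y hy =>
        congrArg₂ (· + ·) (hb.2 ρ' hρ' hne hd x hx y hy) (hb'.2 ρ' hρ' hne hd x hx y hy)⟩
  smul_mem' c _ hb :=
    ⟨fun j hj => hb.1 j (right_ne_zero_of_mul hj), fun ρ' hρ' hne hd x hx y hy =>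
      congrArg (c * ·) (hb.2 ρ' hρ' hne hd x hx y hy)⟩

lemma toReal_mem_waveSpace (hG : G.Connected) (hα : 1 ≤ α) (hN : IsEnsemble N)
    (hB : PropB G α N) (hρ : ρ ∈ neutral N) : toReal ρ ∈ waveSpace G N ρ := by
  refine ⟨fun j hj => ⟨j, mem_supp.2 fun h => hj (by simp [toReal, h]), ?_⟩,
    fun ρ' hρ' hne hd x hx y hy => ?_⟩
  · rw [SimpleGraph.dist_self]
    exact diam_pos hG (hN.1 ρ hρ.1) hρ.2
  · have hzero (z : V) (hz : z ∈ disc G ρ') : ρ z = 0 := by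
      simpa [mem_supp] using hB.notMem_supp_of_mem_disc hG hα hN hρ' hρ.1 hne hd hz
    simp only [toReal, hzero x hx, hzero y hy]

lemma spinWave_mem_waveSpace {k : ℕ} {s : Finset V} {p : V} (hG : G.Connected) (hα : 3 / 2 ≤ α)
    (hN : IsEnsemble N) (hB : PropB G α N) (hs : ∀ x ∈ s, ∀ y ∈ s, G.dist x y ≤ 2 * 2 ^ k)
    (hρ : ρ ∈ neutral N) (hp : p ∈ s) (hpρ : p ∈ supp ρ) (hd : 52 * 2 ^ k < diam G ρ) :
    spinWave G N k s ∈ waveSpace G N ρ :=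
  ⟨fun _ hj => ⟨p, hpρ, (dist_le_of_spinWave_ne_zero hG hα hN hB hs hp hj).trans_lt hd⟩,
    fun _ hρ' hne hd' _ hx _ hy =>
      spinWave_eq_of_mem_disc hG hα hN hB hs hp hρ hpρ hρ' hne hd' hx hy⟩

lemma pairing_eq_zero_of_const (hρ : charge ρ = 0)
    (hb : ∀ x ∈ supp ρ, ∀ y ∈ supp ρ, b x = b y) : pairing b (toReal ρ) = 0 := by
  obtain ⟨c, hc⟩ : ∃ c, ∀ x ∈ supp ρ, b x = c := by
    rcases (supp ρ).eq_empty_or_nonempty with hempty | ⟨x, hx⟩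
    · exact ⟨0, by simp [hempty]⟩
    · exact ⟨b x, fun y hy => hb y hy x hx⟩
  calc pairing b (toReal ρ) = pairing (fun _ => c) (toReal ρ) := by
        refine Finset.sum_congr rfl fun j _ => ?_
        by_cases hj : ρ j = 0
        · simp [toReal, hj]
        · rw [hc j (mem_supp.2 hj)]
    _ = 0 := by rw [pairing_const_toReal, hρ, Int.cast_zero, mul_zero]

lemma dirichletForm_eq_zero_of_mem_waveSpace (hG : G.Connected) (hρ : ρ ∈ neutral N)
    (hρ' : ρ' ∈ neutral N) (hne : ρ ≠ ρ') (hb : b ∈ waveSpace G N ρ)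
    (hb' : b' ∈ waveSpace G N ρ') : dirichletForm G b b' = 0 := by
  wlog hd : diam G ρ' ≤ diam G ρ generalizing ρ ρ' b b'
  · rw [dirichletForm_comm]
    exact this hρ' hρ hne.symm hb' hb (le_of_not_ge hd)
  have hconst (j l : V) (hjl : G.Adj j l) (hj : b' j ≠ 0) : b j = b l := by
    obtain ⟨i, hi, hij⟩ := hb'.1 j hj
    have htri := hG.dist_triangle (u := i) (v := j) (w := l)
    rw [SimpleGraph.dist_eq_one_iff_adj.2 hjl] at htri
    exact hb.2 ρ' hρ' hne.symm hd j ⟨i, hi, hij.le⟩ l ⟨i, hi, by omega⟩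
  refine dirichletForm_eq_zero G fun j l hjl => ?_
  by_cases hj : b' j = 0
  · by_cases hl : b' l = 0
    · rw [hj, hl, sub_self, mul_zero]
    · rw [hconst l j hjl.symm hl, sub_self, zero_mul]
  · rw [hconst j l hjl hj, sub_self, zero_mul]

lemma pairing_eq_zero_of_mem_waveSpace (hG : G.Connected) (hα : 1 ≤ α) (hN : IsEnsemble N)
    (hB : PropB G α N) (hρ : ρ ∈ neutral N) (hρ' : ρ' ∈ neutral N) (hne : ρ ≠ ρ')
    (hb : b ∈ waveSpace G N ρ) : pairing b (toReal ρ') = 0 := by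
  rcases le_total (diam G ρ') (diam G ρ) with hd | hd
  · exact pairing_eq_zero_of_const hρ'.2 fun x hx y hy =>
      hb.2 ρ' hρ' hne.symm hd x (mem_disc_of_mem_supp hx) y (mem_disc_of_mem_supp hy)
  · refine Finset.sum_eq_zero fun j _ => ?_
    by_cases hj : b j = 0
    · rw [hj, zero_mul]
    · obtain ⟨i, hi, hij⟩ := hb.1 j hj
      have hjρ' := hB.notMem_supp_of_mem_disc hG hα hN hρ hρ'.1 hne hd ⟨i, hi, hij.le⟩
      rw [toReal, not_not.1 (mt mem_supp.2 hjρ'), Int.cast_zero, mul_zero]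

end Decoupling

section SeparatedSquares

variable {bc : BC} {L : ℕ} {S : ℕ → (Site L → ℤ) → Finset (Finset (Site L))}
  {N : Finset (Site L → ℤ)} {ρ : Site L → ℤ} {α : ℝ} {k k' : ℕ} {s s' : Finset (Site L)}
  {i j p x y : Site L}

lemma IsCoverChoice.dist_le_of_mem_sepSquare (hL : 1 < L) (hS : IsCoverChoice bc S) (hρ : ρ ≠ 0)
    (hs : s ∈ sepSquares bc α S k ρ) :
    ∀ x ∈ s, ∀ y ∈ s, (domain bc L).dist x y ≤ 2 * 2 ^ k := fun _ hx _ hy =>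
  ((hS ρ hρ k).1.1 s (sepSquares_subset hs)).dist_le hL hx hy

lemma IsCoverChoice.exists_mem_supp_notMem (hS : IsCoverChoice bc S) (hρ : ρ ≠ 0)
    (hs : s ∈ sepSquares bc α S k ρ) : ∃ q ∈ supp ρ, q ∉ s := by
  obtain ⟨hcard, hsS, -⟩ := mem_sepSquares.1 hs
  obtain ⟨t, ht, hts⟩ : ∃ t ∈ S k ρ, t ≠ s := by
    by_contra! h
    exact hcard (Finset.card_eq_one.2 ⟨s, Finset.eq_singleton_iff_unique_mem.2 ⟨hsS, h⟩⟩)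
  obtain ⟨q, hq, -, hqs⟩ := hS.exists_mem_supp hρ ht
  exact ⟨q, hq, hqs s hsS hts.symm⟩

lemma IsCoverChoice.sepDist_le_dist (hS : IsCoverChoice bc S) (hρ : ρ ≠ 0)
    (hs : s ∈ sepSquares bc α S k ρ) (hi : i ∈ supp ρ) (his : i ∉ s) (hj : j ∈ s) :
    sepDist α k ≤ (domain bc L).dist i j := by
  obtain ⟨t, ht, hit⟩ := (hS ρ hρ k).1.2 i hi
  have hts := (mem_sepSquares.1 hs).2.2 t ht fun h => his (h ▸ hit)
  exact hts.trans (by exact_mod_cast setDist_le hit hj)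

lemma IsCoverChoice.two_pow_le_dist (hα : 1 ≤ α) (hS : IsCoverChoice bc S) (hρ : ρ ≠ 0)
    (hs : s ∈ sepSquares bc α S k ρ) (hi : i ∈ supp ρ) (his : i ∉ s) (hj : j ∈ s) :
    2 ^ 18 * 2 ^ k ≤ (domain bc L).dist i j := by
  have hdist : (2 ^ 18 * 2 ^ k : ℝ) ≤ (domain bc L).dist i j :=
    calc (2 ^ 18 * 2 ^ k : ℝ) = 2 ^ 17 * 2 ^ (k + 1) := by ring
      _ ≤ sepDist α k := by
        rw [sepDist_eq]
        gcongr
        exact two_pow_succ_le_rpow hα k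
      _ ≤ _ := hS.sepDist_le_dist hρ hs hi his hj
  exact_mod_cast hdist

lemma IsCoverChoice.two_pow_le_diam (hα : 1 ≤ α) (hS : IsCoverChoice bc S) (hρ : ρ ≠ 0)
    (hs : s ∈ sepSquares bc α S k ρ) : 2 ^ 18 * 2 ^ k ≤ diam (domain bc L) ρ := by
  obtain ⟨p, hp, hps, -⟩ := hS.exists_mem_supp hρ (sepSquares_subset hs)
  obtain ⟨q, hq, hqs⟩ := hS.exists_mem_supp_notMem hρ hs
  exact (hS.two_pow_le_dist hα hρ hs hq hqs hps).trans (dist_le_diam hq hp)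

lemma mem_supp_indicator {V : Type} [Fintype V] {ρ : V → ℤ} {A : Set V} {j : V} :
    j ∈ supp (A.indicator ρ) ↔ j ∈ supp ρ ∧ j ∈ A := by
  simp [mem_supp, and_comm]

lemma IsCoverChoice.sum_sepSquare_ne_zero (hL : 1 < L) (hα : 1 ≤ α) (hS : IsCoverChoice bc S)
    (hC : PropC (domain bc L) α N) (hρN : ρ ∈ neutral N) (hρ : ρ ≠ 0)
    (hs : s ∈ sepSquares bc α S k ρ) : ∑ j ∈ s, ρ j ≠ 0 := by
  set ρ₁ : Site L → ℤ := (s : Set (Site L)).indicator ρ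
  set ρ₂ : Site L → ℤ := (s : Set (Site L))ᶜ.indicator ρ
  obtain ⟨p, hp, hps, -⟩ := hS.exists_mem_supp hρ (sepSquares_subset hs)
  obtain ⟨q, hq, hqs⟩ := hS.exists_mem_supp_notMem hρ hs
  have hp₁ : p ∈ supp ρ₁ := mem_supp_indicator.2 ⟨hp, hps⟩
  have hq₂ : q ∈ supp ρ₂ := mem_supp_indicator.2 ⟨hq, hqs⟩
  have hdisj : Disjoint (supp ρ₁) (supp ρ₂) := Finset.disjoint_left.2 fun j h₁ h₂ =>
    (mem_supp_indicator.1 h₂).2 (mem_supp_indicator.1 h₁).2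
  have hdiam : diam (domain bc L) ρ₁ ≤ 2 ^ (k + 1) := Finset.sup_le fun x hx => by
    rw [pow_succ']
    exact hS.dist_le_of_mem_sepSquare hL hρ hs _
      (mem_supp_indicator.1 (Finset.mem_product.1 hx).1).2 _
      (mem_supp_indicator.1 (Finset.mem_product.1 hx).2).2
  have hmin : (min (diam (domain bc L) ρ₁ : ℝ) (diam (domain bc L) ρ₂)) ^ α
      ≤ 2 ^ (α * ((k : ℝ) + 1)) :=
    calc (min (diam (domain bc L) ρ₁ : ℝ) (diam (domain bc L) ρ₂)) ^ α
        ≤ ((2 : ℝ) ^ (k + 1)) ^ α := by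
          gcongr
          exact (min_le_left _ _).trans (by exact_mod_cast hdiam)
      _ = 2 ^ (α * ((k : ℝ) + 1)) := by
          rw [← Real.rpow_natCast, ← Real.rpow_mul zero_le_two, Nat.cast_succ, mul_comm]
  have hdist : 2 * M * (min (diam (domain bc L) ρ₁ : ℝ) (diam (domain bc L) ρ₂)) ^ α
      ≤ densDist (domain bc L) ρ₁ ρ₂ := by
    obtain ⟨i, hi, j, hj, hij⟩ :=
      exists_dist_eq_setDist (G := domain bc L) ⟨p, hp₁⟩ ⟨q, hq₂⟩
    refine (mul_le_mul_of_nonneg_left hmin (by unfold M; positivity)).trans ?_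
    rw [densDist, ← hij, SimpleGraph.dist_comm]
    rw [mem_supp_indicator] at hi hj
    exact hS.sepDist_le_dist hρ hs hj.1 hj.2 hi.2
  have hQ := (hC ρ hρN.1 hρN.2 ρ₁ ρ₂ (fun h => mem_supp.1 hp₁ (congrFun h p))
    (fun h => mem_supp.1 hq₂ (congrFun h q)) hdisj (Set.indicator_self_add_compl _ _).symm hdist).1
  rwa [charge, Finset.sum_indicator_subset _ (Finset.subset_univ s)] at hQ

lemma IsCoverChoice.spinWave_eq_zero (hL : 1 < L) (hα : 3 / 2 ≤ α) (hS : IsCoverChoice bc S)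
    (hN : IsEnsemble N) (hB : PropB (domain bc L) α N) (hρ : ρ ≠ 0)
    (hs : s ∈ sepSquares bc α S k ρ) (hj : j ∈ supp ρ) (hjs : j ∉ s) :
    spinWave (domain bc L) N k s j = 0 := by
  obtain ⟨p, -, hp, -⟩ := hS.exists_mem_supp hρ (sepSquares_subset hs)
  by_contra hne
  have hnear := dist_le_of_spinWave_ne_zero (domain_connected (zero_lt_one.trans hL)) hα hN hB
    (hS.dist_le_of_mem_sepSquare hL hρ hs) hp hne
  have hfar := hS.two_pow_le_dist (by linarith) hρ hs hj hjs hp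
  rw [SimpleGraph.dist_comm] at hfar
  have := Nat.two_pow_pos k
  omega

lemma IsCoverChoice.one_le_abs_pairing_spinWave (hL : 1 < L) (hα : 3 / 2 ≤ α)
    (hS : IsCoverChoice bc S) (hN : IsEnsemble N) (hB : PropB (domain bc L) α N)
    (hC : PropC (domain bc L) α N) (hρ : ρ ∈ neutral N) (hs : s ∈ sepSquares bc α S k ρ) :
    1 ≤ |pairing (spinWave (domain bc L) N k s) (toReal ρ)| := by
  have hρ₀ := hN.1 ρ hρ.1
  have hsum : pairing (spinWave (domain bc L) N k s) (toReal ρ) = (∑ j ∈ s, ρ j : ℤ) := by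
    rw [pairing, ← Finset.sum_subset s.subset_univ, Int.cast_sum]
    · refine Finset.sum_congr rfl fun j hj => ?_
      rw [spinWave_eq_one (domain_connected (zero_lt_one.trans hL)) hj, one_mul, toReal]
    · intro j _ hjs
      by_cases hj : ρ j = 0
      · simp [toReal, hj]
      · rw [hS.spinWave_eq_zero hL hα hN hB hρ₀ hs (mem_supp.2 hj) hjs, zero_mul]
  rw [hsum]
  exact_mod_cast Int.one_le_abs (hS.sum_sepSquare_ne_zero hL (by linarith) hC hρ hρ₀ hs)

lemma IsCoverChoice.dirichletForm_toReal_spinWave (hL : 1 < L) (hα : 3 / 2 ≤ α)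
    (hS : IsCoverChoice bc S) (hN : IsEnsemble N) (hB : PropB (domain bc L) α N) (hρ : ρ ≠ 0)
    (hs : s ∈ sepSquares bc α S k ρ) :
    dirichletForm (domain bc L) (toReal ρ) (spinWave (domain bc L) N k s) = 0 := by
  have hG := domain_connected (bc := bc) (zero_lt_one.trans hL)
  obtain ⟨p, -, hp, -⟩ := hS.exists_mem_supp hρ (sepSquares_subset hs)
  have hflat (j l : Site L) (hjl : (domain bc L).Adj j l) (hj : j ∈ supp ρ) :
      spinWave (domain bc L) N k s j = spinWave (domain bc L) N k s l := by
    by_contra hne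
    have hpos := Nat.two_pow_pos k
    by_cases hjs : j ∈ s
    · have hfar := le_dist_of_spinWave_ne hG hjl hne hjs
      rw [SimpleGraph.dist_self] at hfar
      omega
    · have hnear := dist_le_of_spinWave_ne hG hα hN hB
        (hS.dist_le_of_mem_sepSquare hL hρ hs) hp hjl hne
      have hfar := hS.two_pow_le_dist (by linarith) hρ hs hj hjs hp
      rw [SimpleGraph.dist_comm] at hfar
      omega
  refine dirichletForm_eq_zero _ fun j l hjl => ?_
  by_cases hj : j ∈ supp ρ
  · rw [hflat j l hjl hj, sub_self, mul_zero]
  · by_cases hl : l ∈ supp ρ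
    · rw [hflat l j hjl.symm hl, sub_self, mul_zero]
    · rw [mem_supp, not_not] at hj hl
      rw [toReal, toReal, hj, hl, sub_self, zero_mul]

lemma IsCoverChoice.dirichletForm_spinWave (hL : 1 < L) (hα : 3 / 2 ≤ α)
    (hS : IsCoverChoice bc S) (hN : IsEnsemble N) (hB : PropB (domain bc L) α N) (hρ : ρ ≠ 0)
    (hs : s ∈ sepSquares bc α S k ρ) (hs' : s' ∈ sepSquares bc α S k' ρ)
    (hne : k = k' → s ≠ s') :
    dirichletForm (domain bc L) (spinWave (domain bc L) N k s)
      (spinWave (domain bc L) N k' s') = 0 := by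
  wlog hk : k ≤ k' generalizing k k' s s'
  · rw [dirichletForm_comm]
    exact this hs' hs (fun h => (hne h.symm).symm) (le_of_not_ge hk)
  have hG := domain_connected (bc := bc) (zero_lt_one.trans hL)
  obtain ⟨p, hpρ, hp, hpS⟩ := hS.exists_mem_supp hρ (sepSquares_subset hs)
  obtain ⟨q, -, hq, -⟩ := hS.exists_mem_supp hρ (sepSquares_subset hs')
  refine dirichletForm_eq_zero _ fun j l hjl => ?_
  by_contra hgrad
  rw [mul_eq_zero, not_or, sub_eq_zero, sub_eq_zero] at hgrad
  have hpj := dist_le_of_spinWave_ne hG hα hN hB (hS.dist_le_of_mem_sepSquare hL hρ hs) hp hjl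
    hgrad.1
  have hqj := dist_le_of_spinWave_ne hG hα hN hB (hS.dist_le_of_mem_sepSquare hL hρ hs') hq hjl
    hgrad.2
  have hpos := Nat.two_pow_pos k
  by_cases hps' : p ∈ s'
  · have hlt : k < k' := hk.lt_of_ne fun h => by
      subst h
      exact hpS s' (sepSquares_subset hs') (hne rfl).symm hps'
    have hfar := le_dist_of_spinWave_ne hG hjl hgrad.2 hps'
    have hpow : 2 * 2 ^ k ≤ 2 ^ k' := by
      rw [← pow_succ']
      exact Nat.pow_le_pow_right two_pos hlt
    omega
  · have hfar := hS.two_pow_le_dist (by linarith) hρ hs' hpρ hps' hq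
    have htri := hG.dist_triangle (u := p) (v := j) (w := q)
    rw [SimpleGraph.dist_comm (u := j)] at htri
    have hpow : 2 ^ k ≤ 2 ^ k' := Nat.pow_le_pow_right two_pos hk
    omega

end SeparatedSquares

section EnergyGain

variable {V ι : Type} [Fintype V] (G : SimpleGraph V)

lemma exists_le_pairing_sub_dirichletEnergy {W : Submodule ℝ (V → ℝ)} {I : Finset ι} {f : V → ℝ}
    {w : ι → V → ℝ} {c : ℝ} (hc : 0 < c) (hfW : f ∈ W) (hwW : ∀ i ∈ I, w i ∈ W)
    (hf : dirichletEnergy G f ≤ 8 * pairing f f) (hw : ∀ i ∈ I, dirichletEnergy G (w i) ≤ 1 / c)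
    (hww : (I : Set ι).Pairwise fun i i' => dirichletForm G (w i) (w i') = 0)
    (hfw : ∀ i ∈ I, dirichletForm G f (w i) = 0) (hwf : ∀ i ∈ I, 1 ≤ |pairing (w i) f|) :
    ∃ b ∈ W, 1 / 16 * pairing f f + c / 2 * I.card
      ≤ pairing b f - 1 / 2 * dirichletEnergy G b := by
  set ε : ι → ℝ := fun i => SignType.sign (pairing (w i) f)
  set u : V → ℝ := ∑ i ∈ I, (c * ε i) • w i
  have hε (i : ι) : ε i ^ 2 ≤ 1 := by
    simp only [ε]
    cases SignType.sign (pairing (w i) f) <;> norm_num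
  refine ⟨(1 / 8 : ℝ) • f + u, W.add_mem (W.smul_mem _ hfW)
    (W.sum_mem fun i hi => W.smul_mem _ (hwW i hi)), ?_⟩
  have hcross : dirichletForm G ((1 / 8 : ℝ) • f) u = 0 := by
    rw [map_sum]
    refine Finset.sum_eq_zero fun i hi => ?_
    rw [map_smul, map_smul, LinearMap.smul_apply, hfw i hi, smul_zero, smul_zero]
  have henergy : dirichletEnergy G u ≤ c * I.card :=
    calc dirichletEnergy G u = ∑ i ∈ I, (c * ε i) ^ 2 * dirichletEnergy G (w i) :=
          dirichletEnergy_sum_smul G I _ w hww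
      _ ≤ ∑ i ∈ I, c ^ 2 * (1 / c) := by
          refine Finset.sum_le_sum fun i hi =>
            mul_le_mul ?_ (hw i hi) (dirichletEnergy_nonneg G _) (sq_nonneg c)
          rw [mul_pow]
          exact mul_le_of_le_one_right (sq_nonneg c) (hε i)
      _ = c * I.card := by
          rw [Finset.sum_const, nsmul_eq_mul]
          field_simp
  have hpairing : c * I.card ≤ pairing u f :=
    calc c * I.card = ∑ i ∈ I, c * 1 := by rw [Finset.sum_const, nsmul_eq_mul, mul_one, mul_comm]
      _ ≤ ∑ i ∈ I, c * |pairing (w i) f| := by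
          gcongr with i hi
          exact hwf i hi
      _ = pairing u f := by
          simp only [u, ε, pairing_eq_dotProduct, sum_dotProduct, smul_dotProduct, smul_eq_mul,
            mul_assoc, sign_mul_self]
  have hadd : pairing ((1 / 8 : ℝ) • f + u) f = 1 / 8 * pairing f f + pairing u f := by
    simp only [pairing_eq_dotProduct, add_dotProduct, smul_dotProduct, smul_eq_mul]
  rw [dirichletEnergy_add, hcross, dirichletEnergy_smul, hadd]
  linarith

end EnergyGain

lemma pairing_toReal_self {V : Type} [Fintype V] (ρ : V → ℤ) :
    pairing (toReal ρ) (toReal ρ) = normSq ρ :=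
  Finset.sum_congr rfl fun _ _ => (sq _).symm

lemma exists_mem_waveSpace {bc : BC} {L : ℕ} {S : ℕ → (Site L → ℤ) → Finset (Finset (Site L))}
    {N : Finset (Site L → ℤ)} {ρ : Site L → ℤ} {α : ℝ} (hL : 1 < L) (hα : 3 / 2 ≤ α)
    (hS : IsCoverChoice bc S) (hN : IsEnsemble N) (hB : PropB (domain bc L) α N)
    (hC : PropC (domain bc L) α N) (hρ : ρ ∈ neutral N) :
    ∃ b ∈ waveSpace (domain bc L) N ρ, 1 / 16 * normSq ρ + 1 / 2 ^ 17 * sepTotal bc α S ρ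
      ≤ pairing b (toReal ρ) - 1 / 2 * dirichletEnergy (domain bc L) b := by
  have hα₁ : 1 ≤ α := by linarith
  have hG := domain_connected (bc := bc) (zero_lt_one.trans hL)
  have hρ₀ := hN.1 ρ hρ.1
  let I : Finset (Σ _ : ℕ, Finset (Site L)) :=
    (Finset.range L).sigma fun k => sepSquares bc α S (k + 1) ρ
  let w : (Σ _ : ℕ, Finset (Site L)) → Site L → ℝ := fun i => spinWave (domain bc L) N (i.1 + 1) i.2
  have hI (i) (hi : i ∈ I) : i.2 ∈ sepSquares bc α S (i.1 + 1) ρ := (Finset.mem_sigma.1 hi).2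
  have hwW (i) (hi : i ∈ I) : w i ∈ waveSpace (domain bc L) N ρ := by
    obtain ⟨p, hpρ, hp, -⟩ := hS.exists_mem_supp hρ₀ (sepSquares_subset (hI i hi))
    have hd := hS.two_pow_le_diam hα₁ hρ₀ (hI i hi)
    have hpos := Nat.two_pow_pos (i.1 + 1)
    exact spinWave_mem_waveSpace hG hα hN hB (hS.dist_le_of_mem_sepSquare hL hρ₀ (hI i hi)) hρ hp
      hpρ (by omega)
  have hw (i) (hi : i ∈ I) : dirichletEnergy (domain bc L) (w i) ≤ 1 / (1 / 2 ^ 16) := by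
    obtain ⟨p, -, hp, -⟩ := hS.exists_mem_supp hρ₀ (sepSquares_subset (hI i hi))
    rw [one_div_one_div]
    exact dirichletEnergy_spinWave_le hL hα hN hB
      (hS.dist_le_of_mem_sepSquare hL hρ₀ (hI i hi)) ⟨p, hp⟩
  have hww : (I : Set _).Pairwise fun i i' => dirichletForm (domain bc L) (w i) (w i') = 0 :=
    fun i hi i' hi' hne => hS.dirichletForm_spinWave hL hα hN hB hρ₀ (hI i hi) (hI i' hi')
      fun hk hs => hne (Sigma.ext (Nat.succ_injective hk) (heq_of_eq hs))
  have hf : dirichletEnergy (domain bc L) (toReal ρ) ≤ 8 * pairing (toReal ρ) (toReal ρ) := by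
    refine (dirichletEnergy_le_of_degree_le (fun j => domain_degree_le hL j) _).trans_eq ?_
    rw [pairing_toReal_self, normSq]
    norm_num [toReal]
  obtain ⟨b, hbW, hb⟩ := exists_le_pairing_sub_dirichletEnergy (domain bc L)
    (by positivity) (toReal_mem_waveSpace hG hα₁ hN hB hρ) hwW hf hw hww
    (fun i hi => hS.dirichletForm_toReal_spinWave hL hα hN hB hρ₀ (hI i hi))
    (fun i hi => hS.one_le_abs_pairing_spinWave hL hα hN hB hC hρ (hI i hi))
  refine ⟨b, hbW, le_trans (le_of_eq ?_) hb⟩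
  rw [pairing_toReal_self, hS.sepTotal_eq (zero_lt_one.trans hL) hρ₀, Finset.card_sigma,
    Nat.cast_sum]
  ring

lemma exists_renormalizing_spinWaves {bc : BC} {L : ℕ}
    {S : ℕ → (Site L → ℤ) → Finset (Finset (Site L))} {N : Finset (Site L → ℤ)} {α β : ℝ}
    (hL : 1 < L) (hα : 3 / 2 ≤ α) (hβ : 0 < β) (hS : IsCoverChoice bc S) (hN : IsEnsemble N)
    (hB : PropB (domain bc L) α N) (hC : PropC (domain bc L) α N) :
    ∃ a : (Site L → ℤ) → Site L → ℝ,
      (neutral N).Pairwise (fun ρ ρ' => pairing (a ρ) (toReal ρ') = 0) ∧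
      (neutral N).Pairwise (fun ρ ρ' => dirichletForm (domain bc L) (a ρ) (a ρ') = 0) ∧
      ∀ ρ ∈ neutral N, -pairing (a ρ) (toReal ρ) + β / 2 * dirichletEnergy (domain bc L) (a ρ)
        ≤ -(1 / β) * (1 / 16 * normSq ρ + 1 / 2 ^ 17 * sepTotal bc α S ρ) := by
  have hG := domain_connected (bc := bc) (zero_lt_one.trans hL)
  choose! b hbW hb using fun ρ (hρ : ρ ∈ neutral N) => exists_mem_waveSpace hL hα hS hN hB hC hρ
  have haW (ρ) (hρ : ρ ∈ neutral N) : (1 / β) • b ρ ∈ waveSpace (domain bc L) N ρ :=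
    Submodule.smul_mem _ _ (hbW ρ hρ)
  refine ⟨fun ρ => (1 / β) • b ρ, fun ρ hρ ρ' hρ' hne => ?_, fun ρ hρ ρ' hρ' hne => ?_,
    fun ρ hρ => ?_⟩
  · exact pairing_eq_zero_of_mem_waveSpace hG (by linarith) hN hB hρ hρ' hne (haW ρ hρ)
  · exact dirichletForm_eq_zero_of_mem_waveSpace hG hρ hρ' hne (haW ρ hρ) (haW ρ' hρ')
  · calc -pairing ((1 / β) • b ρ) (toReal ρ)
          + β / 2 * dirichletEnergy (domain bc L) ((1 / β) • b ρ)
        = -(1 / β) * (pairing (b ρ) (toReal ρ) - 1 / 2 * dirichletEnergy (domain bc L) (b ρ)) := by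
          rw [pairing_eq_dotProduct, pairing_eq_dotProduct, smul_dotProduct, smul_eq_mul,
            dirichletEnergy_smul]
          field_simp
          ring
      _ ≤ _ := mul_le_mul_of_nonpos_left (hb ρ hρ) (by simpa using hβ.le)

/-! ### Bounds on the activities -/

section Activities

lemma exp_sq_mul_coeff_le {c Γ κ : ℝ} {m : ℤ} (hm : m ≠ 0)
    (hc : |c| ≤ Γ * Real.exp (κ * (m : ℝ) ^ 2)) :
    Real.exp ((m : ℝ) ^ 2) * |c| ≤ Real.exp ((1 + |Γ| + κ) * (m : ℝ) ^ 2) := by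
  have hm₁ : (1 : ℝ) ≤ (m : ℝ) ^ 2 := by
    exact_mod_cast (one_le_sq_iff_one_le_abs m).2 (Int.one_le_abs hm)
  have hΓ : Γ ≤ Real.exp (|Γ| * (m : ℝ) ^ 2) :=
    calc Γ ≤ |Γ| := le_abs_self Γ
      _ ≤ |Γ| * (m : ℝ) ^ 2 := le_mul_of_one_le_right (abs_nonneg Γ) hm₁
      _ ≤ Real.exp (|Γ| * (m : ℝ) ^ 2) := by linarith [Real.add_one_le_exp (|Γ| * (m : ℝ) ^ 2)]
  calc Real.exp ((m : ℝ) ^ 2) * |c|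
      ≤ Real.exp ((m : ℝ) ^ 2) * (Real.exp (|Γ| * (m : ℝ) ^ 2) * Real.exp (κ * (m : ℝ) ^ 2)) := by
        gcongr
        exact hc.trans (by gcongr)
    _ = Real.exp ((1 + |Γ| + κ) * (m : ℝ) ^ 2) := by
        rw [← Real.exp_add, ← Real.exp_add]
        congr 1
        ring

lemma prod_supp_exp_sq_mul_coeff_le {V : Type} [Fintype V] {Γ κ : ℝ} {c : V → ℕ → ℝ}
    (hc : ∀ j q, 1 ≤ q → |c j q| ≤ Γ * Real.exp (κ * (q : ℝ) ^ 2)) (ρ : V → ℤ) :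
    ∏ j ∈ supp ρ, Real.exp ((ρ j : ℝ) ^ 2) * |c j (ρ j).natAbs|
      ≤ Real.exp ((1 + |Γ| + κ) * normSq ρ) := by
  have hsupp : ∑ j ∈ supp ρ, (ρ j : ℝ) ^ 2 = normSq ρ := by
    refine Finset.sum_subset (Finset.subset_univ _) fun j _ hj => ?_
    rw [mem_supp, not_not] at hj
    simp only [hj, Int.cast_zero, zero_pow two_ne_zero]
  rw [← hsupp, Finset.mul_sum, Real.exp_sum]
  refine Finset.prod_le_prod (fun _ _ => by positivity) fun j hj => ?_
  have hsite := hc j _ (Int.natAbs_pos.2 (mem_supp.1 hj))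
  rw [Nat.cast_natAbs, Int.cast_abs, sq_abs] at hsite
  exact exp_sq_mul_coeff_le (mem_supp.1 hj) hsite

/-- The rate `min (1/16 - θ) 2⁻¹⁷` at which the spin waves beat weights growing like
`exp (θ q² / β)`, with the junk value `1` when `θ ≥ 1/16`. -/
noncomputable def activityRate (θ : ℝ) : ℝ :=
  if θ < 1 / 16 then min (1 / 16 - θ) (1 / 2 ^ 17) else 1

lemma activityRate_pos (θ : ℝ) : 0 < activityRate θ := by
  unfold activityRate
  split_ifs with hθ
  · exact lt_min (by linarith) (by norm_num)
  · exact one_pos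

lemma activityRate_mul_le {θ n s : ℝ} (hθ : θ < 1 / 16) (hn : 0 ≤ n) (hs : 0 ≤ s) :
    activityRate θ * (n + s) ≤ (1 / 16 - θ) * n + 1 / 2 ^ 17 * s := by
  rw [activityRate, if_pos hθ, mul_add]
  gcongr
  · exact min_le_left _ _
  · exact min_le_right _ _

lemma activity_exponent_le {β θ μ C D κ n s A ℓ : ℝ} (hβ : 0 < β) (hμ : 0 < μ) (hC : 0 ≤ C)
    (hD : 0 ≤ D) (hκ : 0 ≤ κ) (hs : 0 ≤ s) (hA : A ≤ C * (n + s)) (hℓ : ℓ ≤ C * (n + s))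
    (hμn : μ * (n + s) ≤ (1 / 16 - θ) * n + 1 / 2 ^ 17 * s) (hns : 0 ≤ n + s)
    (hβμ : D * C + κ ≤ μ / (2 * β)) :
    D * A + (κ + θ / β) * n + -(1 / β) * (1 / 16 * n + 1 / 2 ^ 17 * s)
      ≤ -(μ / (2 * (1 + C)) / β) * (n + ℓ) :=
  calc D * A + (κ + θ / β) * n + -(1 / β) * (1 / 16 * n + 1 / 2 ^ 17 * s)
      = D * A + κ * n - 1 / β * ((1 / 16 - θ) * n + 1 / 2 ^ 17 * s) := by ring
    _ ≤ D * (C * (n + s)) + κ * (n + s) - 1 / β * (μ * (n + s)) := by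
        gcongr
        linarith
    _ = (D * C + κ) * (n + s) - μ / β * (n + s) := by ring
    _ ≤ μ / (2 * β) * (n + s) - μ / β * (n + s) := by gcongr
    _ = -(μ / (2 * (1 + C)) / β * ((1 + C) * (n + s))) := by
        field_simp
        ring
    _ ≤ -(μ / (2 * (1 + C)) / β * (n + ℓ)) := by
        gcongr
        linarith
    _ = -(μ / (2 * (1 + C)) / β) * (n + ℓ) := by ring

/-- The inverse temperature below which the spin-wave gain absorbs the entropy factor
`exp (D₂ A(ρ))` and the single-site weights. -/
noncomputable def betaThreshold (α D₂ Γ η θ : ℝ) : ℝ :=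
  activityRate θ / (2 * (|D₂| * entropyConst α + (1 + |Γ| + |η|)))

lemma betaThreshold_pos {α : ℝ} (hα' : α < 2) (D₂ Γ η θ : ℝ) : 0 < betaThreshold α D₂ Γ η θ := by
  have hμ := activityRate_pos θ
  have hC := entropyConst_pos hα'
  unfold betaThreshold
  positivity

/-- The decay rate of the renormalized activities. -/
noncomputable def activityDecay (α θ : ℝ) : ℝ := activityRate θ / (2 * (1 + entropyConst α))

lemma activityDecay_pos {α : ℝ} (hα' : α < 2) (θ : ℝ) : 0 < activityDecay α θ := by
  have hμ := activityRate_pos θ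
  have hC := entropyConst_pos hα'
  unfold activityDecay
  positivity

lemma coverSum_nonneg (bc : BC) {L : ℕ} (α : ℝ)
    (S : ℕ → (Site L → ℤ) → Finset (Finset (Site L))) (ρ : Site L → ℤ) :
    0 ≤ coverSum bc α S ρ := by
  unfold coverSum
  split_ifs <;> positivity

lemma IsCoverChoice.abs_mul_exp_le {bc : BC} {L : ℕ}
    {S : ℕ → (Site L → ℤ) → Finset (Finset (Site L))} {ρ : Site L → ℤ} {c : Site L → ℕ → ℝ}
    {α β D₂ Γ η θ K : ℝ} (hL : 1 < L) (hα : 1 ≤ α) (hα' : α < 2) (hβ : 0 < β) (hθ : θ < 1 / 16)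
    (hS : IsCoverChoice bc S) (hρ : ρ ≠ 0)
    (hc : ∀ j q, 1 ≤ q → |c j q| ≤ Γ * Real.exp ((η + θ / β) * (q : ℝ) ^ 2))
    (hK : |K| ≤ Real.exp (D₂ * coverSum bc α S ρ) *
      ∏ j ∈ supp ρ, Real.exp ((ρ j : ℝ) ^ 2) * |c j (ρ j).natAbs|)
    (hβ₀ : β < betaThreshold α D₂ Γ η θ) :
    |K| * Real.exp (-(1 / β) * (1 / 16 * normSq ρ + 1 / 2 ^ 17 * sepTotal bc α S ρ))
      ≤ Real.exp (-(activityDecay α θ / β) *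
        (normSq ρ + Real.logb 2 ((diam (domain bc L) ρ : ℝ) + 1))) := by
  have hμ := activityRate_pos θ
  have hC := entropyConst_pos hα'
  have hn : 0 ≤ normSq ρ := Finset.sum_nonneg fun _ _ => sq_nonneg _
  have hs : 0 ≤ sepTotal bc α S ρ := sepTotal_nonneg α
  have hβμ : |D₂| * entropyConst α + (1 + |Γ| + |η|) ≤ activityRate θ / (2 * β) := by
    rw [betaThreshold, lt_div_iff₀ (by positivity)] at hβ₀
    rw [le_div_iff₀ (by positivity)]
    linarith
  have hweights : |K| ≤ Real.exp (|D₂| * coverSum bc α S ρ) *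
      Real.exp ((1 + |Γ| + |η| + θ / β) * normSq ρ) := by
    refine hK.trans (mul_le_mul ?_ ((prod_supp_exp_sq_mul_coeff_le hc ρ).trans ?_)
      (by positivity) (by positivity))
    · exact Real.exp_le_exp.2
        (mul_le_mul_of_nonneg_right (le_abs_self D₂) (coverSum_nonneg bc α S ρ))
    · rw [← add_assoc]
      gcongr
      exact le_abs_self η
  refine (mul_le_mul_of_nonneg_right hweights (Real.exp_pos _).le).trans ?_
  rw [← Real.exp_add, ← Real.exp_add, Real.exp_le_exp]
  exact activity_exponent_le hβ hμ hC.le (abs_nonneg D₂) (by positivity) hs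
    (hS.coverSum_le hL hα hα' hρ) (hS.logb_diam_add_one_le hL hα hα' hρ)
    (activityRate_mul_le hθ hn hs) (by positivity) hβμ

end Activities

end RenormStep

theorem theorem2p3_general (α : ℝ) (hα : 3 / 2 ≤ α) (hα' : α < 2) :
    ∃ D₃ : ℝ, 0 < D₃ ∧
    ∃ β₀ c₁ : ℝ → ℝ → ℝ → ℝ → ℝ,
      (∀ D₂ Γ η θ : ℝ, 0 < β₀ D₂ Γ η θ ∧ 0 < c₁ D₂ Γ η θ) ∧
      ∀ (bc : BC) (L : ℕ), 1 < L →
      ∀ S : ℕ → (Site L → ℤ) → Finset (Finset (Site L)), IsCoverChoice bc S →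
      ∀ (v : Site L) (β : ℝ), 0 < β →
      ∀ N : Finset (Site L → ℤ), IsEnsemble N →
        PropA N → PropB (domain bc L) α N → PropC (domain bc L) α N →
      ∃ a : (Site L → ℤ) → (Site L → ℝ),
      ∀ K : (Site L → ℤ) → ℝ,
      ∃ z : (Site L → ℤ) → ℝ,
        (∀ σ : Site L → ℝ,
          ∫ φ, ∏ ρ ∈ N,
              (1 + K ρ * Real.cos (pairing φ (toReal ρ) + pairing σ (toReal ρ)))
            ∂(gff (domain bc L) β v) =
          ∫ φ, ∏ ρ ∈ N with charge ρ = 0,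
              (1 + z ρ * Real.cos
                (pairing φ (toReal ρ + β • laplacian (domain bc L) (a ρ))
                  + pairing σ (toReal ρ)))
            ∂(gff (domain bc L) β v)) ∧
        (∀ ρ ∈ N, charge ρ = 0 →
          |z ρ| ≤ |K ρ| *
            Real.exp (-(1 / β) * ((1 / 16) * normSq ρ + D₃ * sepTotal bc α S ρ))) ∧
        (∀ D₂ Γ η θ : ℝ, θ < 1 / 16 →
          ∀ c : Site L → ℕ → ℝ,
          (∀ j q, 1 ≤ q → |c j q| ≤ Γ * Real.exp ((η + θ / β) * (q : ℝ) ^ 2)) →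
          PropD bc α D₂ S c N K →
          β < β₀ D₂ Γ η θ →
          ∀ ρ ∈ N, charge ρ = 0 →
            |z ρ| ≤ Real.exp (-(c₁ D₂ Γ η θ / β) *
              (normSq ρ + Real.logb 2 ((diam (domain bc L) ρ : ℝ) + 1)))) := by
  refine ⟨1 / 2 ^ 17, by norm_num, betaThreshold α, fun _ _ _ θ => activityDecay α θ,
    fun D₂ Γ η θ => ⟨betaThreshold_pos hα' D₂ Γ η θ, activityDecay_pos hα' θ⟩, ?_⟩
  intro bc L hL S hS v β hβ N hN hA hB hC
  have hG : (domain bc L).Connected := domain_connected (zero_lt_one.trans hL)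
  obtain ⟨a, hag, haa, hgain⟩ := exists_renormalizing_spinWaves hL hα hβ hS hN hB hC
  have hz (K : (Site L → ℤ) → ℝ) (ρ : Site L → ℤ) (hρ : ρ ∈ N) (hQ : charge ρ = 0) :
      |K ρ * Real.exp (-pairing (a ρ) (toReal ρ)
        + β / 2 * dirichletEnergy (domain bc L) (a ρ))| ≤ |K ρ| *
          Real.exp (-(1 / β) * (1 / 16 * normSq ρ + 1 / 2 ^ 17 * sepTotal bc α S ρ)) := by
    rw [abs_mul, Real.abs_exp]
    gcongr
    exact hgain ρ ⟨hρ, hQ⟩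
  refine ⟨a, fun K => ⟨_, fun σ => integral_gff_renormalize hG hβ v hA hag haa K
    fun ρ => pairing σ (toReal ρ), hz K, ?_⟩⟩
  intro D₂ Γ η θ hθ c hc hD hβ₀ ρ hρ hQ
  exact (hz K ρ hρ hQ).trans
    (hS.abs_mul_exp_le hL (by linarith) hα' hβ hθ (hN.1 ρ hρ) hc (hD ρ hρ hQ) hβ₀)

theorem theorem2p3 (α : ℝ) (hα : 3 / 2 < α) (hα' : α < 2) :
    ∃ D₃ : ℝ, 0 < D₃ ∧
    -- `β₀` and `c₁` are functions of `D₂, Γ, η, θ`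
    ∃ β₀ c₁ : ℝ → ℝ → ℝ → ℝ → ℝ,
      (∀ D₂ Γ η θ : ℝ, 0 < β₀ D₂ Γ η θ ∧ 0 < c₁ D₂ Γ η θ) ∧
      ∀ (bc : BC) (L : ℕ), Admissible bc L →
      ∀ S : ℕ → (Site L → ℤ) → Finset (Finset (Site L)), IsCoverChoice bc S →
      ∀ (v : Site L) (β : ℝ), 0 < β →
      ∀ N : Finset (Site L → ℤ), IsEnsemble N →
        PropA N → PropB (domain bc L) α N → PropC (domain bc L) α N →
      ∃ a : (Site L → ℤ) → (Site L → ℝ),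
      ∀ K : (Site L → ℤ) → ℝ,
      ∃ z : (Site L → ℤ) → ℝ,
        (∀ σ : Site L → ℝ,
          ∫ φ, ∏ ρ ∈ N,
              (1 + K ρ * Real.cos (pairing φ (toReal ρ) + pairing σ (toReal ρ)))
            ∂(gff (domain bc L) β v) =
          ∫ φ, ∏ ρ ∈ N with charge ρ = 0,
              (1 + z ρ * Real.cos
                (pairing φ (toReal ρ + β • laplacian (domain bc L) (a ρ))
                  + pairing σ (toReal ρ)))
            ∂(gff (domain bc L) β v)) ∧
        (∀ ρ ∈ N, charge ρ = 0 →
          |z ρ| ≤ |K ρ| *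
            Real.exp (-(1 / β) * ((1 / 16) * normSq ρ + D₃ * sepTotal bc α S ρ))) ∧
        (∀ D₂ Γ η θ : ℝ, 0 < D₂ → 0 < Γ → 0 ≤ θ → θ < 1 / 16 →
          ∀ (lam : Site L → ℝ → ℝ) (c : Site L → ℕ → ℝ),
          (∀ j, IsSubGaussian β Γ η θ (lam j) (c j)) →
          PropD bc α D₂ S c N K →
          β < β₀ D₂ Γ η θ →
          ∀ ρ ∈ N, charge ρ = 0 →
            |z ρ| ≤ Real.exp (-(c₁ D₂ Γ η θ / β) *
              (normSq ρ + Real.logb 2 ((diam (domain bc L) ρ : ℝ) + 1)))) := by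
  obtain ⟨D₃, hD₃, β₀, c₁, hpos, h⟩ := theorem2p3_general α hα.le hα'
  exact ⟨D₃, hD₃, β₀, c₁, hpos, fun bc L hL S hS v β hβ N hN hA hB hC =>
    (h bc L hL.one_lt S hS v β hβ N hN hA hB hC).imp fun _ ha K => (ha K).imp fun _ hz =>
      ⟨hz.1, hz.2.1, fun D₂ Γ η θ _ _ _ hθ _ c hsub =>
        hz.2.2 D₂ Γ η θ hθ c fun j => (hsub j).2⟩⟩
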